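/- Let $n\ge 1$ be an integer and let $(\mathcal C,\mathbb E,\mathfrak s)$ be an $n$-exangulated category in the sense of Herschend–Liu–Nakaoka: $\mathcal C$ is an additive category, $\mathbb E\colon\mathcal C^{\mathrm{op}}\times\mathcal C\to\mathsf{Ab}$ is a biadditive functor, and $\mathfrak s$ is an exact realisation of $\mathbb E$ (axioms (R0)–(R2)), such that (EA1), (EA2) and (EA2)$^{\mathrm{op}}$ hold. For $\delta\in\mathbb E(C,A)$ one writes $\mathfrak s(\delta)=[X_\bullet]$, where $X_\bullet$ is a complex $A=X_0\to X_1\to\cdots\to X_{n+1}=C$ and $[X_\bullet]$ is its isomorphism class in the category of such complexes with the ends $A,C$ fixed, with morphisms the homotopy classes of chain maps that are the identity on $A$ and on $C$. Write $a_*=\mathbb E(-,a)$ and $c^*=\mathbb E(c,-)$. **Constructions.** Let $\widetilde{\mathcal C}$ be the idempotent completion of $\mathcal C$: its objects are pairs $(X,e)$ with $e=e^2\in\operatorname{End}_{\mathcal C}(X)$, and a morphism $(X,e)\to(Y,e')$ is a morphism $r\colon X\to Y$ with $e'r=r=re$. Put $$\mathbb F((X',e'),(X,e))=\{\delta\in\mathbb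 E(X',X) : e_*\delta=\delta=(e')^*\delta\},$$ with $\mathbb F(c,a)$ the restriction of $\mathbb E(c,a)$. For $\delta\in\mathbb F((X',e'),(X,e))$ choose $X_\bullet$ with $\mathfrak s(\delta)=[X_\bullet]$ and an idempotent chain endomorphism $e_\bullet$ of $X_\bullet$ with $e_0=e$ and $e_{n+1}=e'$, and let $\mathfrak t(\delta)$ be the class of the complex in $\widetilde{\mathcal C}$ with terms $(X_i,e_i)$ and differentials $e_{i+1}d_ie_i$. Let $\widehat{\mathcal C}\subseteq\widetilde{\mathcal C}$ be the full subcategory of those $(X,e)$ for which $\mathrm{id}_X-e$ is a split idempotent in $\mathcal C$, i.e. $\mathrm{id}_X-e=sr$ with $rs=\mathrm{id}_Y$ for some $r\colon X\to Y$, $s\colon Y\to X$. Let $\mathbb G$ be the restriction of $\mathbb F$ to $\widehat{\mathcal C}^{\mathrm{op}}\times\widehat{\mathcal C}$, and put $\mathfrak r(\delta)=[\widetilde X_\bullet]$ if $\widetilde X_\bullet$ is a complex in $\widehat{\mathcal C}$ with $\mathfrak t(\delta)=[\widetilde X_\bullet]$. Let $\mathscr K_{\mathcal C}\colon\mathcal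 C\to\widehat{\mathcal C}$, $X\mapsto(X,\mathrm{id}_X)$, be the inclusion and let $\Delta\colon\mathbb E(-,-)\Rightarrow\mathbb G(\mathscr K_{\mathcal C}-,\mathscr K_{\mathcal C}-)$ be given by $\delta\mapsto\delta$. **Terminology.** An additive category is weakly idempotent complete if every retraction in it has a kernel; an $n$-exangulated category is so if its underlying category is. An $n$-exangulated functor $(\mathscr F,\Lambda)\colon(\mathcal C,\mathbb E,\mathfrak s)\to(\mathcal C',\mathbb E',\mathfrak s')$ is an additive functor $\mathscr F$ with a natural transformation $\Lambda\colon\mathbb E(-,-)\Rightarrow\mathbb E'(\mathscr F-,\mathscr F-)$ such that $\mathfrak s(\delta)=[X_\bullet]$ implies $\mathfrak s'(\Lambda(\delta))=[\mathscr F(X_\bullet)]$; composition is $(\mathscr L,\Phi)\circ(\mathscr F,\Lambda)=(\mathscr L\mathscr F,\Phi_{\mathscr F\times\mathscr F}\Lambda)$. A natural transformation $\beta\colon\mathscr F\Rightarrow\mathscr G$ is $n$-exangulated from $(\mathscr F,\Lambda)$ to $(\mathscr G,\Theta)$ if $(\beta_A)_*\Lambda(\delta)=(\beta_C)^*\Theta(\delta)$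 for all $\delta\in\mathbb E(C,A)$; it is an $n$-exangulated natural isomorphism if it has an $n$-exangulated inverse. **Theorem.** 1. $(\widetilde{\mathcal C},\mathbb F,\mathfrak t)$ is an $n$-exangulated category, and $\widehat{\mathcal C}$ is extension-closed in it: for all $A,C\in\widehat{\mathcal C}$ and $\delta\in\mathbb F(C,A)$ there is a complex $X_\bullet$ with $\mathfrak t(\delta)=[X_\bullet]$ and $X_i\in\widehat{\mathcal C}$ for $1\le i\le n$. 2. $(\widehat{\mathcal C},\mathbb G,\mathfrak r)$ is a weakly idempotent complete $n$-exangulated category. 3. $(\mathscr K_{\mathcal C},\Delta)\colon(\mathcal C,\mathbb E,\mathfrak s)\to(\widehat{\mathcal C},\mathbb G,\mathfrak r)$ is an $n$-exangulated functor, and it is $2$-universal: for every $n$-exangulated functor $(\mathscr F,\Lambda)\colon(\mathcal C,\mathbb E,\mathfrak s)\to(\mathcal C',\mathbb E',\mathfrak s')$ to a weakly idempotent complete $n$-exangulated category, - (i) there are an $n$-exangulated functor $(\mathscr E,\Psi)\colon(\widehat{\mathcal C},\mathbb G,\mathfrak r)\to(\mathcal C',\mathbb E',\mathfrak s')$ and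 an $n$-exangulated natural isomorphism $(\mathscr F,\Lambda)\Rightarrow(\mathscr E,\Psi)\circ(\mathscr K_{\mathcal C},\Delta)$; - (ii) for all $n$-exangulated functors $(\mathscr G,\Theta),(\mathscr H,\Phi)\colon(\widehat{\mathcal C},\mathbb G,\mathfrak r)\to(\mathcal C',\mathbb E',\mathfrak s')$ and all $n$-exangulated natural isomorphisms $\beta\colon(\mathscr F,\Lambda)\Rightarrow(\mathscr G,\Theta)\circ(\mathscr K_{\mathcal C},\Delta)$ and $\gamma\colon(\mathscr F,\Lambda)\Rightarrow(\mathscr H,\Phi)\circ(\mathscr K_{\mathcal C},\Delta)$ there is a unique $n$-exangulated natural isomorphism $\mu\colon(\mathscr G,\Theta)\Rightarrow(\mathscr H,\Phi)$ with $\gamma=\mu_{\mathscr K_{\mathcal C}}\,\beta$. -/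

import Mathlib

open CategoryTheory CategoryTheory.Limits CategoryTheory.Idempotents Opposite

universe w v u w' v' u' w'' v'' u''

noncomputable section

namespace NExang

/-! ### Complexes concentrated in degrees `0, …, n + 1` -/

/-- The shape of the complexes `X₀ ⟶ X₁ ⟶ ⋯ ⟶ Xₙ₊₁`. -/
def nShape (n : ℕ) : ComplexShape (Fin (n + 2)) where
  Rel i j := i.val + 1 = j.val
  next_eq h h' := Fin.ext (h.symm.trans h')
  prev_eq h h' := Fin.ext (Nat.succ_injective (h.trans h'.symm))

section Complexes

variable {𝒞 : Type u} [Category.{v} 𝒞] [Preadditive 𝒞] {n : ℕ}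
variable {𝒟 : Type u'} [Category.{v'} 𝒟] [Preadditive 𝒟]

/-- A complex `X₀ ⟶ X₁ ⟶ ⋯ ⟶ Xₙ₊₁` whose end terms are identified with `A` and `C`.
The identifications are recorded as isomorphisms `X₀ ≅ A` and `Xₙ₊₁ ≅ C`. (Every such complex
is isomorphic, compatibly with the identifications, to one with `X₀ = A` and `Xₙ₊₁ = C`, where
the identifications are identities.) -/
structure NComplex (n : ℕ) (A C : 𝒞) where
  /-- the complex -/
  K : HomologicalComplex 𝒞 (nShape n)
  /-- the identification of the first term -/
  left : K.X 0 ≅ A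
  /-- the identification of the last term -/
  right : K.X (Fin.last (n + 1)) ≅ C

namespace NComplex

variable {A B C D : 𝒞}

/-- The first differential `d₀ : A ⟶ X₁`. -/
def dFirst (X : NComplex n A C) : A ⟶ X.K.X 1 :=
  X.left.inv ≫ X.K.d 0 1

/-- The last differential `dₙ : Xₙ ⟶ C`. -/
def dLast (X : NComplex n A C) : X.K.X (Fin.last n).castSucc ⟶ C :=
  X.K.d (Fin.last n).castSucc (Fin.last (n + 1)) ≫ X.right.hom

/-- The morphism of complexes `f` satisfies `f₀ = a` and `fₙ₊₁ = c`, up to the identifications of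
the end terms. -/
structure IsLift (X : NComplex n A C) (Y : NComplex n B D) (f : X.K ⟶ Y.K)
    (a : A ⟶ B) (c : C ⟶ D) : Prop where
  left : f.f 0 ≫ Y.left.hom = X.left.hom ≫ a
  right : f.f (Fin.last (n + 1)) ≫ Y.right.hom = X.right.hom ≫ c

/-- `X` and `Y` are isomorphic in the category whose objects are the complexes with end terms `A`
and `C` and whose morphisms are the homotopy classes of those morphisms of complexes which are the
identity on `A` and on `C`. -/
def HtpyEquiv (X Y : NComplex n A C) : Prop :=
  ∃ (f : X.K ⟶ Y.K) (g : Y.K ⟶ X.K),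
    IsLift X Y f (𝟙 A) (𝟙 C) ∧ IsLift Y X g (𝟙 A) (𝟙 C) ∧
    Nonempty (Homotopy (f ≫ g) (𝟙 X.K)) ∧ Nonempty (Homotopy (g ≫ f) (𝟙 Y.K))

/-- The image of a complex under a functor. -/
def map (F : 𝒞 ⥤ 𝒟) [F.PreservesZeroMorphisms] (X : NComplex n A C) :
    NComplex n (F.obj A) (F.obj C) where
  K := (F.mapHomologicalComplex (nShape n)).obj X.K
  left := F.mapIso X.left
  right := F.mapIso X.right

section Triv

variable [HasZeroObject 𝒞]

/-- The complex `A = A ⟶ 0 ⟶ ⋯ ⟶ 0 ⟶ Z` with `A` in degrees `0` and `1`,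
where `Z` is a zero object. -/
def trivFirst (hn : 1 ≤ n) (A : 𝒞) {Z : 𝒞} (hZ : IsZero Z) : NComplex n A Z where
  K := HomologicalComplex.double (c := nShape n) (i₀ := 0) (i₁ := 1) (𝟙 A) (by simp [nShape])
  left := HomologicalComplex.doubleXIso₀ _ _
  right := (HomologicalComplex.isZero_double_X _ _ _ (by simp [Fin.ext_iff])
    (by simp [Fin.ext_iff]; omega)).iso hZ

/-- The complex `Z ⟶ 0 ⟶ ⋯ ⟶ 0 ⟶ A = A` with `A` in degrees `n` and `n + 1`,
where `Z` is a zero object. -/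
def trivLast (hn : 1 ≤ n) (A : 𝒞) {Z : 𝒞} (hZ : IsZero Z) : NComplex n Z A where
  K := HomologicalComplex.double (c := nShape n) (i₀ := (Fin.last n).castSucc)
    (i₁ := Fin.last (n + 1)) (𝟙 A) (by simp [nShape])
  left := (HomologicalComplex.isZero_double_X _ _ _ (by simp [Fin.ext_iff]; omega)
    (by simp [Fin.ext_iff])).iso hZ
  right := HomologicalComplex.doubleXIso₁ _ _ (by simp [Fin.ext_iff])

end Triv

end NComplex

/-- Morphisms which exhibit `M` as the biproduct `P ⊕ Q`. -/
structure BiprodData (P Q M : 𝒞) where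
  inl : P ⟶ M
  inr : Q ⟶ M
  fst : M ⟶ P
  snd : M ⟶ Q
  inl_fst : inl ≫ fst = 𝟙 P
  inl_snd : inl ≫ snd = 0
  inr_fst : inr ≫ fst = 0
  inr_snd : inr ≫ snd = 𝟙 Q
  total : fst ≫ inl + snd ≫ inr = 𝟙 M

/-- Data exhibiting the complex `M` as the mapping cone of `f : X ⟶ Y`, that is
`X₁ ⟶ X₂ ⊕ Y₁ ⟶ X₃ ⊕ Y₂ ⟶ ⋯ ⟶ Xₙ₊₁ ⊕ Yₙ ⟶ Yₙ₊₁`, with the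
differentials (as matrices acting on columns) `[-d₁; f₁]`, then
`[-dᵢ₊₁, 0; fᵢ₊₁, dᵢ]` for `1 ≤ i ≤ n - 1`, and finally `[fₙ₊₁, dₙ]`.
It is used when `n ≥ 1` and `f₀` is an identity. -/
structure MappingCone {A B C D : 𝒞} {X : NComplex n A C} {Y : NComplex n B D}
    (f : X.K ⟶ Y.K) (M : NComplex n (X.K.X 1) D) where
  /-- `M i = X (i + 1) ⊕ Y i` for `1 ≤ i ≤ n` -/
  biprod : ∀ {i j : Fin (n + 2)}, (nShape n).Rel i j → i ≠ 0 →
    BiprodData (X.K.X j) (Y.K.X i) (M.K.X i)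
  first_fst : ∀ {j : Fin (n + 2)} (h : (nShape n).Rel 1 j) (h0 : (1 : Fin (n + 2)) ≠ 0),
    M.dFirst ≫ (biprod h h0).fst = -X.K.d 1 j
  first_snd : ∀ {j : Fin (n + 2)} (h : (nShape n).Rel 1 j) (h0 : (1 : Fin (n + 2)) ≠ 0),
    M.dFirst ≫ (biprod h h0).snd = f.f 1
  inl_d_fst : ∀ {i j k : Fin (n + 2)} (hij : (nShape n).Rel i j) (hjk : (nShape n).Rel j k)
    (hi : i ≠ 0) (hj : j ≠ 0),
    (biprod hij hi).inl ≫ M.K.d i j ≫ (biprod hjk hj).fst = -X.K.d j k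
  inl_d_snd : ∀ {i j k : Fin (n + 2)} (hij : (nShape n).Rel i j) (hjk : (nShape n).Rel j k)
    (hi : i ≠ 0) (hj : j ≠ 0),
    (biprod hij hi).inl ≫ M.K.d i j ≫ (biprod hjk hj).snd = f.f j
  inr_d_fst : ∀ {i j k : Fin (n + 2)} (hij : (nShape n).Rel i j) (hjk : (nShape n).Rel j k)
    (hi : i ≠ 0) (hj : j ≠ 0),
    (biprod hij hi).inr ≫ M.K.d i j ≫ (biprod hjk hj).fst = 0
  inr_d_snd : ∀ {i j k : Fin (n + 2)} (hij : (nShape n).Rel i j) (hjk : (nShape n).Rel j k)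
    (hi : i ≠ 0) (hj : j ≠ 0),
    (biprod hij hi).inr ≫ M.K.d i j ≫ (biprod hjk hj).snd = Y.K.d i j
  inl_last : ∀ (h : (nShape n).Rel (Fin.last n).castSucc (Fin.last (n + 1)))
    (h0 : (Fin.last n).castSucc ≠ 0),
    (biprod h h0).inl ≫ M.dLast = f.f (Fin.last (n + 1)) ≫ Y.right.hom
  inr_last : ∀ (h : (nShape n).Rel (Fin.last n).castSucc (Fin.last (n + 1)))
    (h0 : (Fin.last n).castSucc ≠ 0),
    (biprod h h0).inr ≫ M.dLast = Y.dLast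

/-- Data exhibiting the complex `N` as the mapping cocone of `f : X ⟶ Y` (this is the
mapping cone of `f` seen as a morphism in the opposite category), that is
`X₀ ⟶ Y₀ ⊕ X₁ ⟶ Y₁ ⊕ X₂ ⟶ ⋯ ⟶ Yₙ₋₁ ⊕ Xₙ ⟶ Yₙ`, with the
differentials (as matrices acting on columns) `[f₀; d₀]`, then
`[-dᵢ₋₁, fᵢ; 0, dᵢ]` for `1 ≤ i ≤ n - 1`, and finally `[-dₙ₋₁, fₙ]`.
It is used when `n ≥ 1` and `fₙ₊₁` is an identity. -/
structure MappingCocone {A B C D : 𝒞} {X : NComplex n A C} {Y : NComplex n B D}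
    (f : X.K ⟶ Y.K) (N : NComplex n A (Y.K.X (Fin.last n).castSucc)) where
  /-- `N j = Y (j - 1) ⊕ X j` for `1 ≤ j ≤ n` -/
  biprod : ∀ {i j : Fin (n + 2)}, (nShape n).Rel i j → j ≠ Fin.last (n + 1) →
    BiprodData (Y.K.X i) (X.K.X j) (N.K.X j)
  first_fst : ∀ (h : (nShape n).Rel 0 1) (h1 : (1 : Fin (n + 2)) ≠ Fin.last (n + 1)),
    N.dFirst ≫ (biprod h h1).fst = X.left.inv ≫ f.f 0
  first_snd : ∀ (h : (nShape n).Rel 0 1) (h1 : (1 : Fin (n + 2)) ≠ Fin.last (n + 1)),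
    N.dFirst ≫ (biprod h h1).snd = X.dFirst
  inl_d_fst : ∀ {i j k : Fin (n + 2)} (hij : (nShape n).Rel i j) (hjk : (nShape n).Rel j k)
    (hj : j ≠ Fin.last (n + 1)) (hk : k ≠ Fin.last (n + 1)),
    (biprod hij hj).inl ≫ N.K.d j k ≫ (biprod hjk hk).fst = -Y.K.d i j
  inl_d_snd : ∀ {i j k : Fin (n + 2)} (hij : (nShape n).Rel i j) (hjk : (nShape n).Rel j k)
    (hj : j ≠ Fin.last (n + 1)) (hk : k ≠ Fin.last (n + 1)),
    (biprod hij hj).inl ≫ N.K.d j k ≫ (biprod hjk hk).snd = 0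
  inr_d_fst : ∀ {i j k : Fin (n + 2)} (hij : (nShape n).Rel i j) (hjk : (nShape n).Rel j k)
    (hj : j ≠ Fin.last (n + 1)) (hk : k ≠ Fin.last (n + 1)),
    (biprod hij hj).inr ≫ N.K.d j k ≫ (biprod hjk hk).fst = f.f j
  inr_d_snd : ∀ {i j k : Fin (n + 2)} (hij : (nShape n).Rel i j) (hjk : (nShape n).Rel j k)
    (hj : j ≠ Fin.last (n + 1)) (hk : k ≠ Fin.last (n + 1)),
    (biprod hij hj).inr ≫ N.K.d j k ≫ (biprod hjk hk).snd = X.K.d j k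
  inl_last : ∀ {i : Fin (n + 2)} (h : (nShape n).Rel i (Fin.last n).castSucc)
    (h1 : (Fin.last n).castSucc ≠ Fin.last (n + 1)),
    (biprod h h1).inl ≫ N.dLast = -Y.K.d i (Fin.last n).castSucc
  inr_last : ∀ {i : Fin (n + 2)} (h : (nShape n).Rel i (Fin.last n).castSucc)
    (h1 : (Fin.last n).castSucc ≠ Fin.last (n + 1)),
    (biprod h h1).inr ≫ N.dLast = f.f (Fin.last n).castSucc

end Complexes

/-! ### Extensions -/

section Extensions

variable {𝒞 : Type u} [Category.{v} 𝒞]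

/-- The group `𝔼(C, A)` of extensions. -/
abbrev Ext (E : 𝒞ᵒᵖ ⥤ 𝒞 ⥤ AddCommGrpCat.{w}) (C A : 𝒞) : Type w :=
  (E.obj (op C)).obj A

/-- The map `a_* : 𝔼(C, A) → 𝔼(C, B)` induced by `a : A ⟶ B`. -/
def push (E : 𝒞ᵒᵖ ⥤ 𝒞 ⥤ AddCommGrpCat.{w}) {A B C : 𝒞} (a : A ⟶ B) : Ext E C A →+ Ext E C B :=
  ((E.obj (op C)).map a).hom

/-- The map `c^* : 𝔼(C, A) → 𝔼(D, A)` induced by `c : D ⟶ C`. -/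
def pull (E : 𝒞ᵒᵖ ⥤ 𝒞 ⥤ AddCommGrpCat.{w}) {A C D : 𝒞} (c : D ⟶ C) : Ext E C A →+ Ext E D A :=
  ((E.map c.op).app A).hom

variable (E : 𝒞ᵒᵖ ⥤ 𝒞 ⥤ AddCommGrpCat.{w})

lemma push_comp {A B B' C : 𝒞} (a : A ⟶ B) (b : B ⟶ B') (δ : Ext E C A) :
    push E (a ≫ b) δ = push E b (push E a δ) := by
  simp [push]

lemma push_id {A C : 𝒞} (δ : Ext E C A) : push E (𝟙 A) δ = δ := by
  simp [push]

lemma pull_comp {A C D D' : 𝒞} (c : D ⟶ C) (d : D' ⟶ D) (δ : Ext E C A) :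
    pull E (d ≫ c) δ = pull E d (pull E c δ) := by
  simp [pull]

lemma pull_id {A C : 𝒞} (δ : Ext E C A) : pull E (𝟙 C) δ = δ := by
  simp [pull]

lemma push_pull {A B C D : 𝒞} (a : A ⟶ B) (c : D ⟶ C) (δ : Ext E C A) :
    push E a (pull E c δ) = pull E c (push E a δ) :=
  (ConcreteCategory.congr_hom ((E.map c.op).naturality a) δ).symm

end Extensions

/-! ### `n`-exangulated categories -/

/-- The data `(𝔼, 𝔰)` on a category `𝒞`. The relation `Realises δ X` stands for
`𝔰(δ) = [X]`. -/
structure ExtensionStructure (𝒞 : Type u) [Category.{v} 𝒞] [Preadditive 𝒞] (n : ℕ) where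
  /-- the bifunctor `𝔼` -/
  E : 𝒞ᵒᵖ ⥤ 𝒞 ⥤ AddCommGrpCat.{w}
  /-- the relation `𝔰(δ) = [X]` -/
  Realises : ∀ {A C : 𝒞}, Ext E C A → NComplex n A C → Prop

namespace ExtensionStructure

section Defs

variable {𝒞 : Type u} [Category.{v} 𝒞] [Preadditive 𝒞] {n : ℕ} (S : ExtensionStructure.{w} 𝒞 n)

/-- The pair `⟨X, δ⟩` is an `n`-exangle: it is an `𝔼`-attached complex, and the sequences
`𝒞(-, X₀) ⟶ ⋯ ⟶ 𝒞(-, Xₙ₊₁) ⟶ 𝔼(-, X₀)` and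
`𝒞(Xₙ₊₁, -) ⟶ ⋯ ⟶ 𝒞(X₀, -) ⟶ 𝔼(Xₙ₊₁, -)` are exact (the composites of
consecutive maps vanish because `X` is an attached complex). -/
structure IsExangle {A C : 𝒞} (δ : Ext S.E C A) (X : NComplex n A C) : Prop where
  push_dFirst : push S.E X.dFirst δ = 0
  pull_dLast : pull S.E X.dLast δ = 0
  exact_hom_from : ∀ {i j k : Fin (n + 2)}, (nShape n).Rel i j → (nShape n).Rel j k →
    ∀ {T : 𝒞} (x : T ⟶ X.K.X j), x ≫ X.K.d j k = 0 → ∃ y : T ⟶ X.K.X i, y ≫ X.K.d i j = x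
  exact_hom_from_last : ∀ {T : 𝒞} (x : T ⟶ C), pull S.E x δ = 0 →
    ∃ y : T ⟶ X.K.X (Fin.last n).castSucc, y ≫ X.dLast = x
  exact_hom_to : ∀ {i j k : Fin (n + 2)}, (nShape n).Rel i j → (nShape n).Rel j k →
    ∀ {T : 𝒞} (x : X.K.X j ⟶ T), X.K.d i j ≫ x = 0 → ∃ y : X.K.X k ⟶ T, X.K.d j k ≫ y = x
  exact_hom_to_first : ∀ {T : 𝒞} (x : A ⟶ T), push S.E x δ = 0 →
    ∃ y : X.K.X 1 ⟶ T, X.dFirst ≫ y = x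

/-- `f` is an `𝔰`-inflation: it is the first differential of a complex realising some extension. -/
def IsInflation {A B : 𝒞} (f : A ⟶ B) : Prop :=
  ∃ (C : 𝒞) (δ : Ext S.E C A) (X : NComplex n A C) (β : X.K.X 1 ≅ B),
    S.Realises δ X ∧ X.dFirst ≫ β.hom = f

/-- `g` is an `𝔰`-deflation: it is the last differential of a complex realising some extension. -/
def IsDeflation {B C : 𝒞} (g : B ⟶ C) : Prop :=
  ∃ (A : 𝒞) (δ : Ext S.E C A) (X : NComplex n A C) (β : X.K.X (Fin.last n).castSucc ≅ B),
    S.Realises δ X ∧ β.inv ≫ X.dLast = g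

/-- `(𝒞, 𝔼, 𝔰)` is an `n`-exangulated category. -/
structure IsNExangulated : Prop where
  one_le : 1 ≤ n
  /-- `𝒞` is an additive category -/
  [additive : HasFiniteBiproducts 𝒞]
  /-- `𝔼` is biadditive -/
  additive_fst : S.E.Additive
  additive_snd : ∀ C : 𝒞ᵒᵖ, (S.E.obj C).Additive
  /-- to each extension, `𝔰` assigns an isomorphism class of complexes -/
  isClass : ∀ {A C : 𝒞} (δ : Ext S.E C A),
    ∃ X : NComplex n A C, ∀ Y : NComplex n A C, S.Realises δ Y ↔ X.HtpyEquiv Y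
  /-- (R0) -/
  exists_lift : ∀ {A B C D : 𝒞} (δ : Ext S.E C A) (ρ : Ext S.E D B) (a : A ⟶ B) (c : C ⟶ D),
    push S.E a δ = pull S.E c ρ →
    ∀ (X : NComplex n A C) (Y : NComplex n B D), S.Realises δ X → S.Realises ρ Y →
    ∃ f : X.K ⟶ Y.K, X.IsLift Y f a c
  /-- (R1) -/
  isExangle : ∀ {A C : 𝒞} (δ : Ext S.E C A) (X : NComplex n A C),
    S.Realises δ X → S.IsExangle δ X
  /-- (R2) -/
  realises_trivFirst : ∀ (A : 𝒞) {Z : 𝒞} (hZ : IsZero Z),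
    S.Realises (0 : Ext S.E Z A) (NComplex.trivFirst one_le A hZ)
  realises_trivLast : ∀ (A : 𝒞) {Z : 𝒞} (hZ : IsZero Z),
    S.Realises (0 : Ext S.E A Z) (NComplex.trivLast one_le A hZ)
  /-- (EA1) -/
  inflation_comp : ∀ {A B C : 𝒞} (f : A ⟶ B) (g : B ⟶ C),
    S.IsInflation f → S.IsInflation g → S.IsInflation (f ≫ g)
  deflation_comp : ∀ {A B C : 𝒞} (f : A ⟶ B) (g : B ⟶ C),
    S.IsDeflation f → S.IsDeflation g → S.IsDeflation (f ≫ g)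
  /-- (EA2) -/
  exists_cone : ∀ {A C D : 𝒞} (δ : Ext S.E D A) (c : C ⟶ D)
    (Y : NComplex n A C) (X : NComplex n A D),
    S.Realises (pull S.E c δ) Y → S.Realises δ X →
    ∃ f : Y.K ⟶ X.K, Y.IsLift X f (𝟙 A) c ∧
      ∃ M : NComplex n (Y.K.X 1) D, Nonempty (MappingCone f M) ∧
        S.Realises (push S.E Y.dFirst δ) M
  /-- the dual of (EA2) -/
  exists_cocone : ∀ {A B C : 𝒞} (δ : Ext S.E C A) (a : A ⟶ B)
    (X : NComplex n A C) (Y : NComplex n B C),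
    S.Realises δ X → S.Realises (push S.E a δ) Y →
    ∃ f : X.K ⟶ Y.K, X.IsLift Y f a (𝟙 C) ∧
      ∃ N : NComplex n A (Y.K.X (Fin.last n).castSucc), Nonempty (MappingCocone f N) ∧
        S.Realises (pull S.E Y.dLast δ) N

/-- The full subcategory on the objects satisfying `P` is extension-closed: every extension
between objects satisfying `P` is realised by a complex whose middle terms satisfy `P`. -/
def IsExtensionClosed (P : ObjectProperty 𝒞) : Prop :=
  ∀ ⦃A C : 𝒞⦄, P A → P C → ∀ δ : Ext S.E C A,
    ∃ X : NComplex n A C, S.Realises δ X ∧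
      ∀ i : Fin (n + 2), i ≠ 0 → i ≠ Fin.last (n + 1) → P (X.K.X i)

/-- The restriction of `(𝔼, 𝔰)` to a full subcategory. An extension is realised in the
subcategory by those complexes of the subcategory which realise it in the ambient category. -/
def restrict (P : ObjectProperty 𝒞) : ExtensionStructure.{w} P.FullSubcategory n where
  E := P.ι.op ⋙ S.E ⋙ (Functor.whiskeringLeft _ _ _).obj P.ι
  Realises {A C} δ X := S.Realises (A := A.obj) (C := C.obj) δ (X.map P.ι)

end Defs

end ExtensionStructure

/-! ### Functors and natural transformations -/

/-- A pair `(F, Γ)` of an additive functor `F` and a natural transformation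
`Γ : 𝔼(-, -) ⟶ 𝔼'(F -, F -)`. -/
structure ExtensionFunctor {𝒞 : Type u} [Category.{v} 𝒞] [Preadditive 𝒞]
    {𝒟 : Type u'} [Category.{v'} 𝒟] [Preadditive 𝒟] {n : ℕ}
    (S : ExtensionStructure.{w} 𝒞 n) (S' : ExtensionStructure.{w'} 𝒟 n) where
  F : 𝒞 ⥤ 𝒟
  [additive : F.Additive]
  Γ : ∀ {C A : 𝒞}, Ext S.E C A →+ Ext S'.E (F.obj C) (F.obj A)
  map_push : ∀ {A B C : 𝒞} (a : A ⟶ B) (δ : Ext S.E C A),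
    Γ (push S.E a δ) = push S'.E (F.map a) (Γ δ)
  map_pull : ∀ {A C D : 𝒞} (c : D ⟶ C) (δ : Ext S.E C A),
    Γ (pull S.E c δ) = pull S'.E (F.map c) (Γ δ)

namespace ExtensionFunctor

attribute [instance] ExtensionFunctor.additive

variable {𝒞 : Type u} [Category.{v} 𝒞] [Preadditive 𝒞]
  {𝒟 : Type u'} [Category.{v'} 𝒟] [Preadditive 𝒟]
  {ℬ : Type u''} [Category.{v''} ℬ] [Preadditive ℬ] {n : ℕ}
  {S : ExtensionStructure.{w} 𝒞 n} {S' : ExtensionStructure.{w'} 𝒟 n}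
  {S'' : ExtensionStructure.{w''} ℬ n}

/-- `(F, Γ)` is an `n`-exangulated functor: `𝔰(δ) = [X]` implies `𝔰'(Γ(δ)) = [F(X)]`. -/
def IsNExangulated (Φ : ExtensionFunctor S S') : Prop :=
  ∀ ⦃A C : 𝒞⦄ (δ : Ext S.E C A) (X : NComplex n A C),
    S.Realises δ X → S'.Realises (Φ.Γ δ) (X.map Φ.F)

/-- The composite of `Φ` followed by `Ψ`. -/
def comp (Φ : ExtensionFunctor S S') (Ψ : ExtensionFunctor S' S'') : ExtensionFunctor S S'' where
  F := Φ.F ⋙ Ψ.F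
  Γ := Ψ.Γ.comp Φ.Γ
  map_push a δ := by simp [Φ.map_push, Ψ.map_push]
  map_pull c δ := by simp [Φ.map_pull, Ψ.map_pull]

/-- A natural transformation `α : F ⟶ G` is `n`-exangulated, as a transformation
`(F, Γ) ⟶ (G, Λ)`, if `(α_A)_* Γ(δ) = (α_C)^* Λ(δ)` for all `δ ∈ 𝔼(C, A)`. -/
def IsNExangulatedTrans (Φ Ψ : ExtensionFunctor S S') (α : Φ.F ⟶ Ψ.F) : Prop :=
  ∀ ⦃A C : 𝒞⦄ (δ : Ext S.E C A),
    push S'.E (α.app A) (Φ.Γ δ) = pull S'.E (α.app C) (Ψ.Γ δ)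

/-- An `n`-exangulated natural isomorphism: an `n`-exangulated natural transformation with an
`n`-exangulated inverse. -/
def IsNExangulatedIso (Φ Ψ : ExtensionFunctor S S') (α : Φ.F ≅ Ψ.F) : Prop :=
  IsNExangulatedTrans Φ Ψ α.hom ∧ IsNExangulatedTrans Ψ Φ α.inv

end ExtensionFunctor

/-! ### The idempotent completion -/

section Karoubi

variable {𝒞 : Type u} [Category.{v} 𝒞]

/-- The subgroup of those `δ ∈ 𝔼(X', X)` with `e_* δ = δ = e'^* δ`; it is the group
`𝔽((X', e'), (X, e))`. -/
def karoubiSubgroup (E : 𝒞ᵒᵖ ⥤ 𝒞 ⥤ AddCommGrpCat.{w}) (Q P : Karoubi 𝒞) :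
    AddSubgroup (Ext E Q.X P.X) where
  carrier := {δ | push E P.p δ = δ ∧ pull E Q.p δ = δ}
  zero_mem' := by simp
  add_mem' := by
    rintro a b ⟨ha, ha'⟩ ⟨hb, hb'⟩
    exact ⟨by rw [map_add, ha, hb], by rw [map_add, ha', hb']⟩
  neg_mem' := by
    rintro a ⟨ha, ha'⟩
    exact ⟨by rw [map_neg, ha], by rw [map_neg, ha']⟩

/-- The bifunctor `𝔽` on the idempotent completion; on morphisms it is the restriction
of `𝔼`. -/
def karoubiE (E : 𝒞ᵒᵖ ⥤ 𝒞 ⥤ AddCommGrpCat.{w}) :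
    (Karoubi 𝒞)ᵒᵖ ⥤ Karoubi 𝒞 ⥤ AddCommGrpCat.{w} where
  obj Q :=
    { obj := fun P => AddCommGrpCat.of (karoubiSubgroup E Q.unop P)
      map := fun {P P'} a => AddCommGrpCat.ofHom
        (((push E a.f).comp (karoubiSubgroup E Q.unop P).subtype).codRestrict
          (karoubiSubgroup E Q.unop P') (by
            rintro ⟨δ, h, h'⟩
            refine ⟨?_, ?_⟩
            · change push E P'.p (push E a.f δ) = push E a.f δ
              rw [← push_comp, Karoubi.comp_p]
            · change pull E Q.unop.p (push E a.f δ) = push E a.f δ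
              rw [← push_pull, h']))
      map_id := fun P => by
        ext ⟨δ, h, h'⟩
        exact h
      map_comp := fun a b => by
        ext ⟨δ, h, h'⟩
        exact push_comp E a.f b.f δ }
  map {Q Q'} c :=
    { app := fun P => AddCommGrpCat.ofHom
        (((pull E c.unop.f).comp (karoubiSubgroup E Q.unop P).subtype).codRestrict
          (karoubiSubgroup E Q'.unop P) (by
            rintro ⟨δ, h, h'⟩
            refine ⟨?_, ?_⟩
            · change push E P.p (pull E c.unop.f δ) = pull E c.unop.f δ
              rw [push_pull, h]
            · change pull E Q'.unop.p (pull E c.unop.f δ) = pull E c.unop.f δ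
              rw [← pull_comp, Karoubi.p_comp]))
      naturality := fun P P' a => by
        ext ⟨δ, h, h'⟩
        exact (push_pull E a.f c.unop.f δ).symm }
  map_id Q := by
    ext P ⟨δ, h, h'⟩
    exact h'
  map_comp c d := by
    ext P ⟨δ, h, h'⟩
    exact pull_comp E c.unop.f d.unop.f δ

/-- The extension in `𝔼` underlying an extension in `𝔽`. -/
def underlying (E : 𝒞ᵒᵖ ⥤ 𝒞 ⥤ AddCommGrpCat.{w}) {P Q : Karoubi 𝒞} (δ : Ext (karoubiE E) Q P) :
    Ext E Q.X P.X :=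
  Subtype.val (p := fun x => x ∈ karoubiSubgroup E Q P) δ

variable [Preadditive 𝒞] {n : ℕ}

/-- The complex in the idempotent completion with terms `(Xᵢ, eᵢ)` and differentials with
underlying morphisms `eᵢ₊₁ dᵢ eᵢ`, for an idempotent endomorphism `e` of a complex. -/
def karoubiComplex (K : HomologicalComplex 𝒞 (nShape n)) (e : K ⟶ K) (he : e ≫ e = e) :
    HomologicalComplex (Karoubi 𝒞) (nShape n) where
  X i := ⟨K.X i, e.f i, by rw [← HomologicalComplex.comp_f, he]⟩
  d i j := ⟨e.f i ≫ K.d i j ≫ e.f j, by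
    have h : ∀ i, e.f i ≫ e.f i = e.f i := fun i => by rw [← HomologicalComplex.comp_f, he]
    simp only [Category.assoc, h]
    rw [← Category.assoc, h]⟩
  shape i j h := by
    ext
    simp [K.shape i j h]
  d_comp_d' i j k _ _ := by
    ext
    simp

/-- The complex `(X, e)` in the idempotent completion, with its end terms `(X₀, e₀)` and
`(Xₙ₊₁, eₙ₊₁)` identified with `P` and `Q`. -/
def karoubiNComplex {P Q : Karoubi 𝒞} (X : NComplex n P.X Q.X) (e : X.K ⟶ X.K) (he : e ≫ e = e)
    (hl : X.IsLift X e P.p Q.p) : NComplex n P Q where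
  K := karoubiComplex X.K e he
  left :=
    { hom := ⟨X.left.hom ≫ P.p, by
        change e.f 0 ≫ (X.left.hom ≫ P.p) ≫ P.p = X.left.hom ≫ P.p
        rw [Category.assoc, P.idem, ← hl.left, ← Category.assoc, ← HomologicalComplex.comp_f, he]⟩
      inv := ⟨P.p ≫ X.left.inv, by
        change P.p ≫ (P.p ≫ X.left.inv) ≫ e.f 0 = P.p ≫ X.left.inv
        have h : X.left.inv ≫ e.f 0 = P.p ≫ X.left.inv := by
          rw [Iso.inv_comp_eq, ← Category.assoc, ← hl.left]
          simp
        rw [Category.assoc, h, Karoubi.idem_assoc, Karoubi.idem_assoc]⟩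
      hom_inv_id := by
        ext
        change (X.left.hom ≫ P.p) ≫ (P.p ≫ X.left.inv) = e.f 0
        rw [Category.assoc, Karoubi.idem_assoc, ← Category.assoc, ← hl.left]
        simp
      inv_hom_id := by
        ext
        change (P.p ≫ X.left.inv) ≫ (X.left.hom ≫ P.p) = P.p
        simp }
  right :=
    { hom := ⟨X.right.hom ≫ Q.p, by
        change e.f _ ≫ (X.right.hom ≫ Q.p) ≫ Q.p = X.right.hom ≫ Q.p
        rw [Category.assoc, Q.idem, ← hl.right, ← Category.assoc, ← HomologicalComplex.comp_f, he]⟩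
      inv := ⟨Q.p ≫ X.right.inv, by
        change Q.p ≫ (Q.p ≫ X.right.inv) ≫ e.f _ = Q.p ≫ X.right.inv
        have h : X.right.inv ≫ e.f _ = Q.p ≫ X.right.inv := by
          rw [Iso.inv_comp_eq, ← Category.assoc, ← hl.right]
          simp
        rw [Category.assoc, h, Karoubi.idem_assoc, Karoubi.idem_assoc]⟩
      hom_inv_id := by
        ext
        change (X.right.hom ≫ Q.p) ≫ (Q.p ≫ X.right.inv) = e.f _
        rw [Category.assoc, Karoubi.idem_assoc, ← Category.assoc, ← hl.right]
        simp
      inv_hom_id := by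
        ext
        change (Q.p ≫ X.right.inv) ≫ (X.right.hom ≫ Q.p) = Q.p
        simp }

/-- The data `(𝔽, 𝔱)` on the idempotent completion: `𝔱(δ) = [Z]` holds if `Z` lies in the
class of `(X, e)`, for a complex `X` which realises the underlying extension of `δ` and an
idempotent endomorphism `e` of `X` which lifts the pair of idempotents of the end terms. -/
def ExtensionStructure.karoubi (S : ExtensionStructure.{w} 𝒞 n) :
    ExtensionStructure.{w} (Karoubi 𝒞) n where
  E := karoubiE S.E
  Realises {P Q} δ Z :=
    ∃ (X : NComplex n P.X Q.X) (e : X.K ⟶ X.K) (he : e ≫ e = e) (hl : X.IsLift X e P.p Q.p),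
      S.Realises (underlying S.E δ) X ∧ (karoubiNComplex X e he hl).HtpyEquiv Z

end Karoubi

/-! ### The weak idempotent completion -/

/-- Every retraction has a kernel. -/
def IsWeaklyIdempotentComplete (𝒞 : Type u) [Category.{v} 𝒞] [Preadditive 𝒞] : Prop :=
  ∀ ⦃X Y : 𝒞⦄ (r : X ⟶ Y), IsSplitEpi r → HasKernel r

section WeakCompletion

variable (𝒞 : Type u) [Category.{v} 𝒞] [Preadditive 𝒞]

/-- The objects `(X, e)` of the idempotent completion such that `1 - e` splits. -/
def weakProp : ObjectProperty (Karoubi 𝒞) := fun P =>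
  ∃ (Y : 𝒞) (r : P.X ⟶ Y) (s : Y ⟶ P.X), r ≫ s = 𝟙 P.X - P.p ∧ s ≫ r = 𝟙 Y

/-- The weak idempotent completion. -/
abbrev WeakCompletion := (weakProp 𝒞).FullSubcategory

variable {𝒞} {n : ℕ}

/-- The data `(𝔾, 𝔯)` on the weak idempotent completion, restricted from `(𝔽, 𝔱)`. -/
def ExtensionStructure.weak (S : ExtensionStructure.{w} 𝒞 n) :
    ExtensionStructure.{w} (WeakCompletion 𝒞) n :=
  S.karoubi.restrict (weakProp 𝒞)

variable (𝒞) in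
/-- The inclusion `X ↦ (X, 1)` of `𝒞` into its weak idempotent completion. -/
def toWeak [HasFiniteBiproducts 𝒞] : 𝒞 ⥤ WeakCompletion 𝒞 :=
  (weakProp 𝒞).lift (toKaroubi 𝒞) (fun X => by
    obtain ⟨Z, hZ⟩ := hasZeroObject_of_hasFiniteBiproducts 𝒞
    exact ⟨Z, 0, 0, by simp, hZ.eq_of_src _ _⟩)

/-- The pair `(K, Δ)`, where `Δ` sends `δ` to itself. -/
def inclusion [HasFiniteBiproducts 𝒞] (S : ExtensionStructure.{w} 𝒞 n) :
    ExtensionFunctor S S.weak where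
  F := toWeak 𝒞
  additive := ⟨rfl⟩
  Γ {C A} :=
    ((AddMonoidHom.id (Ext S.E C A)).codRestrict
      (karoubiSubgroup S.E ((toKaroubi 𝒞).obj C) ((toKaroubi 𝒞).obj A))
      (fun δ => show push S.E (𝟙 A) δ = δ ∧ pull S.E (𝟙 C) δ = δ from
        ⟨push_id S.E δ, pull_id S.E δ⟩) :)
  map_push _ _ := rfl
  map_pull _ _ := rfl

end WeakCompletion

end NExang

end

/-! The engine is one fact about an `n`-exangle `X` of `δ`: an endomorphism whose two end components
annihilate `δ` has null-homotopic square. Modulo maps that factor through contractible complexes `T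
= T`, it may be taken to vanish on both ends. Exactness of `Hom(-, X)` then removes its components
from the top down until only degree 1 is left, and that remainder factors through `d₀`, so it
squares to zero (`comp_self_mem_relNull`, `comp_self_htpy_zero`). If `f ≫ g = 1 + x` with `x²`
null-homotopic, then `1 - x` corrects `g` to a homotopy inverse. So two exangles of one extension
with maps both ways over the identities are equivalent, and a direct factor of a complex realising
an extension realises the corresponding factor of the extension (`realises_of_retract`). Most
realisation statements below reduce to this last one.

In the idempotent completion, idempotents `p`, `q` on the ends that fix `δ` lift to `e = 1 - E -
E'`, where `E` and `E'` are orthogonal idempotents factoring through contractible complexes in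
degrees `0, 1` and `n, n + 1` (`exists_idempotent`). Then `1 - e` has components `Eᵢ + E'ᵢ`, which
split as soon as `1 - p` and `1 - q` do; this is extension-closedness. The pair `(X, e)` is a direct
factor of `X`, which gives (R0) and (R1).

For (EA2), a complex over the completion that realises an extension is only homotopy equivalent to
some `(X, e)`, but after adding contractible complexes to `X` it becomes an honest direct factor
(`exists_presentation`). A cone in `𝒞` is then restricted to the factors: the morphism is moved
within its homotopy class to one commuting with the idempotents, its cone changes only by an
isomorphism, and the resulting diagonal idempotent of the cone splits (`exists_cone_of_retract`).

For (EA1), in a weakly idempotent complete category with mapping cocones, `u` is an inflation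
whenever some `u ≫ φ` is the first differential of a realising complex, because the unwanted part of
a cocone is a contractible summand that splits off (`isInflation_of_comp`). A composite of
inflations of the completion acquires this form by comparison with inflations of `𝒞`. The last term
involved lies in `𝒞`, so the same comparison serves the weak completion, which otherwise inherits
its structure as a full subcategory. Its weak idempotent completeness comes from a stabilisation:
the complement of a kernel need not split, but it does after adding a suitable object of `𝒞`.

For the universal property, each `(X, e)` is a retract of `X`, compatibly with morphisms, so natural
transformations extend uniquely. A functor `F` extends by choosing images of `F(e)`; these exist
since `F(1 - e)` splits and the target is weakly idempotent complete. The extension preserves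
realisations by `exists_presentation` and `realises_of_retract`. -/

noncomputable section

namespace NExang

/-! ### Contractible complexes concentrated in two adjacent degrees -/

section Doubles

variable {𝒱 : Type u} [Category.{v} 𝒱] [Preadditive 𝒱] [HasZeroObject 𝒱]
  {ι : Type*} {c : ComplexShape ι} {i j : ι}

/-- The contractible complex `T = T` in the degrees `i` and `j`. -/
abbrev dbl (hij : c.Rel i j) (T : 𝒱) : HomologicalComplex 𝒱 c :=
  HomologicalComplex.double (𝟙 T) hij

open scoped Classical in
/-- The morphism to a contractible complex determined by its component in the upper degree. -/
def toDbl (hij : c.Rel i j) (h : i ≠ j) {K : HomologicalComplex 𝒱 c} {T : 𝒱} (φ : K.X j ⟶ T) :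
    K ⟶ dbl hij T where
  f k :=
    if hk₀ : k = i then
      eqToHom (by rw [hk₀]) ≫ K.d i j ≫ φ ≫ (HomologicalComplex.doubleXIso₀ (𝟙 T) hij).inv ≫
        eqToHom (by rw [hk₀])
    else if hk₁ : k = j then
      eqToHom (by rw [hk₁]) ≫ φ ≫ (HomologicalComplex.doubleXIso₁ (𝟙 T) hij h).inv ≫
        eqToHom (by rw [hk₁])
    else 0
  comm' a b hab := by
    by_cases hb : b = j
    · subst hb
      obtain rfl := c.prev_eq hab hij
      simp [dif_neg h.symm, HomologicalComplex.double_d _ hij h]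
    · by_cases hb' : b = i
      · subst hb'
        have ha : a ≠ b := by
          rintro rfl
          exact hb (c.next_eq hab hij)
        rw [HomologicalComplex.double_d_eq_zero₁ _ _ _ _ hb]
        simp
      · apply (HomologicalComplex.isZero_double_X (𝟙 T) hij b hb' hb).eq_of_tgt

@[simp]
lemma toDbl_f₀ (hij : c.Rel i j) (h : i ≠ j) {K : HomologicalComplex 𝒱 c} {T : 𝒱}
    (φ : K.X j ⟶ T) :
    (toDbl hij h φ).f i = K.d i j ≫ φ ≫ (HomologicalComplex.doubleXIso₀ (𝟙 T) hij).inv := by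
  simp [toDbl]

@[simp]
lemma toDbl_f₁ (hij : c.Rel i j) (h : i ≠ j) {K : HomologicalComplex 𝒱 c} {T : 𝒱}
    (φ : K.X j ⟶ T) :
    (toDbl hij h φ).f j = φ ≫ (HomologicalComplex.doubleXIso₁ (𝟙 T) hij h).inv := by
  simp [toDbl, h.symm]

/-- The morphism from a contractible complex determined by its component in the lower degree. -/
def fromDbl (hij : c.Rel i j) (h : i ≠ j) {K : HomologicalComplex 𝒱 c} {T : 𝒱} (ψ : T ⟶ K.X i) :
    dbl hij T ⟶ K :=
  HomologicalComplex.mkHomFromDouble hij h ψ (ψ ≫ K.d i j) (by simp) (by simp)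

@[simp]
lemma fromDbl_f₀ (hij : c.Rel i j) (h : i ≠ j) {K : HomologicalComplex 𝒱 c} {T : 𝒱}
    (ψ : T ⟶ K.X i) :
    (fromDbl hij h ψ).f i = (HomologicalComplex.doubleXIso₀ (𝟙 T) hij).hom ≫ ψ := by
  simp [fromDbl]

@[simp]
lemma fromDbl_f₁ (hij : c.Rel i j) (h : i ≠ j) {K : HomologicalComplex 𝒱 c} {T : 𝒱}
    (ψ : T ⟶ K.X i) :
    (fromDbl hij h ψ).f j =
      (HomologicalComplex.doubleXIso₁ (𝟙 T) hij h).hom ≫ ψ ≫ K.d i j := by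
  simp [fromDbl]

lemma dbl_comp_f_eq_zero {hij : c.Rel i j} {K L : HomologicalComplex 𝒱 c} {T : 𝒱}
    (α : K ⟶ dbl hij T) (β : dbl hij T ⟶ L) {k : ι} (hi : k ≠ i) (hj : k ≠ j) :
    (α ≫ β).f k = 0 := by
  rw [HomologicalComplex.comp_f,
    (HomologicalComplex.isZero_double_X (𝟙 T) hij k hi hj).eq_of_tgt (α.f k) 0, zero_comp]

-- The contracting homotopy has a single nonzero component, the identification of the upper copy of
-- `T` with the lower one.
open scoped Classical in
lemma dbl_contractible (hij : c.Rel i j) (h : i ≠ j) (T : 𝒱) :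
    Nonempty (Homotopy (𝟙 (dbl hij T)) 0) := by
  let s : (dbl hij T).X j ⟶ (dbl hij T).X i :=
    (HomologicalComplex.doubleXIso₁ (𝟙 T) hij h).hom ≫
      (HomologicalComplex.doubleXIso₀ (𝟙 T) hij).inv
  let hom : ∀ a b, (dbl hij T).X a ⟶ (dbl hij T).X b := fun a b =>
    if hab : a = j ∧ b = i then eqToHom (by rw [hab.1]) ≫ s ≫ eqToHom (by rw [hab.2]) else 0
  have hs : hom j i = s := by simp [hom]
  have e : Homotopy.nullHomotopicMap hom = 𝟙 (dbl hij T) := by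
    apply HomologicalComplex.from_double_hom_ext
    · have h2 : prevD i hom = 0 := by
        have : hom i (c.prev i) = 0 := by simp [hom, h]
        change hom i (c.prev i) ≫ _ = 0
        rw [this, zero_comp]
      change dNext i hom + prevD i hom = _
      rw [h2, dNext_eq _ hij, hs]
      simp [s, HomologicalComplex.double_d _ hij h]
    · have h2 : dNext j hom = 0 := by
        have : hom (c.next j) j = 0 := by simp [hom, h.symm]
        change _ ≫ hom (c.next j) j = 0
        rw [this, comp_zero]
      change dNext j hom + prevD j hom = _
      rw [h2, prevD_eq _ hij, hs]
      simp [s, HomologicalComplex.double_d _ hij h]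
  rw [← e]
  exact ⟨Homotopy.nullHomotopy hom (fun a b hab => by
    simp only [hom]
    rw [dif_neg]
    rintro ⟨rfl, rfl⟩
    exact hab hij)⟩

lemma dbl_factor_htpy {hij : c.Rel i j} (h : i ≠ j) {K L : HomologicalComplex 𝒱 c} {T : 𝒱}
    (α : K ⟶ dbl hij T) (β : dbl hij T ⟶ L) : Nonempty (Homotopy (α ≫ β) 0) := by
  obtain ⟨H⟩ := dbl_contractible hij h T
  exact ⟨((Homotopy.ofEq (by simp)).trans ((H.compRight β).compLeft α)).trans
    (Homotopy.ofEq (by simp))⟩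

end Doubles

/-! ### Combinatorics of the degrees `0, …, n + 1` -/

section Shape

variable {n : ℕ}

lemma nShape_rel_zero_one : (nShape n).Rel 0 1 := by simp [nShape]

lemma nShape_rel_last : (nShape n).Rel (Fin.last n).castSucc (Fin.last (n + 1)) := by
  simp [nShape]

lemma nShape_ne {i j : Fin (n + 2)} (h : (nShape n).Rel i j) : i ≠ j := by
  rintro rfl
  simp [nShape] at h

lemma nShape_not_rel_zero (i : Fin (n + 2)) : ¬ (nShape n).Rel i 0 := by simp [nShape]

lemma nShape_not_last_rel (i : Fin (n + 2)) : ¬ (nShape n).Rel (Fin.last (n + 1)) i := by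
  simp only [nShape, Fin.val_last]
  omega

lemma nShape_exists_next (i : Fin (n + 2)) (hi : i ≠ Fin.last (n + 1)) :
    ∃ j, (nShape n).Rel i j :=
  ⟨⟨i.val + 1, by have := i.isLt; have : i.val ≠ n + 1 := fun h => hi (Fin.ext h); omega⟩, rfl⟩

lemma nShape_exists_prev (i : Fin (n + 2)) (hi : i ≠ 0) : ∃ j, (nShape n).Rel j i := by
  have : i.val ≠ 0 := fun h => hi (Fin.ext h)
  refine ⟨⟨i.val - 1, by omega⟩, ?_⟩
  simp only [nShape]
  omega

lemma nShape_rel_zero {j : Fin (n + 2)} (h : (nShape n).Rel 0 j) : j = 1 :=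
  (nShape n).next_eq h nShape_rel_zero_one

lemma last_ne_zero : Fin.last (n + 1) ≠ 0 := by simp [Fin.ext_iff]

lemma last_ne_one (hn : 1 ≤ n) : Fin.last (n + 1) ≠ 1 := by
  simp [Fin.ext_iff]; omega

lemma castSucc_last_ne_zero (hn : 1 ≤ n) : (Fin.last n).castSucc ≠ 0 := by
  simp [Fin.ext_iff]; omega

lemma castSucc_last_ne_last : (Fin.last n).castSucc ≠ Fin.last (n + 1) := by
  simp [Fin.ext_iff]

end Shape

/-! ### Morphisms with prescribed end components, and relative homotopy equivalence -/

section Lifts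

variable {𝒞 : Type u} [Category.{v} 𝒞] [Preadditive 𝒞] {n : ℕ}
variable {𝒟 : Type u'} [Category.{v'} 𝒟] [Preadditive 𝒟]

namespace NComplex

variable {A B C D A' C' : 𝒞}

lemma IsLift.id (X : NComplex n A C) : IsLift X X (𝟙 X.K) (𝟙 A) (𝟙 C) := ⟨by simp, by simp⟩

lemma IsLift.comp {X : NComplex n A C} {Y : NComplex n B D} {Z : NComplex n A' C'}
    {f : X.K ⟶ Y.K} {g : Y.K ⟶ Z.K} {a : A ⟶ B} {c : C ⟶ D} {b : B ⟶ A'} {d : D ⟶ C'}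
    (hf : IsLift X Y f a c) (hg : IsLift Y Z g b d) : IsLift X Z (f ≫ g) (a ≫ b) (c ≫ d) :=
  ⟨by rw [HomologicalComplex.comp_f, Category.assoc, hg.left, ← Category.assoc, hf.left,
      Category.assoc],
    by rw [HomologicalComplex.comp_f, Category.assoc, hg.right, ← Category.assoc, hf.right,
      Category.assoc]⟩

lemma IsLift.add {X : NComplex n A C} {Y : NComplex n B D}
    {f g : X.K ⟶ Y.K} {a a' : A ⟶ B} {c c' : C ⟶ D}
    (hf : IsLift X Y f a c) (hg : IsLift X Y g a' c') : IsLift X Y (f + g) (a + a') (c + c') :=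
  ⟨by simp [hf.left, hg.left], by simp [hf.right, hg.right]⟩

lemma IsLift.sub {X : NComplex n A C} {Y : NComplex n B D}
    {f g : X.K ⟶ Y.K} {a a' : A ⟶ B} {c c' : C ⟶ D}
    (hf : IsLift X Y f a c) (hg : IsLift X Y g a' c') : IsLift X Y (f - g) (a - a') (c - c') :=
  ⟨by simp [hf.left, hg.left], by simp [hf.right, hg.right]⟩

lemma IsLift.congr {X : NComplex n A C} {Y : NComplex n B D}
    {f : X.K ⟶ Y.K} {a a' : A ⟶ B} {c c' : C ⟶ D}
    (hf : IsLift X Y f a c) (ha : a = a') (hc : c = c') : IsLift X Y f a' c' := by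
  subst ha hc
  exact hf

lemma IsLift.f_zero {X : NComplex n A C} {Y : NComplex n B D} {f : X.K ⟶ Y.K} {a : A ⟶ B}
    {c : C ⟶ D} (hf : IsLift X Y f a c) : f.f 0 = X.left.hom ≫ a ≫ Y.left.inv := by
  rw [← Category.assoc, ← hf.left]; simp

lemma IsLift.f_last {X : NComplex n A C} {Y : NComplex n B D} {f : X.K ⟶ Y.K} {a : A ⟶ B}
    {c : C ⟶ D} (hf : IsLift X Y f a c) :
    f.f (Fin.last (n + 1)) = X.right.hom ≫ c ≫ Y.right.inv := by
  rw [← Category.assoc, ← hf.right]; simp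

lemma IsLift.mk' {X : NComplex n A C} {Y : NComplex n B D} {f : X.K ⟶ Y.K} {a : A ⟶ B}
    {c : C ⟶ D} (h : f.f 0 = X.left.hom ≫ a ≫ Y.left.inv)
    (h' : f.f (Fin.last (n + 1)) = X.right.hom ≫ c ≫ Y.right.inv) : IsLift X Y f a c :=
  ⟨by simp [h], by simp [h']⟩

lemma IsLift.dFirst {X : NComplex n A C} {Y : NComplex n B D} {f : X.K ⟶ Y.K} {a : A ⟶ B}
    {c : C ⟶ D} (hf : IsLift X Y f a c) : X.dFirst ≫ f.f 1 = a ≫ Y.dFirst := by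
  simp [NComplex.dFirst, ← f.comm, hf.f_zero]

lemma IsLift.dLast {X : NComplex n A C} {Y : NComplex n B D} {f : X.K ⟶ Y.K} {a : A ⟶ B}
    {c : C ⟶ D} (hf : IsLift X Y f a c) :
    f.f (Fin.last n).castSucc ≫ Y.dLast = X.dLast ≫ c := by
  simp [NComplex.dLast, hf.f_last]

lemma IsLift.map (F : 𝒞 ⥤ 𝒟) [F.PreservesZeroMorphisms] {X : NComplex n A C}
    {Y : NComplex n B D} {f : X.K ⟶ Y.K} {a : A ⟶ B}
    {c : C ⟶ D} (hf : IsLift X Y f a c) :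
    IsLift (X.map F) (Y.map F) ((F.mapHomologicalComplex (nShape n)).map f) (F.map a) (F.map c) :=
  ⟨by
    change F.map _ ≫ F.map _ = F.map _ ≫ F.map _
    rw [← F.map_comp, hf.left, F.map_comp],
  by
    change F.map _ ≫ F.map _ = F.map _ ≫ F.map _
    rw [← F.map_comp, hf.right, F.map_comp]⟩

lemma map_dFirst (F : 𝒞 ⥤ 𝒟) [F.PreservesZeroMorphisms] (X : NComplex n A C) :
    (X.map F).dFirst = F.map X.dFirst := by
  simp only [NComplex.dFirst, F.map_comp]
  rfl

lemma map_dLast (F : 𝒞 ⥤ 𝒟) [F.PreservesZeroMorphisms] (X : NComplex n A C) :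
    (X.map F).dLast = F.map X.dLast := by
  simp only [NComplex.dLast, F.map_comp]
  rfl

lemma HtpyEquiv.refl (X : NComplex n A C) : HtpyEquiv X X :=
  ⟨𝟙 _, 𝟙 _, IsLift.id X, IsLift.id X, ⟨Homotopy.ofEq (by simp)⟩, ⟨Homotopy.ofEq (by simp)⟩⟩

lemma HtpyEquiv.symm {X Y : NComplex n A C} (h : HtpyEquiv X Y) : HtpyEquiv Y X := by
  obtain ⟨f, g, hf, hg, H, H'⟩ := h
  exact ⟨g, f, hg, hf, H', H⟩

lemma HtpyEquiv.trans {X Y Z : NComplex n A C} (h : HtpyEquiv X Y) (h' : HtpyEquiv Y Z) :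
    HtpyEquiv X Z := by
  obtain ⟨f, g, hf, hg, ⟨H⟩, ⟨H'⟩⟩ := h
  obtain ⟨f', g', hf', hg', ⟨I⟩, ⟨I'⟩⟩ := h'
  refine ⟨f ≫ f', g' ≫ g, (hf.comp hf').congr (by simp) (by simp),
    (hg'.comp hg).congr (by simp) (by simp), ⟨?_⟩, ⟨?_⟩⟩
  · exact ((Homotopy.ofEq (by simp)).trans (((I.compRight g).compLeft f).trans
      (Homotopy.ofEq (by simp)))).trans H
  · exact ((Homotopy.ofEq (by simp)).trans (((H'.compRight f').compLeft g').trans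
      (Homotopy.ofEq (by simp)))).trans I'

lemma HtpyEquiv.of_iso {X Y : NComplex n A C} (f : X.K ⟶ Y.K) (g : Y.K ⟶ X.K)
    (hf : IsLift X Y f (𝟙 A) (𝟙 C)) (h : f ≫ g = 𝟙 _) (h' : g ≫ f = 𝟙 _) : HtpyEquiv X Y := by
  refine ⟨f, g, hf, ⟨?_, ?_⟩, ⟨Homotopy.ofEq h⟩, ⟨Homotopy.ofEq h'⟩⟩
  · have := HomologicalComplex.congr_hom h' 0
    simp only [HomologicalComplex.comp_f, HomologicalComplex.id_f] at this
    have h2 := hf.left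
    simp only [Category.comp_id] at h2 ⊢
    rw [← h2, ← Category.assoc, this, Category.id_comp]
  · have := HomologicalComplex.congr_hom h' (Fin.last (n + 1))
    simp only [HomologicalComplex.comp_f, HomologicalComplex.id_f] at this
    have h2 := hf.right
    simp only [Category.comp_id] at h2 ⊢
    rw [← h2, ← Category.assoc, this, Category.id_comp]

end NComplex

end Lifts

/-! ### Maps that are null-homotopic away from the ends -/

section RelNull

variable {𝒞 : Type u} [Category.{v} 𝒞] [Preadditive 𝒞] [HasZeroObject 𝒞] {n : ℕ}

/-- The additive submonoid generated by the morphisms which factor through a contractible complex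
`T = T` concentrated in the degrees `1, …, n`. -/
def relNull (K L : HomologicalComplex 𝒞 (nShape n)) : AddSubmonoid (K ⟶ L) :=
  AddSubmonoid.closure {φ | ∃ (i j : Fin (n + 2)) (hij : (nShape n).Rel i j) (_ : i ≠ 0)
    (_ : j ≠ Fin.last (n + 1)) (T : 𝒞) (α : K ⟶ dbl hij T) (β : dbl hij T ⟶ L), φ = α ≫ β}

variable {K L M : HomologicalComplex 𝒞 (nShape n)}

lemma relNull_of {i j : Fin (n + 2)} (hij : (nShape n).Rel i j) (hi : i ≠ 0)
    (hj : j ≠ Fin.last (n + 1)) {T : 𝒞} (α : K ⟶ dbl hij T) (β : dbl hij T ⟶ L) :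
    α ≫ β ∈ relNull K L :=
  AddSubmonoid.subset_closure ⟨i, j, hij, hi, hj, T, α, β, rfl⟩

lemma relNull_comp_right {φ : K ⟶ L} (h : φ ∈ relNull K L) (g : L ⟶ M) :
    φ ≫ g ∈ relNull K M := by
  induction h using AddSubmonoid.closure_induction with
  | mem x hx =>
    obtain ⟨i, j, hij, hi, hj, T, α, β, rfl⟩ := hx
    rw [Category.assoc]
    exact relNull_of hij hi hj _ _
  | zero => simp
  | add x y _ _ hx hy =>
    rw [Preadditive.add_comp]
    exact add_mem hx hy

lemma relNull_comp_left (f : K ⟶ L) {φ : L ⟶ M} (h : φ ∈ relNull L M) :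
    f ≫ φ ∈ relNull K M := by
  induction h using AddSubmonoid.closure_induction with
  | mem x hx =>
    obtain ⟨i, j, hij, hi, hj, T, α, β, rfl⟩ := hx
    rw [← Category.assoc]
    exact relNull_of hij hi hj _ _
  | zero => simp
  | add x y _ _ hx hy =>
    rw [Preadditive.comp_add]
    exact add_mem hx hy

lemma relNull_htpy {φ : K ⟶ L} (h : φ ∈ relNull K L) : Nonempty (Homotopy φ 0) := by
  induction h using AddSubmonoid.closure_induction with
  | mem x hx =>
    obtain ⟨i, j, hij, hi, hj, T, α, β, rfl⟩ := hx
    exact dbl_factor_htpy (nShape_ne hij) α β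
  | zero => exact ⟨Homotopy.refl 0⟩
  | add x y _ _ hx hy =>
    exact ⟨(hx.some.add hy.some).trans (Homotopy.ofEq (by simp))⟩

end RelNull

end NExang

end

noncomputable section

namespace NExang

namespace ExtensionStructure

open NComplex

variable {𝒞 : Type u} [Category.{v} 𝒞] [Preadditive 𝒞] {n : ℕ} {S : ExtensionStructure.{w} 𝒞 n}

/-! ### Rigidity of exangles -/

section Exangles

variable {A B C D : 𝒞}

namespace IsExangle

variable {δ : Ext S.E C A} {X : NComplex n A C}

/-- Components are removed from the top down. If `x'` vanishes above degree `j`, then `x'` in degree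
`j` is killed by the differential, hence factors as `h` followed by `d`. The map through `T = T`
built from `h` has the same component in degree `j`, and subtracting it only disturbs the degree
below. -/
lemma exists_relNull_sub [HasZeroObject 𝒞] (hX : S.IsExangle δ X) (x : X.K ⟶ X.K)
    (hx : IsLift X X x 0 0) (k : ℕ) (hk : k < n) :
    ∃ x' : X.K ⟶ X.K, x - x' ∈ relNull X.K X.K ∧ x'.f 0 = 0 ∧
      ∀ i : Fin (n + 2), n - k < i.val → x'.f i = 0 := by
  induction k with
  | zero =>
    refine ⟨x, by simp, by simp [hx.f_zero], fun i hi => ?_⟩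
    obtain rfl : i = Fin.last (n + 1) := Fin.ext (by simp; omega)
    simp [hx.f_last]
  | succ k ih =>
    obtain ⟨x', h1, h2, h3⟩ := ih (by omega)
    -- The degree cleared now is `j = n - k`. The bound `k + 1 < n` keeps the lower degree `i` away
    -- from `0`, so the contractible complex avoids both ends.
    let j : Fin (n + 2) := ⟨n - k, by omega⟩
    let i : Fin (n + 2) := ⟨n - (k + 1), by omega⟩
    let l : Fin (n + 2) := ⟨n - k + 1, by omega⟩
    have hij : (nShape n).Rel i j := by simp only [nShape, i, j]; omega
    have hjl : (nShape n).Rel j l := by simp only [nShape, j, l]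
    have hi : i ≠ 0 := by simp only [i, ne_eq, Fin.ext_iff, Fin.val_zero]; omega
    have hj0 : j ≠ 0 := by simp only [j, ne_eq, Fin.ext_iff, Fin.val_zero]; omega
    have hj : j ≠ Fin.last (n + 1) := by simp only [j, ne_eq, Fin.ext_iff, Fin.val_last]; omega
    obtain ⟨h, hh⟩ := hX.exact_hom_from hij hjl (x'.f j) (by
      rw [x'.comm, h3 l (by simp only [l]; omega), comp_zero])
    have hne := nShape_ne hij
    refine ⟨x' - toDbl hij hne (𝟙 (X.K.X j)) ≫ fromDbl hij hne h, ?_, ?_, ?_⟩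
    · have : x - (x' - toDbl hij hne (𝟙 (X.K.X j)) ≫ fromDbl hij hne h) =
        (x - x') + toDbl hij hne (𝟙 (X.K.X j)) ≫ fromDbl hij hne h := by abel
      rw [this]
      exact add_mem h1 (relNull_of hij hi hj _ _)
    · rw [HomologicalComplex.sub_f_apply, h2, dbl_comp_f_eq_zero _ _ hi.symm hj0.symm, sub_zero]
    · intro a ha
      rw [HomologicalComplex.sub_f_apply]
      by_cases haj : a = j
      · subst haj
        simp [hh]
      · have hai : a ≠ i := by
          rintro rfl
          simp [i] at ha
        rw [dbl_comp_f_eq_zero _ _ hai haj, h3, sub_zero]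
        have : a.val ≠ n - k := fun h => haj (Fin.ext h)
        omega

/-- The square of an endomorphism of an exangle which vanishes on the end terms is
null-homotopic, relative to the end terms. -/
lemma comp_self_mem_relNull [HasZeroObject 𝒞] (hn : 1 ≤ n) (hX : S.IsExangle δ X)
    (x : X.K ⟶ X.K) (hx : IsLift X X x 0 0) : x ≫ x ∈ relNull X.K X.K := by
  -- With `k = n - 1` every component is cleared except the one in degree 1.
  obtain ⟨x', h1, h2, h3⟩ := hX.exists_relNull_sub x hx (n - 1) (by omega)
  have hsq : x' ≫ x' = 0 := by
    ext a
    by_cases ha : 1 < a.val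
    · simp [h3 a (by omega)]
    · by_cases ha0 : a = 0
      · subst ha0
        simp [h2]
      · obtain rfl : a = 1 := by
          have : a.val ≠ 0 := fun h => ha0 (Fin.ext h)
          exact Fin.ext (by simp; omega)
        let l : Fin (n + 2) := ⟨2, by omega⟩
        have h12 : (nShape n).Rel 1 l := by simp [nShape, l]
        -- The surviving component is `h ≫ d₀`, and `d₀` followed by it equals `x'.f 0 ≫ d₀ = 0`;
        -- hence its square vanishes.
        obtain ⟨h, hh⟩ := hX.exact_hom_from nShape_rel_zero_one h12 (x'.f 1) (by
          rw [x'.comm, h3 l (by simp only [l]; omega), comp_zero])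
        rw [HomologicalComplex.comp_f]
        nth_rw 1 [← hh]
        rw [Category.assoc, ← x'.comm, h2]
        simp
  have : x ≫ x = x ≫ (x - x') + (x - x') ≫ x' := by
    simp [hsq]
  rw [this]
  exact add_mem (relNull_comp_left _ h1) (relNull_comp_right h1 _)

/-- The square of an endomorphism of an exangle whose components on the end terms annihilate the
extension is null-homotopic. -/
lemma comp_self_htpy_zero [HasZeroObject 𝒞] (hn : 1 ≤ n) (hX : S.IsExangle δ X)
    (z : X.K ⟶ X.K) {a : A ⟶ A} {c : C ⟶ C} (hz : IsLift X X z a c) (ha : push S.E a δ = 0)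
    (hc : pull S.E c δ = 0) : Nonempty (Homotopy (z ≫ z) 0) := by
  obtain ⟨k, hk⟩ := hX.exact_hom_to_first a ha
  obtain ⟨l, hl⟩ := hX.exact_hom_from_last c hc
  have h01 := nShape_ne (nShape_rel_zero_one (n := n))
  have hnl := nShape_ne (nShape_rel_last (n := n))
  -- As `a` factors through the first differential and `c` through the last, each extends to an
  -- endomorphism through a contractible complex at its own end, vanishing on the other end.
  -- Subtracting both reduces to zero end components.
  let α := toDbl (nShape_rel_zero_one (n := n)) h01 k ≫ fromDbl nShape_rel_zero_one h01 X.left.inv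
  let β := toDbl (nShape_rel_last (n := n)) hnl (X.right.hom ≫ l) ≫
    fromDbl nShape_rel_last hnl (𝟙 _)
  have hα : IsLift X X α a 0 := IsLift.mk'
    (by
      rw [← hk]
      simp [α, NComplex.dFirst])
    (by
      rw [dbl_comp_f_eq_zero _ _ last_ne_zero (last_ne_one hn)]
      simp)
  have hβ : IsLift X X β 0 c := IsLift.mk'
    (by
      rw [dbl_comp_f_eq_zero _ _ (castSucc_last_ne_zero hn).symm last_ne_zero.symm]
      simp)
    (by
      rw [← hl]
      simp [β, NComplex.dLast])
  obtain ⟨H1⟩ : Nonempty (Homotopy α 0) := dbl_factor_htpy h01 _ _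
  obtain ⟨H2⟩ : Nonempty (Homotopy β 0) := dbl_factor_htpy hnl _ _
  have hz' : IsLift X X (z - α - β) 0 0 := ((hz.sub hα).sub hβ).congr (by simp) (by simp)
  obtain ⟨H3⟩ := relNull_htpy (hX.comp_self_mem_relNull hn _ hz')
  have H4 : Homotopy z (z - α - β) :=
    ((Homotopy.ofEq (by abel)).trans ((Homotopy.refl (z - α - β)).add (H1.add H2))).trans
      (Homotopy.ofEq (by simp))
  exact ⟨(H4.comp H4).trans H3⟩

/-- Two exangles of the same extension with morphisms in both directions are homotopy equivalent
relative to the end terms. -/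
lemma exists_htpy_inverse [HasZeroObject 𝒞] (hn : 1 ≤ n) {Y : NComplex n A C}
    (hX : S.IsExangle δ X) (hY : S.IsExangle δ Y) (f : X.K ⟶ Y.K) (g : Y.K ⟶ X.K)
    (hf : IsLift X Y f (𝟙 A) (𝟙 C)) (hg : IsLift Y X g (𝟙 A) (𝟙 C)) :
    ∃ g' : Y.K ⟶ X.K, IsLift Y X g' (𝟙 A) (𝟙 C) ∧ 𝟙 _ - f ≫ g' ∈ relNull X.K X.K ∧
      𝟙 _ - g' ≫ f ∈ relNull Y.K Y.K := by
  have hx : IsLift X X (f ≫ g - 𝟙 _) 0 0 :=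
    ((hf.comp hg).sub (IsLift.id X)).congr (by simp) (by simp)
  have hy : IsLift Y Y (g ≫ f - 𝟙 _) 0 0 :=
    ((hg.comp hf).sub (IsLift.id Y)).congr (by simp) (by simp)
  -- With `f ≫ g = 1 + x` and `g ≫ f = 1 + y`, this choice makes the two defects exactly `x²` and
  -- `y²`.
  refine ⟨g ≫ (𝟙 _ - (f ≫ g - 𝟙 _)), ?_, ?_, ?_⟩
  · exact (hg.comp ((IsLift.id X).sub hx)).congr (by simp) (by simp)
  · convert hX.comp_self_mem_relNull hn _ hx using 1
    simp only [Preadditive.comp_sub, Preadditive.sub_comp, Category.comp_id, Category.id_comp,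
      Category.assoc]
    abel
  · convert hY.comp_self_mem_relNull hn _ hy using 1
    simp only [Preadditive.comp_sub, Preadditive.sub_comp, Category.comp_id, Category.id_comp,
      Category.assoc]
    abel

lemma htpyEquiv [HasZeroObject 𝒞] (hn : 1 ≤ n) {Y : NComplex n A C}
    (hX : S.IsExangle δ X) (hY : S.IsExangle δ Y) (f : X.K ⟶ Y.K) (g : Y.K ⟶ X.K)
    (hf : IsLift X Y f (𝟙 A) (𝟙 C)) (hg : IsLift Y X g (𝟙 A) (𝟙 C)) : X.HtpyEquiv Y := by
  obtain ⟨g', hg', h1, h2⟩ := hX.exists_htpy_inverse hn hY f g hf hg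
  exact ⟨f, g', hf, hg', ⟨(Homotopy.equivSubZero.symm (relNull_htpy h1).some).symm⟩,
    ⟨(Homotopy.equivSubZero.symm (relNull_htpy h2).some).symm⟩⟩

end IsExangle

/-- Homotopy retracts of exangles are exangles. -/
lemma IsExangle.of_retract {ε₀ : Ext S.E C A} {M₀ : NComplex n A C} (h₀ : S.IsExangle ε₀ M₀)
    {ε : Ext S.E D B} {M : NComplex n B D} (i : M.K ⟶ M₀.K) (r : M₀.K ⟶ M.K)
    {a : B ⟶ A} {c : D ⟶ C} {a' : A ⟶ B} {c' : C ⟶ D} (hi : IsLift M M₀ i a c)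
    (hr : IsLift M₀ M r a' c') (H : Homotopy (i ≫ r) (𝟙 _)) (haa : a ≫ a' = 𝟙 B)
    (hcc : c ≫ c' = 𝟙 D) (h : push S.E a ε = pull S.E c ε₀)
    (h' : push S.E a' ε₀ = pull S.E c' ε) : S.IsExangle ε M := by
  have key : ∀ k, i.f k ≫ r.f k = dNext k H.hom + prevD k H.hom + 𝟙 _ := fun k => by
    rw [← HomologicalComplex.comp_f, H.comm, HomologicalComplex.id_f]
  have e0 : i.f 0 ≫ r.f 0 = 𝟙 _ := by
    rw [hi.f_zero, hr.f_zero]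
    simp [reassoc_of% haa]
  have e1 : i.f (Fin.last (n + 1)) ≫ r.f (Fin.last (n + 1)) = 𝟙 _ := by
    rw [hi.f_last, hr.f_last]
    simp [reassoc_of% hcc]
  -- On the end terms the retraction holds strictly, so the homotopy contributes nothing there. This
  -- makes `i ≫ r` act as the identity on the first and last differentials.
  have hd0 : M.dFirst ≫ H.hom 1 0 ≫ M.K.d 0 1 = 0 := by
    have := key 0
    rw [e0, dNext_eq _ nShape_rel_zero_one, prevD_eq_zero _ _ (nShape_not_rel_zero _)] at this
    have h2 : M.K.d 0 1 ≫ H.hom 1 0 = 0 := by simpa using this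
    simp [NComplex.dFirst, reassoc_of% h2]
  have hdl : (M.K.d (Fin.last n).castSucc (Fin.last (n + 1)) ≫
      H.hom (Fin.last (n + 1)) (Fin.last n).castSucc) ≫ M.dLast = 0 := by
    have := key (Fin.last (n + 1))
    have h3 : dNext (Fin.last (n + 1)) H.hom = 0 := by
      change M.K.d _ _ ≫ _ = 0
      rw [M.K.shape _ _ (nShape_not_last_rel _), zero_comp]
    rw [e1, prevD_eq _ nShape_rel_last, h3] at this
    have h2 : H.hom (Fin.last (n + 1)) (Fin.last n).castSucc ≫ M.K.d _ (Fin.last (n + 1)) = 0 := by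
      simpa using this
    simp [NComplex.dLast, reassoc_of% h2]
  have hfirst : M.dFirst ≫ i.f 1 ≫ r.f 1 = M.dFirst := by
    rw [key, prevD_eq _ nShape_rel_zero_one]
    simp only [Preadditive.comp_add, hd0, Category.comp_id, add_zero]
    simp [NComplex.dFirst, dNext]
  have hlast : (i.f (Fin.last n).castSucc ≫ r.f (Fin.last n).castSucc) ≫ M.dLast = M.dLast := by
    rw [key, dNext_eq _ nShape_rel_last]
    simp only [Preadditive.add_comp, hdl, Category.id_comp, zero_add]
    simp [NComplex.dLast, prevD]
  refine ⟨?_, ?_, ?_, ?_, ?_, ?_⟩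
  · rw [← hfirst, ← Category.assoc, hi.dFirst, push_comp, push_comp, h, push_pull,
      h₀.push_dFirst, map_zero, map_zero]
  · rw [← hlast, Category.assoc, hr.dLast, pull_comp, pull_comp, ← h', ← push_pull,
      h₀.pull_dLast, map_zero, map_zero]
  · intro i' j k hij hjk T x hx
    obtain ⟨y, hy⟩ := h₀.exact_hom_from hij hjk (x ≫ i.f j) (by
      rw [Category.assoc, i.comm, reassoc_of% hx, zero_comp])
    -- Transporting the preimage back along `r` gives `x` only up to the homotopy; the second term
    -- removes that error.
    refine ⟨y ≫ r.f i' - x ≫ H.hom j i', ?_⟩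
    have := key j
    rw [dNext_eq _ hjk, prevD_eq _ hij] at this
    rw [Preadditive.sub_comp, Category.assoc, r.comm, reassoc_of% hy, this]
    simp [Preadditive.comp_add, reassoc_of% hx]
  · intro T x hx
    obtain ⟨y, hy⟩ := h₀.exact_hom_from_last (x ≫ c) (by
      rw [pull_comp, ← h, ← push_pull, hx, map_zero])
    refine ⟨y ≫ r.f _, ?_⟩
    rw [Category.assoc, hr.dLast, reassoc_of% hy, hcc, Category.comp_id]
  · intro i' j k hij hjk T x hx
    obtain ⟨y, hy⟩ := h₀.exact_hom_to hij hjk (r.f j ≫ x) (by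
      rw [← r.comm_assoc, hx, comp_zero])
    refine ⟨i.f k ≫ y - H.hom k j ≫ x, ?_⟩
    have := key j
    rw [dNext_eq _ hjk, prevD_eq _ hij] at this
    rw [Preadditive.comp_sub, ← i.comm_assoc, hy, reassoc_of% this]
    simp [Preadditive.add_comp, hx]
  · intro T x hx
    obtain ⟨y, hy⟩ := h₀.exact_hom_to_first (a' ≫ x) (by
      rw [push_comp, h', push_pull, hx, map_zero])
    refine ⟨i.f _ ≫ y, ?_⟩
    rw [← Category.assoc, hi.dFirst, Category.assoc, hy, reassoc_of% haa]

lemma IsExangle.of_htpyEquiv {δ : Ext S.E C A} {X Y : NComplex n A C} (hX : S.IsExangle δ X)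
    (h : X.HtpyEquiv Y) : S.IsExangle δ Y := by
  obtain ⟨f, g, hf, hg, _, ⟨H⟩⟩ := h
  exact hX.of_retract g f hg hf H (by simp) (by simp) (by rw [push_id, pull_id])
    (by rw [push_id, pull_id])

end Exangles

/-! ### Realisations and their direct factors -/

variable (S) in
/-- `𝔰` is an exact realisation of `𝔼`, apart from the axiom (R2), which is automatic for additive
categories. -/
structure IsRealisation : Prop where
  one_le : 1 ≤ n
  isClass : ∀ {A C : 𝒞} (δ : Ext S.E C A),
    ∃ X : NComplex n A C, ∀ Y : NComplex n A C, S.Realises δ Y ↔ X.HtpyEquiv Y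
  exists_lift : ∀ {A B C D : 𝒞} (δ : Ext S.E C A) (ρ : Ext S.E D B) (a : A ⟶ B) (c : C ⟶ D),
    push S.E a δ = pull S.E c ρ →
    ∀ (X : NComplex n A C) (Y : NComplex n B D), S.Realises δ X → S.Realises ρ Y →
    ∃ f : X.K ⟶ Y.K, X.IsLift Y f a c
  isExangle : ∀ {A C : 𝒞} (δ : Ext S.E C A) (X : NComplex n A C),
    S.Realises δ X → S.IsExangle δ X

lemma IsNExangulated.isRealisation (hS : S.IsNExangulated) : S.IsRealisation where
  one_le := hS.one_le
  isClass := hS.isClass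
  exists_lift := hS.exists_lift
  isExangle := hS.isExangle

namespace IsRealisation

variable {A B C D : 𝒞}

lemma exists_realises (hS : S.IsRealisation) (δ : Ext S.E C A) : ∃ X : NComplex n A C, S.Realises δ X := by
  obtain ⟨X, hX⟩ := hS.isClass δ
  exact ⟨X, (hX X).2 (HtpyEquiv.refl X)⟩

lemma realises_of_htpyEquiv (hS : S.IsRealisation) {δ : Ext S.E C A} {X Y : NComplex n A C} (hX : S.Realises δ X)
    (h : X.HtpyEquiv Y) : S.Realises δ Y := by
  obtain ⟨Z, hZ⟩ := hS.isClass δ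
  exact (hZ Y).2 (((hZ X).1 hX).trans h)

/-- The converse direction of (R1): an exangle is realising once it can be compared both ways with a
realising complex, because such a comparison is automatically a homotopy equivalence. -/
lemma realises_of_lifts [HasZeroObject 𝒞] (hS : S.IsRealisation) {δ : Ext S.E C A} {W X : NComplex n A C}
    (hW : S.Realises δ W) (hX : S.IsExangle δ X) (f : W.K ⟶ X.K) (g : X.K ⟶ W.K)
    (hf : IsLift W X f (𝟙 A) (𝟙 C)) (hg : IsLift X W g (𝟙 A) (𝟙 C)) : S.Realises δ X :=
  hS.realises_of_htpyEquiv hW ((hS.isExangle δ W hW).htpyEquiv hS.one_le hX f g hf hg)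

/-- A retract of a complex realising `ε₀` realises the corresponding retract of `ε₀`. -/
lemma realises_of_retract [HasZeroObject 𝒞] (hS : S.IsRealisation) {ε₀ : Ext S.E C A} {M₀ : NComplex n A C}
    (h₀ : S.Realises ε₀ M₀)
    {ε : Ext S.E D B} {M : NComplex n B D} (i : M.K ⟶ M₀.K) (r : M₀.K ⟶ M.K)
    {a : B ⟶ A} {c : D ⟶ C} {a' : A ⟶ B} {c' : C ⟶ D} (hi : IsLift M M₀ i a c)
    (hr : IsLift M₀ M r a' c') (hir : i ≫ r = 𝟙 _) (haa : a ≫ a' = 𝟙 B)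
    (hcc : c ≫ c' = 𝟙 D) (h : push S.E a ε = pull S.E c ε₀)
    (h' : push S.E a' ε₀ = pull S.E c' ε) : S.Realises ε M := by
  -- The candidate `M` is compared with an arbitrary realisation `W` of `ε` by passing through `M₀`:
  -- (R0) supplies maps between `W` and `M₀`, and `i`, `r` connect `M₀` with `M`.
  obtain ⟨W, hW⟩ := hS.exists_realises ε
  obtain ⟨f, hf⟩ := hS.exists_lift ε ε₀ a c h W M₀ hW h₀
  obtain ⟨g, hg⟩ := hS.exists_lift ε₀ ε a' c' h' M₀ W h₀ hW
  exact hS.realises_of_lifts hW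
    ((hS.isExangle _ _ h₀).of_retract i r hi hr (Homotopy.ofEq hir) haa hcc h h') (f ≫ r) (i ≫ g)
    ((hf.comp hr).congr haa hcc) ((hi.comp hg).congr haa hcc)

/-- Realisations are invariant under isomorphisms. -/
lemma realises_of_iso [HasZeroObject 𝒞] (hS : S.IsRealisation) {ε₀ : Ext S.E C A} {M₀ : NComplex n A C}
    (h₀ : S.Realises ε₀ M₀)
    {ε : Ext S.E D B} {M : NComplex n B D} (e : M.K ≅ M₀.K)
    (a : B ≅ A) (c : D ≅ C) (hi : IsLift M M₀ e.hom a.hom c.hom)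
    (h : push S.E a.hom ε = pull S.E c.hom ε₀) : S.Realises ε M := by
  have hr : IsLift M₀ M e.inv a.inv c.inv := by
    refine IsLift.mk' ?_ ?_
    · have h1 := hi.f_zero
      have h2 : e.hom.f 0 ≫ e.inv.f 0 = 𝟙 _ := by simp [← HomologicalComplex.comp_f]
      rw [h1] at h2
      rw [← cancel_epi (M.left.hom ≫ a.hom ≫ M₀.left.inv), h2]
      simp
    · have h1 := hi.f_last
      have h2 : e.hom.f (Fin.last (n + 1)) ≫ e.inv.f (Fin.last (n + 1)) = 𝟙 _ := by
        simp [← HomologicalComplex.comp_f]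
      rw [h1] at h2
      rw [← cancel_epi (M.right.hom ≫ c.hom ≫ M₀.right.inv), h2]
      simp
  refine hS.realises_of_retract h₀ e.hom e.inv hi hr (by simp) (by simp) (by simp) h ?_
  have h1 : pull S.E c.inv (push S.E a.hom ε) = ε₀ := by
    rw [h, ← pull_comp, c.inv_hom_id, pull_id]
  rw [← h1, push_pull, ← push_comp, a.hom_inv_id, push_id]

/-- In any realisation of the zero extension the first differential has a retraction, because the
identity of `A` pushes `0` to `0`. The trivial complex is thereby a direct factor of that
realisation. -/
lemma realises_trivFirst [HasZeroObject 𝒞] (hS : S.IsRealisation) (A : 𝒞) {Z : 𝒞} (hZ : IsZero Z) :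
    S.Realises (0 : Ext S.E Z A) (NComplex.trivFirst hS.one_le A hZ) := by
  obtain ⟨W, hW⟩ := hS.exists_realises (0 : Ext S.E Z A)
  have h01 := nShape_ne (nShape_rel_zero_one (n := n))
  obtain ⟨r, hr⟩ := (hS.isExangle _ _ hW).exact_hom_to_first (𝟙 A) (map_zero _)
  have hr' : W.K.d 0 1 ≫ r = W.left.hom := by
    rw [← cancel_epi W.left.inv]
    simpa [NComplex.dFirst] using hr
  refine hS.realises_of_retract hW (M := NComplex.trivFirst hS.one_le A hZ)
    (fromDbl nShape_rel_zero_one h01 W.left.inv)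
    (toDbl nShape_rel_zero_one h01 r) (a := 𝟙 _) (a' := 𝟙 _) (c := 𝟙 _) (c' := 𝟙 _)
    ⟨?_, hZ.eq_of_tgt _ _⟩ ⟨?_, hZ.eq_of_tgt _ _⟩ ?_ (by simp) (by simp) (by simp) (by simp)
  · simp [NComplex.trivFirst]
  · simp [NComplex.trivFirst, hr']
  · apply HomologicalComplex.from_double_hom_ext
    · change (fromDbl nShape_rel_zero_one h01 W.left.inv ≫ toDbl nShape_rel_zero_one h01 r).f 0 = _
      rw [HomologicalComplex.comp_f, fromDbl_f₀, toDbl_f₀, ← Category.assoc (W.K.d 0 1), hr']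
      simp [NComplex.trivFirst]
    · change (fromDbl nShape_rel_zero_one h01 W.left.inv ≫ toDbl nShape_rel_zero_one h01 r).f 1 = _
      rw [HomologicalComplex.comp_f, fromDbl_f₁, toDbl_f₁]
      simp [reassoc_of% hr', NComplex.trivFirst]

/-- Dually, the last differential of a realisation of the zero extension has a section. -/
lemma realises_trivLast [HasZeroObject 𝒞] (hS : S.IsRealisation) (A : 𝒞) {Z : 𝒞} (hZ : IsZero Z) :
    S.Realises (0 : Ext S.E A Z) (NComplex.trivLast hS.one_le A hZ) := by
  obtain ⟨W, hW⟩ := hS.exists_realises (0 : Ext S.E A Z)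
  have hl := nShape_ne (nShape_rel_last (n := n))
  obtain ⟨s, hs⟩ := (hS.isExangle _ _ hW).exact_hom_from_last (𝟙 A) (map_zero _)
  have hs' : s ≫ W.K.d (Fin.last n).castSucc (Fin.last (n + 1)) = W.right.inv := by
    rw [← cancel_mono W.right.hom]
    simpa [NComplex.dLast] using hs
  refine hS.realises_of_retract hW (M := NComplex.trivLast hS.one_le A hZ)
    (fromDbl nShape_rel_last hl s)
    (toDbl nShape_rel_last hl W.right.hom) (a := 𝟙 _) (a' := 𝟙 _) (c := 𝟙 _) (c' := 𝟙 _)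
    ⟨hZ.eq_of_tgt _ _, ?_⟩ ⟨hZ.eq_of_tgt _ _, ?_⟩ ?_ (by simp) (by simp) (by simp) (by simp)
  · simp [NComplex.trivLast, hs']
  · simp [NComplex.trivLast]
  · apply HomologicalComplex.from_double_hom_ext
    · change (fromDbl nShape_rel_last hl s ≫ toDbl nShape_rel_last hl W.right.hom).f _ = _
      rw [HomologicalComplex.comp_f, fromDbl_f₀, toDbl_f₀]
      simp [reassoc_of% hs', NComplex.trivLast]
    · change (fromDbl nShape_rel_last hl s ≫ toDbl nShape_rel_last hl W.right.hom).f _ = _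
      rw [HomologicalComplex.comp_f, fromDbl_f₁, toDbl_f₁]
      simp [reassoc_of% hs', NComplex.trivLast]

end IsRealisation

end ExtensionStructure

end NExang

end

set_option linter.unusedSectionVars false

noncomputable section

namespace NExang

open NComplex ExtensionStructure

/-! ### Split idempotents -/

section Split

variable {𝒞 : Type u} [Category.{v} 𝒞] [Preadditive 𝒞]

/-- The endomorphism `φ` is a split idempotent. -/
def Splits {X : 𝒞} (φ : X ⟶ X) : Prop :=
  ∃ (Y : 𝒞) (r : X ⟶ Y) (s : Y ⟶ X), r ≫ s = φ ∧ s ≫ r = 𝟙 Y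

/-- The idempotents `α ≫ β` and `β ≫ α` have isomorphic images. This moves a splitting from the
contractible complex, where it is visible, to the exangle. -/
lemma Splits.swap {X D : 𝒞} {α : X ⟶ D} {β : D ⟶ X} (h : β ≫ α ≫ β = β)
    (hs : Splits (β ≫ α)) : Splits (α ≫ β) := by
  obtain ⟨Y, r, s, hrs, hsr⟩ := hs
  refine ⟨Y, α ≫ r, s ≫ β, ?_, ?_⟩
  · simp [reassoc_of% hrs, h]
  · rw [Category.assoc, ← Category.assoc β, ← hrs]
    simp [hsr]

lemma Splits.conj {X Y : 𝒞} {φ : X ⟶ X} (h : Splits φ) (e : Y ≅ X) :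
    Splits (e.hom ≫ φ ≫ e.inv) := by
  obtain ⟨Z, r, s, rfl, hsr⟩ := h
  exact ⟨Z, e.hom ≫ r, s ≫ e.inv, by simp, by simp [hsr]⟩

lemma Splits.of_isZero {X : 𝒞} (hX : IsZero X) (φ : X ⟶ X) : Splits φ :=
  ⟨X, 𝟙 X, 𝟙 X, hX.eq_of_src _ _, by simp⟩

/-- Orthogonality makes the sum of the two images the image of the sum. -/
lemma Splits.add [HasBinaryBiproducts 𝒞] {X : 𝒞} {φ ψ : X ⟶ X} (h : Splits φ) (h' : Splits ψ)
    (h₁ : φ ≫ ψ = 0) (h₂ : ψ ≫ φ = 0) : Splits (φ + ψ) := by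
  obtain ⟨Y, r, s, rfl, hsr⟩ := h
  obtain ⟨Y', r', s', rfl, hsr'⟩ := h'
  have h₃ : s ≫ r' = 0 := by
    have := s ≫= h₁ =≫ r'
    simpa [hsr', reassoc_of% hsr] using this
  have h₄ : s' ≫ r = 0 := by
    have := s' ≫= h₂ =≫ r
    simpa [hsr, reassoc_of% hsr'] using this
  refine ⟨Y ⊞ Y', biprod.lift r r', biprod.desc s s', by simp, ?_⟩
  ext <;> simp [h₃, h₄, hsr, hsr']

end Split

section Doubles

variable {𝒱 : Type u} [Category.{v} 𝒱] [Preadditive 𝒱] [HasZeroObject 𝒱]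
  {ι : Type*} {c : ComplexShape ι} {i j : ι}

lemma fromDbl_comp (hij : c.Rel i j) (h : i ≠ j) {K L : HomologicalComplex 𝒱 c} {T : 𝒱}
    (ψ : T ⟶ K.X i) (g : K ⟶ L) : fromDbl hij h ψ ≫ g = fromDbl hij h (ψ ≫ g.f i) := by
  apply HomologicalComplex.from_double_hom_ext <;> simp

lemma fromDbl_zero (hij : c.Rel i j) (h : i ≠ j) {K : HomologicalComplex 𝒱 c} {T : 𝒱} :
    fromDbl hij h (0 : T ⟶ K.X i) = 0 := by
  apply HomologicalComplex.from_double_hom_ext <;> simp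

/-- In the two nonzero degrees the component is conjugate to the same endomorphism of `T`; elsewhere
the object is zero. -/
lemma splits_dbl (hij : c.Rel i j) (h : i ≠ j) {K : HomologicalComplex 𝒱 c} {T : 𝒱}
    (φ : K.X j ⟶ T) (ψ : T ⟶ K.X i) (hs : Splits (ψ ≫ K.d i j ≫ φ)) (k : ι) :
    Splits ((fromDbl hij h ψ ≫ toDbl hij h φ).f k) := by
  by_cases hi : k = i
  · subst hi
    simpa using hs.conj (HomologicalComplex.doubleXIso₀ (𝟙 T) hij)
  by_cases hj : k = j
  · subst hj
    simpa using hs.conj (HomologicalComplex.doubleXIso₁ (𝟙 T) hij h)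
  exact Splits.of_isZero (HomologicalComplex.isZero_double_X (𝟙 T) hij k hi hj) _

end Doubles

/-! ### Lifting idempotents from the ends to an exangle -/

section Idempotents

variable {𝒞 : Type u} [Category.{v} 𝒞] [Preadditive 𝒞] [HasFiniteBiproducts 𝒞] {n : ℕ}
  {S : ExtensionStructure.{w} 𝒞 n}

/-- A pair of idempotents of the end terms which fix an extension lifts to an idempotent of any
exangle of this extension. -/
lemma ExtensionStructure.IsExangle.exists_idempotent (hn : 1 ≤ n) {A C : 𝒞} {δ : Ext S.E C A}
    {X : NComplex n A C} (hX : S.IsExangle δ X) {p : A ⟶ A} {q : C ⟶ C} (hp : p ≫ p = p)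
    (hq : q ≫ q = q)
    (ha : push S.E (𝟙 A - p) δ = 0) (hc : pull S.E (𝟙 C - q) δ = 0) :
    ∃ e : X.K ⟶ X.K, e ≫ e = e ∧ X.IsLift X e p q ∧
      (Splits (𝟙 A - p) → Splits (𝟙 C - q) → ∀ i, Splits (𝟙 _ - e.f i)) := by
  have hp' : (𝟙 A - p) ≫ (𝟙 A - p) = 𝟙 A - p := by simp [hp]
  have hq' : (𝟙 C - q) ≫ (𝟙 C - q) = 𝟙 C - q := by simp [hq]
  obtain ⟨k, hk⟩ := hX.exact_hom_to_first _ ha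
  obtain ⟨l₀, hl₀⟩ := hX.exact_hom_from_last _ hc
  have h01 := nShape_ne (nShape_rel_zero_one (n := n))
  have hnl := nShape_ne (nShape_rel_last (n := n))
  have hk' : X.K.d 0 1 ≫ k = X.left.hom ≫ (𝟙 A - p) := by
    rw [← hk]; simp [NComplex.dFirst]
  -- The contractible complex is built on `A` itself, since an image of `1 - p` need not exist in
  -- `𝒞`. The factor `1 - p` in `β₀` makes `α₀ ≫ β₀` idempotent all the same.
  let α₀ := toDbl (nShape_rel_zero_one (n := n)) h01 k
  let β₀ := fromDbl (nShape_rel_zero_one (n := n)) h01 ((𝟙 A - p) ≫ X.left.inv)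
  have hmid₀ : ((𝟙 A - p) ≫ X.left.inv) ≫ X.K.d 0 1 ≫ k = 𝟙 A - p := by
    rw [hk', Category.assoc, Iso.inv_hom_id_assoc, hp']
  have h₀ : β₀ ≫ α₀ ≫ β₀ = β₀ := by
    simp only [β₀]
    rw [fromDbl_comp]
    congr 1
    simp only [α₀, HomologicalComplex.comp_f, toDbl_f₀, fromDbl_f₀, Category.assoc,
      Iso.inv_hom_id_assoc]
    rw [reassoc_of% hk', Iso.inv_hom_id_assoc, reassoc_of% hp', reassoc_of% hp']
  let E := α₀ ≫ β₀
  have hE : E ≫ E = E := by simp only [E, Category.assoc, h₀]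
  have hEl : X.IsLift X E (𝟙 A - p) 0 := IsLift.mk'
    (by
      simp only [E, α₀, β₀, HomologicalComplex.comp_f, toDbl_f₀, fromDbl_f₀, Category.assoc,
        Iso.inv_hom_id_assoc]
      rw [reassoc_of% hk', reassoc_of% hp'])
    (by
      simp only [E]
      rw [dbl_comp_f_eq_zero _ _ last_ne_zero (last_ne_one hn)]
      simp)
  -- The factorisation `l₀` of `1 - q` through the last differential is corrected on both sides: by
  -- `1 - q` so that `E'` is idempotent, and by `1 - E` so that `E'` followed by `E` vanishes. The
  -- latter costs nothing, because `1 - E` is the identity on `C`.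
  let l := (𝟙 C - q) ≫ l₀ ≫ (𝟙 X.K - E).f (Fin.last n).castSucc
  have hl : l ≫ X.dLast = 𝟙 C - q := by
    have h1 : (𝟙 X.K - E).f (Fin.last n).castSucc ≫ X.dLast = X.dLast := by
      rw [((IsLift.id X).sub hEl).dLast]; simp
    simp only [l, Category.assoc, h1, hl₀, hq']
  have hql : (𝟙 C - q) ≫ l = l := by simp only [l, reassoc_of% hq']
  have hlE : l ≫ E.f (Fin.last n).castSucc = 0 := by
    have h1 : (𝟙 X.K - E) ≫ E = 0 := by simp [hE]
    have h2 := HomologicalComplex.congr_hom h1 (Fin.last n).castSucc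
    rw [HomologicalComplex.comp_f] at h2
    simp only [l, Category.assoc, h2]
    simp
  let α₁ := toDbl (nShape_rel_last (n := n)) hnl (X.right.hom ≫ (𝟙 C - q))
  let β₁ := fromDbl (nShape_rel_last (n := n)) hnl l
  have hmid₁ : l ≫ X.K.d _ _ ≫ X.right.hom ≫ (𝟙 C - q) = 𝟙 C - q := by
    have : l ≫ X.K.d _ _ ≫ X.right.hom = 𝟙 C - q := hl
    rw [reassoc_of% this, hq']
  have h₁ : β₁ ≫ α₁ ≫ β₁ = β₁ := by
    simp only [β₁]
    rw [fromDbl_comp]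
    congr 1
    simp only [α₁, HomologicalComplex.comp_f, toDbl_f₀, fromDbl_f₀, Category.assoc,
      Iso.inv_hom_id_assoc]
    rw [reassoc_of% hmid₁, hql]
  let E' := α₁ ≫ β₁
  have hE' : E' ≫ E' = E' := by simp only [E', Category.assoc, h₁]
  have hEl' : X.IsLift X E' 0 (𝟙 C - q) := IsLift.mk'
    (by
      simp only [E']
      rw [dbl_comp_f_eq_zero _ _ (castSucc_last_ne_zero hn).symm last_ne_zero.symm]
      simp)
    (by
      have : l ≫ X.K.d _ _ ≫ X.right.hom = 𝟙 C - q := hl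
      have h2 : l ≫ X.K.d _ _ = (𝟙 C - q) ≫ X.right.inv := by rw [← this]; simp
      simp only [E', α₁, β₁, HomologicalComplex.comp_f, toDbl_f₁, fromDbl_f₁, Category.assoc,
        Iso.inv_hom_id_assoc]
      rw [h2, reassoc_of% hq'])
  have hEE' : E ≫ E' = 0 := by
    -- A map out of `A = A` is determined by its component in degree 0, where the contractible
    -- complex in degrees `n, n + 1` vanishes since `n ≥ 1`.
    have : β₀ ≫ α₁ = 0 := by
      simp only [β₀]
      rw [fromDbl_comp]
      have : α₁.f 0 = 0 := (HomologicalComplex.isZero_double_X _ _ _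
        (castSucc_last_ne_zero hn).symm last_ne_zero.symm).eq_of_tgt _ _
      rw [this, comp_zero, fromDbl_zero]
    simp only [E, E', Category.assoc, reassoc_of% this, zero_comp, comp_zero]
  have hE'E : E' ≫ E = 0 := by
    have : β₁ ≫ E = 0 := by
      simp only [β₁]
      rw [fromDbl_comp, hlE, fromDbl_zero]
    simp only [E', Category.assoc, this, comp_zero]
  refine ⟨𝟙 _ - E - E', ?_, ?_, ?_⟩
  · simp [hE, hE', hEE', hE'E]
  · exact (((IsLift.id X).sub hEl).sub hEl').congr (by simp) (by simp)
  · intro hsp hsq i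
    have := hasBinaryBiproducts_of_finite_biproducts 𝒞
    have : 𝟙 _ - (𝟙 X.K - E - E').f i = E.f i + E'.f i := by
      simp
      abel
    rw [this]
    refine Splits.add ?_ ?_ ?_ ?_
    · refine Splits.swap ?_ ?_
      · exact HomologicalComplex.congr_hom h₀ i
      · exact splits_dbl _ _ _ _ (by rwa [hmid₀]) i
    · refine Splits.swap ?_ ?_
      · exact HomologicalComplex.congr_hom h₁ i
      · exact splits_dbl _ _ _ _ (by rwa [hmid₁]) i
    · exact HomologicalComplex.congr_hom hEE' i
    · exact HomologicalComplex.congr_hom hE'E i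

end Idempotents

/-! ### Direct factors in the idempotent completion -/

section Karoubi

variable {𝒞 : Type u} [Category.{v} 𝒞]

/-- The inclusion of a formal direct factor. -/
@[simps]
def karι (P : Karoubi 𝒞) : P ⟶ (toKaroubi 𝒞).obj P.X := ⟨P.p, by simp⟩

/-- The projection to a formal direct factor. -/
@[simps]
def karπ (P : Karoubi 𝒞) : (toKaroubi 𝒞).obj P.X ⟶ P := ⟨P.p, by simp⟩

@[simp]
lemma karι_karπ (P : Karoubi 𝒞) : karι P ≫ karπ P = 𝟙 P := by
  ext
  simp

@[simp]
lemma karι_karπ_assoc (P : Karoubi 𝒞) {Q : Karoubi 𝒞} (f : P ⟶ Q) :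
    karι P ≫ karπ P ≫ f = f := by
  rw [← Category.assoc, karι_karπ, Category.id_comp]

section Ext

variable {E : 𝒞ᵒᵖ ⥤ 𝒞 ⥤ AddCommGrpCat.{w}}

lemma underlying_injective {P Q : Karoubi 𝒞} {δ ε : Ext (karoubiE E) Q P}
    (h : underlying E δ = underlying E ε) : δ = ε := Subtype.ext h

lemma underlying_push {P P' Q : Karoubi 𝒞} (a : P ⟶ P') (δ : Ext (karoubiE E) Q P) :
    underlying E (push (karoubiE E) a δ) = push E a.f (underlying E δ) := rfl

lemma underlying_pull {P Q Q' : Karoubi 𝒞} (c : Q' ⟶ Q) (δ : Ext (karoubiE E) Q P) :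
    underlying E (pull (karoubiE E) c δ) = pull E c.f (underlying E δ) := rfl

lemma push_p_underlying {P Q : Karoubi 𝒞} (δ : Ext (karoubiE E) Q P) :
    push E P.p (underlying E δ) = underlying E δ := δ.2.1

lemma pull_p_underlying {P Q : Karoubi 𝒞} (δ : Ext (karoubiE E) Q P) :
    pull E Q.p (underlying E δ) = underlying E δ := δ.2.2

/-- An extension in `𝔼`, seen as an extension in `𝔽`. -/
def ofExt {A C : 𝒞} (δ : Ext E C A) :
    Ext (karoubiE E) ((toKaroubi 𝒞).obj C) ((toKaroubi 𝒞).obj A) :=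
  (⟨δ, push_id E δ, pull_id E δ⟩ :
    karoubiSubgroup E ((toKaroubi 𝒞).obj C) ((toKaroubi 𝒞).obj A))

/-- With `push_karπ`, this exhibits every extension in `𝔽` as a direct factor of its underlying
extension, in the form required by the retract lemmas. -/
lemma push_karι {P Q : Karoubi 𝒞} (δ : Ext (karoubiE E) Q P) :
    push (karoubiE E) (karι P) δ = pull (karoubiE E) (karι Q) (ofExt (underlying E δ)) :=
  underlying_injective ((push_p_underlying δ).trans (pull_p_underlying δ).symm)

lemma push_karπ {P Q : Karoubi 𝒞} (δ : Ext (karoubiE E) Q P) :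
    push (karoubiE E) (karπ P) (ofExt (underlying E δ)) = pull (karoubiE E) (karπ Q) δ :=
  underlying_injective ((push_p_underlying δ).trans (pull_p_underlying δ).symm)

end Ext

variable [Preadditive 𝒞] {n : ℕ}

/-- The inclusion of the direct factor `(X, e)` of `X`. -/
def karIncl {P Q : Karoubi 𝒞} (X : NComplex n P.X Q.X) (e : X.K ⟶ X.K) (he : e ≫ e = e)
    (hl : X.IsLift X e P.p Q.p) :
    (karoubiNComplex X e he hl).K ⟶ (X.map (toKaroubi 𝒞)).K where
  f i := ⟨e.f i, by
    have : e.f i ≫ e.f i = e.f i := by rw [← HomologicalComplex.comp_f, he]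
    change e.f i ≫ e.f i ≫ 𝟙 _ = e.f i
    rw [Category.comp_id, this]⟩
  comm' i j _ := by
    have this : ∀ k, e.f k ≫ e.f k = e.f k := fun k => by rw [← HomologicalComplex.comp_f, he]
    apply Karoubi.hom_ext
    change e.f i ≫ X.K.d i j = (e.f i ≫ X.K.d i j ≫ e.f j) ≫ e.f j
    simp only [← e.comm, Category.assoc, reassoc_of% this]

/-- The projection to the direct factor `(X, e)` of `X`. -/
def karProj {P Q : Karoubi 𝒞} (X : NComplex n P.X Q.X) (e : X.K ⟶ X.K) (he : e ≫ e = e)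
    (hl : X.IsLift X e P.p Q.p) :
    (X.map (toKaroubi 𝒞)).K ⟶ (karoubiNComplex X e he hl).K where
  f i := ⟨e.f i, by
    have : e.f i ≫ e.f i = e.f i := by rw [← HomologicalComplex.comp_f, he]
    change 𝟙 _ ≫ e.f i ≫ e.f i = e.f i
    rw [Category.id_comp, this]⟩
  comm' i j _ := by
    have this : ∀ k, e.f k ≫ e.f k = e.f k := fun k => by rw [← HomologicalComplex.comp_f, he]
    apply Karoubi.hom_ext
    change e.f i ≫ e.f i ≫ X.K.d i j ≫ e.f j = X.K.d i j ≫ e.f j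
    simp only [← e.comm, reassoc_of% this]

lemma karIncl_karProj {P Q : Karoubi 𝒞} (X : NComplex n P.X Q.X) (e : X.K ⟶ X.K)
    (he : e ≫ e = e) (hl : X.IsLift X e P.p Q.p) :
    karIncl X e he hl ≫ karProj X e he hl = 𝟙 _ := by
  ext i
  change e.f i ≫ e.f i = e.f i
  rw [← HomologicalComplex.comp_f, he]

lemma isLift_karIncl {P Q : Karoubi 𝒞} (X : NComplex n P.X Q.X) (e : X.K ⟶ X.K)
    (he : e ≫ e = e) (hl : X.IsLift X e P.p Q.p) :
    IsLift (karoubiNComplex X e he hl) (X.map (toKaroubi 𝒞)) (karIncl X e he hl)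
      (karι P) (karι Q) := by
  refine ⟨?_, ?_⟩
  · ext
    change e.f 0 ≫ X.left.hom = (X.left.hom ≫ P.p) ≫ P.p
    rw [hl.left, Category.assoc, P.idem]
  · ext
    change e.f _ ≫ X.right.hom = (X.right.hom ≫ Q.p) ≫ Q.p
    rw [hl.right, Category.assoc, Q.idem]

lemma isLift_karProj {P Q : Karoubi 𝒞} (X : NComplex n P.X Q.X) (e : X.K ⟶ X.K)
    (he : e ≫ e = e) (hl : X.IsLift X e P.p Q.p) :
    IsLift (X.map (toKaroubi 𝒞)) (karoubiNComplex X e he hl) (karProj X e he hl)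
      (karπ P) (karπ Q) := by
  refine ⟨?_, ?_⟩
  · ext
    change e.f 0 ≫ X.left.hom ≫ P.p = X.left.hom ≫ P.p
    rw [reassoc_of% hl.left, P.idem]
  · ext
    change e.f _ ≫ X.right.hom ≫ Q.p = X.right.hom ≫ Q.p
    rw [reassoc_of% hl.right, Q.idem]

variable {S : ExtensionStructure.{w} 𝒞 n}

/-- Exactness need only be tested in `𝒞`: a morphism to or from a formal direct factor of `T.X` is a
morphism of `𝒞` on `T.X`, and a solution found there becomes one in the completion after composition
with the idempotent. -/
lemma isExangle_map_toKaroubi {A C : 𝒞} {δ : Ext S.E C A} {X : NComplex n A C}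
    (hX : S.IsExangle δ X) : S.karoubi.IsExangle (ofExt δ) (X.map (toKaroubi 𝒞)) where
  push_dFirst := underlying_injective (by
    erw [underlying_push]
    rw [NComplex.map_dFirst]
    exact hX.push_dFirst)
  pull_dLast := underlying_injective (by
    erw [underlying_pull]
    rw [NComplex.map_dLast]
    exact hX.pull_dLast)
  exact_hom_from {i j k} hij hjk T x hx := by
    obtain ⟨y, hy⟩ := hX.exact_hom_from hij hjk x.f (congrArg Karoubi.Hom.f hx)
    refine ⟨karι T ≫ (toKaroubi 𝒞).map y, ?_⟩
    ext
    change (T.p ≫ y) ≫ X.K.d i j = x.f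
    rw [Category.assoc, hy]
    exact Karoubi.p_comp x
  exact_hom_from_last {T} x hx := by
    obtain ⟨y, hy⟩ := hX.exact_hom_from_last x.f (congrArg (underlying S.E) hx)
    refine ⟨karι T ≫ (toKaroubi 𝒞).map y, ?_⟩
    rw [NComplex.map_dLast]
    ext
    change (T.p ≫ y) ≫ X.dLast = x.f
    rw [Category.assoc, hy]
    exact Karoubi.p_comp x
  exact_hom_to {i j k} hij hjk T x hx := by
    obtain ⟨y, hy⟩ := hX.exact_hom_to hij hjk x.f (congrArg Karoubi.Hom.f hx)
    refine ⟨(toKaroubi 𝒞).map y ≫ karπ T, ?_⟩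
    ext
    change X.K.d j k ≫ y ≫ T.p = x.f
    rw [← Category.assoc, hy]
    exact Karoubi.comp_p x
  exact_hom_to_first {T} x hx := by
    obtain ⟨y, hy⟩ := hX.exact_hom_to_first x.f (congrArg (underlying S.E) hx)
    refine ⟨(toKaroubi 𝒞).map y ≫ karπ T, ?_⟩
    rw [NComplex.map_dFirst]
    ext
    change X.dFirst ≫ y ≫ T.p = x.f
    rw [← Category.assoc, hy]
    exact Karoubi.comp_p x

lemma isExangle_karoubiNComplex {P Q : Karoubi 𝒞} {δ : Ext (karoubiE S.E) Q P}
    {X : NComplex n P.X Q.X} (hX : S.IsExangle (underlying S.E δ) X) (e : X.K ⟶ X.K)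
    (he : e ≫ e = e) (hl : X.IsLift X e P.p Q.p) :
    S.karoubi.IsExangle δ (karoubiNComplex X e he hl) :=
  (isExangle_map_toKaroubi hX).of_retract _ _ (isLift_karIncl X e he hl)
    (isLift_karProj X e he hl) (Homotopy.ofEq (karIncl_karProj X e he hl)) (karι_karπ P)
    (karι_karπ Q) (push_karι δ) (push_karπ δ)

end Karoubi

/-! ### The realisation of the idempotent completion -/

section KaroubiRealisation

variable {𝒞 : Type u} [Category.{v} 𝒞] [Preadditive 𝒞] {n : ℕ} {S : ExtensionStructure.{w} 𝒞 n}

lemma push_add_of_additive (hE : ∀ C : 𝒞ᵒᵖ, (S.E.obj C).Additive) {A B C : 𝒞} (a b : A ⟶ B)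
    (δ : Ext S.E C A) : push S.E (a + b) δ = push S.E a δ + push S.E b δ := by
  have := hE (op C)
  simp [push]

lemma pull_add_of_additive (hE : S.E.Additive) {A C D : 𝒞} (c d : D ⟶ C) (δ : Ext S.E C A) :
    pull S.E (c + d) δ = pull S.E c δ + pull S.E d δ := by
  simp [pull]

lemma push_one_sub (hE : ∀ C : 𝒞ᵒᵖ, (S.E.obj C).Additive) {A C : 𝒞} {p : A ⟶ A}
    {δ : Ext S.E C A} (h : push S.E p δ = δ) : push S.E (𝟙 A - p) δ = 0 := by
  have := hE (op C)
  have h1 : push S.E (𝟙 A - p) δ = push S.E (𝟙 A) δ - push S.E p δ := by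
    simp [push]
  rw [h1, push_id, h, sub_self]

lemma pull_one_sub (hE : S.E.Additive) {A C : 𝒞} {q : C ⟶ C}
    {δ : Ext S.E C A} (h : pull S.E q δ = δ) : pull S.E (𝟙 C - q) δ = 0 := by
  have h1 : pull S.E (𝟙 C - q) δ = pull S.E (𝟙 C) δ - pull S.E q δ := by
    simp [pull, op_sub]
  rw [h1, pull_id, h, sub_self]

variable [HasFiniteBiproducts 𝒞]

lemma ExtensionStructure.IsNExangulated.exists_karoubiNComplex (hS : S.IsNExangulated)
    {P Q : Karoubi 𝒞} (δ : Ext (karoubiE S.E) Q P) :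
    ∃ (X : NComplex n P.X Q.X) (e : X.K ⟶ X.K) (_ : e ≫ e = e) (_ : X.IsLift X e P.p Q.p),
      S.Realises (underlying S.E δ) X ∧
      (Splits (𝟙 P.X - P.p) → Splits (𝟙 Q.X - Q.p) → ∀ i, Splits (𝟙 _ - e.f i)) := by
  obtain ⟨X, hX⟩ := hS.isRealisation.exists_realises (underlying S.E δ)
  obtain ⟨e, he, hl, h⟩ := (hS.isExangle _ X hX).exists_idempotent hS.one_le P.idem Q.idem
    (push_one_sub hS.additive_snd (push_p_underlying δ))
    (pull_one_sub hS.additive_fst (pull_p_underlying δ))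
  exact ⟨X, e, he, hl, hX, h⟩

/-- A lift in `𝒞` between the ambient complexes, sandwiched between the inclusion of one direct
factor and the projection to the other. -/
lemma ExtensionStructure.IsNExangulated.exists_lift_karoubiNComplex (hS : S.IsNExangulated)
    {P P' Q Q' : Karoubi 𝒞} {δ : Ext (karoubiE S.E) Q P} {ρ : Ext (karoubiE S.E) Q' P'}
    (a : P ⟶ P') (c : Q ⟶ Q') (h : push S.karoubi.E a δ = pull S.karoubi.E c ρ)
    (X : NComplex n P.X Q.X) (e : X.K ⟶ X.K) (he : e ≫ e = e) (hl : X.IsLift X e P.p Q.p)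
    (X' : NComplex n P'.X Q'.X) (e' : X'.K ⟶ X'.K) (he' : e' ≫ e' = e')
    (hl' : X'.IsLift X' e' P'.p Q'.p) (hX : S.Realises (underlying S.E δ) X)
    (hX' : S.Realises (underlying S.E ρ) X') :
    ∃ f, IsLift (karoubiNComplex X e he hl) (karoubiNComplex X' e' he' hl') f a c := by
  obtain ⟨f, hf⟩ := hS.exists_lift _ _ a.f c.f (congrArg (underlying S.E) h) X X' hX hX'
  refine ⟨_, (((isLift_karIncl X e he hl).comp (hf.map (toKaroubi 𝒞))).comp
    (isLift_karProj X' e' he' hl')).congr ?_ ?_⟩ <;> ext <;> simp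

/-- The idempotent completion satisfies the axioms on the realisation. -/
lemma ExtensionStructure.IsNExangulated.isRealisation_karoubi (hS : S.IsNExangulated) :
    S.karoubi.IsRealisation where
  one_le := hS.one_le
  isClass {P Q} δ := by
    obtain ⟨X, e, he, hl, hX, -⟩ := hS.exists_karoubiNComplex δ
    refine ⟨karoubiNComplex X e he hl, fun Y => ⟨?_, fun h => ⟨X, e, he, hl, hX, h⟩⟩⟩
    -- This is the independence of `𝔱(δ)` from the chosen complex and idempotent: two choices are
    -- exangles of the same extension with lifts of the identities in both directions.
    rintro ⟨X', e', he', hl', hX', h⟩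
    refine HtpyEquiv.trans ?_ h
    obtain ⟨f, hf⟩ := hS.exists_lift_karoubiNComplex (𝟙 P) (𝟙 Q)
      (by rw [push_id, pull_id]) X e he hl X' e' he' hl' hX hX'
    obtain ⟨g, hg⟩ := hS.exists_lift_karoubiNComplex (𝟙 P) (𝟙 Q)
      (by rw [push_id, pull_id]) X' e' he' hl' X e he hl hX' hX
    exact (isExangle_karoubiNComplex (hS.isExangle _ X hX) e he hl).htpyEquiv hS.one_le
      (isExangle_karoubiNComplex (hS.isExangle _ X' hX') e' he' hl') f g hf hg
  exists_lift {P P' Q Q'} δ ρ a c h Z Z' := by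
    rintro ⟨X, e, he, hl, hX, f₁, g₁, hf₁, hg₁, -⟩ ⟨X', e', he', hl', hX', f₂, g₂, hf₂, hg₂, -⟩
    obtain ⟨f, hf⟩ := hS.exists_lift_karoubiNComplex a c h X e he hl X' e' he' hl' hX hX'
    exact ⟨_, ((hg₁.comp hf).comp hf₂).congr (by simp) (by simp)⟩
  isExangle δ Z := by
    rintro ⟨X, e, he, hl, hX, h⟩
    exact (isExangle_karoubiNComplex (hS.isExangle _ X hX) e he hl).of_htpyEquiv h

/-- The inclusion of `𝒞` in its idempotent completion preserves realisations. -/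
lemma ExtensionStructure.realises_map_toKaroubi {A C : 𝒞}
    {δ : Ext S.E C A} {X : NComplex n A C} (hX : S.Realises δ X) :
    S.karoubi.Realises (ofExt δ) (X.map (toKaroubi 𝒞)) := by
  have he : 𝟙 X.K ≫ 𝟙 X.K = 𝟙 X.K := Category.comp_id _
  have hl : X.IsLift X (𝟙 X.K) ((toKaroubi 𝒞).obj A).p ((toKaroubi 𝒞).obj C).p := IsLift.id X
  refine ⟨X, 𝟙 _, he, hl, hX, ?_⟩
  let P := (toKaroubi 𝒞).obj A
  let Q := (toKaroubi 𝒞).obj C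
  refine HtpyEquiv.of_iso (karIncl (P := P) (Q := Q) X (𝟙 _) he hl)
    (karProj (P := P) (Q := Q) X (𝟙 _) he hl) (isLift_karIncl (P := P) (Q := Q) X (𝟙 _) he hl)
    (karIncl_karProj (P := P) (Q := Q) X (𝟙 _) he hl) ?_
  ext i
  change 𝟙 _ ≫ 𝟙 _ = 𝟙 _
  simp

end KaroubiRealisation

end NExang

end

noncomputable section

namespace NExang

open NComplex ExtensionStructure

/-! ### Realising complexes as strict direct factors of complexes of `𝒞` -/

section Presentation

lemma NComplex.IsLift.of_zero {𝒱 : Type u'} [Category.{v'} 𝒱] [Preadditive 𝒱] {n : ℕ}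
    {A B C D : 𝒱} {X : NComplex n A C} {Y : NComplex n B D} {f : X.K ⟶ Y.K}
    (h : f.f 0 = 0) (h' : f.f (Fin.last (n + 1)) = 0) : IsLift X Y f 0 0 :=
  ⟨by simp [h], by simp [h']⟩

variable {𝒞 : Type u} [Category.{v} 𝒞] [Preadditive 𝒞] {n : ℕ}

/-- A complex in the idempotent completion presented as a direct factor of a complex in `𝒞` which
realises the underlying extension. -/
structure Presentation (S : ExtensionStructure.{w} 𝒞 n) {P Q : Karoubi 𝒞}
    (δ : Ext (karoubiE S.E) Q P) (Z : NComplex n P Q) where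
  X : NComplex n P.X Q.X
  realises : S.Realises (underlying S.E δ) X
  i : Z.K ⟶ (X.map (toKaroubi 𝒞)).K
  r : (X.map (toKaroubi 𝒞)).K ⟶ Z.K
  isLift_i : IsLift Z (X.map (toKaroubi 𝒞)) i (karι P) (karι Q)
  isLift_r : IsLift (X.map (toKaroubi 𝒞)) Z r (karπ P) (karπ Q)
  i_r : i ≫ r = 𝟙 _

variable [HasFiniteBiproducts 𝒞]

section AddDbl

variable {A C : 𝒞} (X : NComplex n A C) {i j : Fin (n + 2)} (hij : (nShape n).Rel i j)
  (hi : i ≠ 0) (hj : j ≠ Fin.last (n + 1)) (T : 𝒞)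

lemma isZero_dbl_zero (hij : (nShape n).Rel i j) (hi : i ≠ 0) (T : 𝒞) :
    IsZero ((dbl hij T).X 0) :=
  HomologicalComplex.isZero_double_X _ _ _ hi.symm (by
    rintro rfl
    exact nShape_not_rel_zero _ hij)

lemma isZero_dbl_last (hij : (nShape n).Rel i j) (hj : j ≠ Fin.last (n + 1)) (T : 𝒞) :
    IsZero ((dbl hij T).X (Fin.last (n + 1))) :=
  HomologicalComplex.isZero_double_X _ _ _ (by
    rintro rfl
    exact nShape_not_last_rel _ hij) hj.symm

/-- The isomorphism between `K` and `K ⊕ L` in a degree where `L` vanishes. -/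
def biprodXIso [HasBinaryBiproducts 𝒞] (K L : HomologicalComplex 𝒞 (nShape n)) (k : Fin (n + 2))
    (h : IsZero (L.X k)) : (K ⊞ L).X k ≅ K.X k where
  hom := (biprod.fst : K ⊞ L ⟶ K).f k
  inv := (biprod.inl : K ⟶ K ⊞ L).f k
  hom_inv_id := by
    have h1 : (biprod.fst ≫ biprod.inl + biprod.snd ≫ biprod.inr : K ⊞ L ⟶ K ⊞ L).f k
        = (𝟙 (K ⊞ L) : K ⊞ L ⟶ K ⊞ L).f k := HomologicalComplex.congr_hom biprod.total k
    have h2 : (biprod.inr : L ⟶ K ⊞ L).f k = 0 := h.eq_of_src _ _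
    rwa [HomologicalComplex.add_f_apply, HomologicalComplex.comp_f, HomologicalComplex.comp_f, h2,
      comp_zero, add_zero, HomologicalComplex.id_f] at h1
  inv_hom_id := by
    rw [← HomologicalComplex.comp_f, biprod.inl_fst, HomologicalComplex.id_f]

/-- The direct sum of a complex and a contractible complex which vanishes on the end terms. -/
def addDbl [HasBinaryBiproducts 𝒞] : NComplex n A C where
  K := X.K ⊞ dbl hij T
  left := biprodXIso _ _ _ (isZero_dbl_zero hij hi T) ≪≫ X.left
  right := biprodXIso _ _ _ (isZero_dbl_last hij hj T) ≪≫ X.right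

lemma isLift_addDbl_fst [HasBinaryBiproducts 𝒞] :
    IsLift (addDbl X hij hi hj T) X (biprod.fst : X.K ⊞ dbl hij T ⟶ X.K) (𝟙 A) (𝟙 C) :=
  ⟨by simp [addDbl, biprodXIso], by simp [addDbl, biprodXIso]⟩

lemma isLift_addDbl_inl [HasBinaryBiproducts 𝒞] :
    IsLift X (addDbl X hij hi hj T) (biprod.inl : X.K ⟶ X.K ⊞ dbl hij T) (𝟙 A) (𝟙 C) := by
  have this : ∀ k, (biprod.inl : X.K ⟶ X.K ⊞ dbl hij T).f k ≫
      (biprod.fst : X.K ⊞ dbl hij T ⟶ X.K).f k = 𝟙 _ := fun k => by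
    rw [← HomologicalComplex.comp_f, biprod.inl_fst, HomologicalComplex.id_f]
  exact ⟨by simp [addDbl, biprodXIso, reassoc_of% this],
    by simp [addDbl, biprodXIso, reassoc_of% this]⟩

/-- The summand added is contractible and vanishes on the ends, so the complementary projection is
null-homotopic without affecting the end identifications. -/
lemma htpyEquiv_addDbl [HasBinaryBiproducts 𝒞] : X.HtpyEquiv (addDbl X hij hi hj T) := by
  refine ⟨biprod.inl, biprod.fst, isLift_addDbl_inl X hij hi hj T, isLift_addDbl_fst X hij hi hj T,
    ⟨Homotopy.ofEq biprod.inl_fst⟩, ?_⟩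
  obtain ⟨H⟩ := dbl_factor_htpy (nShape_ne hij) (biprod.snd : X.K ⊞ dbl hij T ⟶ _) biprod.inr
  have h1 : (biprod.fst ≫ biprod.inl + biprod.snd ≫ biprod.inr : X.K ⊞ dbl hij T ⟶ _) = 𝟙 _ :=
    biprod.total
  exact ⟨((Homotopy.ofEq (add_zero _).symm).trans ((Homotopy.refl (biprod.fst ≫ biprod.inl)).add
    H.symm)).trans (Homotopy.ofEq h1)⟩

end AddDbl

variable {S : ExtensionStructure.{w} 𝒞 n}

/-- Every contractible complex in the idempotent completion is a direct factor of a contractible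
complex in `𝒞`. -/
lemma exists_retract_dbl {i j : Fin (n + 2)} (hij : (nShape n).Rel i j) (T : Karoubi 𝒞) :
    ∃ (s : dbl hij T ⟶ ((toKaroubi 𝒞).mapHomologicalComplex _).obj (dbl hij T.X))
      (t : ((toKaroubi 𝒞).mapHomologicalComplex _).obj (dbl hij T.X) ⟶ dbl hij T),
      s ≫ t = 𝟙 _ := by
  have h := nShape_ne hij
  let L := ((toKaroubi 𝒞).mapHomologicalComplex _).obj (dbl hij T.X)
  let a : T ⟶ L.X i := karι T ≫
    (toKaroubi 𝒞).map (HomologicalComplex.doubleXIso₀ (𝟙 T.X) hij).inv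
  let b : L.X j ⟶ T := (toKaroubi 𝒞).map (HomologicalComplex.doubleXIso₁ (𝟙 T.X) hij h).hom ≫ karπ T
  have hab : a ≫ L.d i j ≫ b = 𝟙 T := by
    ext
    change (T.p ≫ (HomologicalComplex.doubleXIso₀ (𝟙 T.X) hij).inv) ≫ (dbl hij T.X).d i j ≫
      (HomologicalComplex.doubleXIso₁ (𝟙 T.X) hij h).hom ≫ T.p = T.p
    rw [HomologicalComplex.double_d _ hij h]
    simp
  refine ⟨fromDbl hij h a, toDbl hij h b, ?_⟩
  apply HomologicalComplex.from_double_hom_ext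
  · rw [HomologicalComplex.comp_f, fromDbl_f₀, toDbl_f₀, Category.assoc,
      ← Category.assoc (L.d i j), ← Category.assoc a, hab]
    simp
  · rw [HomologicalComplex.comp_f, fromDbl_f₁, toDbl_f₁, Category.assoc, Category.assoc,
      ← Category.assoc (L.d i j), ← Category.assoc a, hab]
    simp

lemma comp_eq_add_of_biprod {𝒱 : Type u'} [Category.{v'} 𝒱] [Preadditive 𝒱] {Z K L M : 𝒱}
    {inl : K ⟶ M} {inr : L ⟶ M} {fst : M ⟶ K} {snd : M ⟶ L} (a : Z ⟶ K) (b : K ⟶ Z) (a' : Z ⟶ L)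
    (b' : L ⟶ Z) (h1 : inl ≫ fst = 𝟙 _) (h2 : inl ≫ snd = 0) (h3 : inr ≫ fst = 0)
    (h4 : inr ≫ snd = 𝟙 _) {φ : Z ⟶ Z} (h : a' ≫ b' = φ) :
    (a ≫ inl + a' ≫ inr) ≫ (fst ≫ b + snd ≫ b') = a ≫ b + φ := by
  simp [reassoc_of% h1, reassoc_of% h2, reassoc_of% h3, reassoc_of% h4, h]

/-- Every complex in the idempotent completion which realises an extension is a direct factor of a
complex in `𝒞` which realises the underlying extension. -/
lemma ExtensionStructure.IsNExangulated.exists_presentation (hS : S.IsNExangulated)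
    {P Q : Karoubi 𝒞} {δ : Ext (karoubiE S.E) Q P} {Z : NComplex n P Q}
    (hZ : S.karoubi.Realises δ Z) : Nonempty (Presentation S δ Z) := by
  have := hasBinaryBiproducts_of_finite_biproducts 𝒞
  -- `Good φ` says that `φ` factors, compatibly with the ends, through a complex of `𝒞` realising
  -- the underlying extension; the goal is `Good` of the identity. Homotopy equivalence with some
  -- `(X, e)` gives it only for a map differing from the identity by an element of `relNull`.
  let Good (φ : Z.K ⟶ Z.K) : Prop := ∃ (X : NComplex n P.X Q.X)
    (i : Z.K ⟶ (X.map (toKaroubi 𝒞)).K) (r : (X.map (toKaroubi 𝒞)).K ⟶ Z.K),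
    S.Realises (underlying S.E δ) X ∧ IsLift Z (X.map (toKaroubi 𝒞)) i (karι P) (karι Q) ∧
    IsLift (X.map (toKaroubi 𝒞)) Z r (karπ P) (karπ Q) ∧ i ≫ r = φ
  -- An error through a contractible complex is absorbed by enlarging `X`: that complex is a direct
  -- factor of a contractible complex from `𝒞`, which is added to `X`. Here the description of
  -- `relNull` by explicit factorisations is essential, rather than mere null-homotopy.
  have key : ∀ ν ∈ relNull Z.K Z.K, ∀ φ, Good φ → Good (φ + ν) := by
    intro ν hν
    induction hν using AddSubmonoid.closure_induction with
    | zero =>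
      intro φ hφ
      rwa [add_zero]
    | add x y _ _ hx hy =>
      intro φ hφ
      rw [← add_assoc]
      exact hy _ (hx _ hφ)
    | mem ν hν =>
      obtain ⟨i, j, hij, hi, hj, T, α, β, rfl⟩ := hν
      rintro φ ⟨X, a, b, hX, ha, hb, rfl⟩
      obtain ⟨s, t, hst⟩ := exists_retract_dbl hij T
      let F := (toKaroubi 𝒞).mapHomologicalComplex (nShape n)
      let inl := F.map (biprod.inl : X.K ⟶ X.K ⊞ dbl hij T.X)
      let inr := F.map (biprod.inr : _ ⟶ X.K ⊞ dbl hij T.X)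
      let fst := F.map (biprod.fst : X.K ⊞ dbl hij T.X ⟶ X.K)
      let snd := F.map (biprod.snd : X.K ⊞ dbl hij T.X ⟶ _)
      have h1 : inl ≫ fst = 𝟙 _ := by simp only [inl, fst, ← F.map_comp, biprod.inl_fst, F.map_id]
      have h2 : inl ≫ snd = 0 := by simp only [inl, snd, ← F.map_comp, biprod.inl_snd, F.map_zero]
      have h3 : inr ≫ fst = 0 := by simp only [inr, fst, ← F.map_comp, biprod.inr_fst, F.map_zero]
      have h4 : inr ≫ snd = 𝟙 _ := by simp only [inr, snd, ← F.map_comp, biprod.inr_snd, F.map_id]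
      have hj0 : j ≠ 0 := by
        rintro rfl
        exact nShape_not_rel_zero _ hij
      have hil : i ≠ Fin.last (n + 1) := by
        rintro rfl
        exact nShape_not_last_rel _ hij
      refine ⟨addDbl X hij hi hj T.X, a ≫ inl + (α ≫ s) ≫ inr, fst ≫ b + snd ≫ t ≫ β, ?_, ?_, ?_, ?_⟩
      · exact hS.isRealisation.realises_of_htpyEquiv hX (htpyEquiv_addDbl X hij hi hj T.X)
      · have h := ha.comp ((isLift_addDbl_inl X hij hi hj T.X).map (toKaroubi 𝒞))
        have e : ∀ k, k ≠ i → k ≠ j → ((α ≫ s) ≫ inr).f k = 0 := fun k hki hkj => by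
          rw [Category.assoc, dbl_comp_f_eq_zero _ _ hki hkj]
        have h' : IsLift Z ((addDbl X hij hi hj T.X).map (toKaroubi 𝒞)) ((α ≫ s) ≫ inr) 0 0 :=
          IsLift.of_zero (e 0 hi.symm hj0.symm) (e _ hil.symm hj.symm)
        exact (h.add h').congr (by simp) (by simp)
      · have h := ((isLift_addDbl_fst X hij hi hj T.X).map (toKaroubi 𝒞)).comp hb
        have e : ∀ k, k ≠ i → k ≠ j → (snd ≫ t ≫ β).f k = 0 := fun k hki hkj => by
          rw [← Category.assoc, dbl_comp_f_eq_zero _ _ hki hkj]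
        have h' : IsLift ((addDbl X hij hi hj T.X).map (toKaroubi 𝒞)) Z (snd ≫ t ≫ β) 0 0 :=
          IsLift.of_zero (e 0 hi.symm hj0.symm) (e _ hil.symm hj.symm)
        exact (h.add h').congr (by simp) (by simp)
      · exact comp_eq_add_of_biprod a b (α ≫ s) (t ≫ β) h1 h2 h3 h4 (by simp [reassoc_of% hst])
  have hZ' := hS.isRealisation_karoubi.isExangle δ Z hZ
  obtain ⟨X, e, he, hl, hX, f, g, hf, hg, -, -⟩ := hZ
  have hW := isExangle_karoubiNComplex (hS.isExangle _ X hX) e he hl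
  -- The given homotopy inverse `f` is replaced by one whose defect lies in `relNull`.
  obtain ⟨f', hf', h1, -⟩ := hZ'.exists_htpy_inverse hS.one_le hW g f hg hf
  have hgood : Good (g ≫ f') := ⟨X, g ≫ karIncl X e he hl, karProj X e he hl ≫ f', hX,
    (hg.comp (isLift_karIncl X e he hl)).congr (by simp) (by simp),
    ((isLift_karProj X e he hl).comp hf').congr (by simp) (by simp), by
      simp only [Category.assoc]
      rw [← Category.assoc (karIncl X e he hl), karIncl_karProj, Category.id_comp]⟩
  obtain ⟨X', i, r, hX', hi, hr, hir⟩ := key _ h1 _ hgood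
  exact ⟨⟨X', hX', i, r, hi, hr, by rw [hir]; abel⟩⟩

end Presentation

end NExang

end

set_option linter.unusedSectionVars false

noncomputable section

namespace NExang

open NComplex ExtensionStructure

/-! ### Diagonal idempotents of biproducts and splittings of complexes -/

section BiprodData

variable {𝒞 : Type u} [Category.{v} 𝒞] [Preadditive 𝒞]

attribute [simp] BiprodData.inl_fst BiprodData.inl_snd BiprodData.inr_fst BiprodData.inr_snd

namespace BiprodData

variable {P Q M T : 𝒞} (b : BiprodData P Q M)

@[simp]
lemma inl_fst_assoc (f : P ⟶ T) : b.inl ≫ b.fst ≫ f = f := by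
  rw [← Category.assoc, b.inl_fst, Category.id_comp]

@[simp]
lemma inl_snd_assoc (f : Q ⟶ T) : b.inl ≫ b.snd ≫ f = 0 := by
  rw [← Category.assoc, b.inl_snd, zero_comp]

@[simp]
lemma inr_fst_assoc (f : P ⟶ T) : b.inr ≫ b.fst ≫ f = 0 := by
  rw [← Category.assoc, b.inr_fst, zero_comp]

@[simp]
lemma inr_snd_assoc (f : Q ⟶ T) : b.inr ≫ b.snd ≫ f = f := by
  rw [← Category.assoc, b.inr_snd, Category.id_comp]

lemma hom_ext_to {f g : T ⟶ M} (h : f ≫ b.fst = g ≫ b.fst) (h' : f ≫ b.snd = g ≫ b.snd) :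
    f = g := by
  rw [← Category.comp_id f, ← Category.comp_id g, ← b.total]
  simp only [Preadditive.comp_add, reassoc_of% h, reassoc_of% h']

lemma hom_ext_from {f g : M ⟶ T} (h : b.inl ≫ f = b.inl ≫ g) (h' : b.inr ≫ f = b.inr ≫ g) :
    f = g := by
  rw [← Category.id_comp f, ← Category.id_comp g, ← b.total]
  simp only [Preadditive.add_comp, Category.assoc, h, h']

/-- The diagonal endomorphism of a biproduct. -/
def diag (α : P ⟶ P) (β : Q ⟶ Q) : M ⟶ M := b.fst ≫ α ≫ b.inl + b.snd ≫ β ≫ b.inr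

@[simp]
lemma inl_diag (α : P ⟶ P) (β : Q ⟶ Q) : b.inl ≫ b.diag α β = α ≫ b.inl := by simp [diag]

@[simp]
lemma inr_diag (α : P ⟶ P) (β : Q ⟶ Q) : b.inr ≫ b.diag α β = β ≫ b.inr := by simp [diag]

@[simp]
lemma diag_fst (α : P ⟶ P) (β : Q ⟶ Q) : b.diag α β ≫ b.fst = b.fst ≫ α := by simp [diag]

@[simp]
lemma diag_snd (α : P ⟶ P) (β : Q ⟶ Q) : b.diag α β ≫ b.snd = b.snd ≫ β := by simp [diag]

lemma diag_comp_self {α : P ⟶ P} {β : Q ⟶ Q} (hα : α ≫ α = α) (hβ : β ≫ β = β) :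
    b.diag α β ≫ b.diag α β = b.diag α β := by
  simp [diag, reassoc_of% hα, reassoc_of% hβ]

/-- A direct factor of a biproduct, for a diagonal idempotent. -/
@[simps]
def retract {P' Q' M' : 𝒞} {iP : P' ⟶ P} {rP : P ⟶ P'} {iQ : Q' ⟶ Q} {rQ : Q ⟶ Q'}
    {iM : M' ⟶ M} {rM : M ⟶ M'} (hP : iP ≫ rP = 𝟙 _) (hQ : iQ ≫ rQ = 𝟙 _) (hM : iM ≫ rM = 𝟙 _)
    (h : rM ≫ iM = b.diag (rP ≫ iP) (rQ ≫ iQ)) : BiprodData P' Q' M' where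
  inl := iP ≫ b.inl ≫ rM
  inr := iQ ≫ b.inr ≫ rM
  fst := iM ≫ b.fst ≫ rP
  snd := iM ≫ b.snd ≫ rQ
  inl_fst := by
    simp [reassoc_of% h, diag, hP]
  inl_snd := by
    simp [reassoc_of% h, diag]
  inr_fst := by
    simp [reassoc_of% h, diag]
  inr_snd := by
    simp [reassoc_of% h, diag, hQ]
  total := by
    have h1 := iM ≫= h =≫ rM
    simp only [diag, Category.assoc, hM, Preadditive.comp_add, Preadditive.add_comp,
      reassoc_of% hM] at h1 ⊢
    exact h1.symm

/-- The image of a biproduct under an additive functor. -/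
@[simps]
def map {𝒟 : Type u'} [Category.{v'} 𝒟] [Preadditive 𝒟] (F : 𝒞 ⥤ 𝒟) [F.Additive] :
    BiprodData (F.obj P) (F.obj Q) (F.obj M) where
  inl := F.map b.inl
  inr := F.map b.inr
  fst := F.map b.fst
  snd := F.map b.snd
  inl_fst := by rw [← F.map_comp, b.inl_fst, F.map_id]
  inl_snd := by rw [← F.map_comp, b.inl_snd, F.map_zero]
  inr_fst := by rw [← F.map_comp, b.inr_fst, F.map_zero]
  inr_snd := by rw [← F.map_comp, b.inr_snd, F.map_id]
  total := by rw [← F.map_comp, ← F.map_comp, ← F.map_add, b.total, F.map_id]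

end BiprodData

/-- Idempotent endomorphisms of complexes split if their components do. -/
lemma exists_splitting {ι : Type*} {c : ComplexShape ι} {K : HomologicalComplex 𝒞 c} (E : K ⟶ K)
    (p : ObjectProperty 𝒞) (h : ∀ k, ∃ (T : 𝒞) (i : T ⟶ K.X k) (r : K.X k ⟶ T),
      p T ∧ i ≫ r = 𝟙 T ∧ r ≫ i = E.f k) :
    ∃ (L : HomologicalComplex 𝒞 c) (i : L ⟶ K) (r : K ⟶ L), i ≫ r = 𝟙 L ∧ r ≫ i = E ∧
      ∀ k, p (L.X k) := by
  choose T i r hT hir hri using h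
  have h1 : ∀ k k', i k ≫ K.d k k' ≫ r k' ≫ i k' = i k ≫ K.d k k' := fun k k' => by
    rw [hri, ← E.comm, ← hri, Category.assoc, reassoc_of% (hir k)]
  have h2 : ∀ k k', r k ≫ i k ≫ K.d k k' ≫ r k' = K.d k k' ≫ r k' := fun k k' => by
    rw [reassoc_of% (hri k), E.comm_assoc, ← hri, Category.assoc, hir, Category.comp_id]
  let L : HomologicalComplex 𝒞 c :=
    { X := T
      d k k' := i k ≫ K.d k k' ≫ r k'
      shape k k' hk := by simp [K.shape k k' hk]
      d_comp_d' k k' k'' _ _ := by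
        simp only [Category.assoc, h2]
        simp }
  refine ⟨L, ⟨i, fun k k' _ => ?_⟩, ⟨r, fun k k' _ => ?_⟩, ?_, ?_, hT⟩
  · simp [L, h1]
  · simp [L, h2]
  · ext k
    exact hir k
  · ext k
    exact hri k

end BiprodData

/-! ### Endomorphisms and direct factors of mapping cones -/

namespace MappingCone

variable {𝒞 : Type u} [Category.{v} 𝒞] [Preadditive 𝒞] {n : ℕ} {A B C D : 𝒞}
  {X : NComplex n A C} {Y : NComplex n B D} {f : X.K ⟶ Y.K} {M : NComplex n (X.K.X 1) D}
  (m : MappingCone f M)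

/-- The structure records differentials entry by entry; this and the next two lemmas reassemble the
matrices, which is the form in which composites are computed. -/
lemma dFirst_eq {j : Fin (n + 2)} (h : (nShape n).Rel 1 j) (h0 : (1 : Fin (n + 2)) ≠ 0) :
    M.dFirst = -X.K.d 1 j ≫ (m.biprod h h0).inl + f.f 1 ≫ (m.biprod h h0).inr := by
  apply (m.biprod h h0).hom_ext_to
  · simp [m.first_fst]
  · simp [m.first_snd]

lemma d_eq {i j k : Fin (n + 2)} (hij : (nShape n).Rel i j) (hjk : (nShape n).Rel j k)
    (hi : i ≠ 0) (hj : j ≠ 0) :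
    M.K.d i j = -(m.biprod hij hi).fst ≫ X.K.d j k ≫ (m.biprod hjk hj).inl +
      (m.biprod hij hi).fst ≫ f.f j ≫ (m.biprod hjk hj).inr +
      (m.biprod hij hi).snd ≫ Y.K.d i j ≫ (m.biprod hjk hj).inr := by
  apply (m.biprod hij hi).hom_ext_from <;> apply (m.biprod hjk hj).hom_ext_to
  · simp [m.inl_d_fst hij hjk]
  · simp [m.inl_d_snd hij hjk]
  · simp [m.inr_d_fst hij hjk]
  · simp [m.inr_d_snd hij hjk]

lemma dLast_eq (h : (nShape n).Rel (Fin.last n).castSucc (Fin.last (n + 1)))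
    (h0 : (Fin.last n).castSucc ≠ 0) :
    M.dLast = (m.biprod h h0).fst ≫ f.f (Fin.last (n + 1)) ≫ Y.right.hom +
      (m.biprod h h0).snd ≫ Y.dLast := by
  apply (m.biprod h h0).hom_ext_from
  · simp [m.inl_last]
  · simp [m.inr_last]

section Endomorphism

variable (α : X.K ⟶ X.K) (β : Y.K ⟶ Y.K)

/-- The components of the endomorphism of a mapping cone induced by `α` and `β`. -/
def endoF (k : Fin (n + 2)) : M.K.X k ⟶ M.K.X k :=
  if h0 : k = 0 then h0.symm ▸ (M.left.hom ≫ α.f 1 ≫ M.left.inv : M.K.X 0 ⟶ M.K.X 0)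
  else if hl : k = Fin.last (n + 1) then
    hl.symm ▸ (M.right.hom ≫ Y.right.inv ≫ β.f _ ≫ Y.right.hom ≫ M.right.inv :
      M.K.X (Fin.last (n + 1)) ⟶ M.K.X (Fin.last (n + 1)))
  else (m.biprod (nShape_exists_next k hl).choose_spec h0).diag (α.f _) (β.f _)

lemma endoF_zero : m.endoF α β 0 = M.left.hom ≫ α.f 1 ≫ M.left.inv := by
  rw [endoF, dif_pos rfl]

lemma endoF_last : m.endoF α β (Fin.last (n + 1)) =
    M.right.hom ≫ Y.right.inv ≫ β.f _ ≫ Y.right.hom ≫ M.right.inv := by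
  rw [endoF, dif_neg last_ne_zero, dif_pos rfl]

lemma endoF_mid {i j : Fin (n + 2)} (hij : (nShape n).Rel i j) (hi : i ≠ 0) :
    m.endoF α β i = (m.biprod hij hi).diag (α.f j) (β.f i) := by
  have hl : i ≠ Fin.last (n + 1) := by
    rintro rfl
    exact nShape_not_last_rel _ hij
  rw [endoF, dif_neg hi, dif_neg hl]
  have key : ∀ j' (h : (nShape n).Rel i j'), (m.biprod h hi).diag (α.f j') (β.f i) =
      (m.biprod hij hi).diag (α.f j) (β.f i) := by
    intro j' h
    obtain rfl := (nShape n).next_eq h hij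
    rfl
  exact key _ _

/-- The endomorphism of a mapping cone induced by compatible endomorphisms `α` and `β`. -/
def endo (hn : 1 ≤ n) (h : α ≫ f = f ≫ β) : M.K ⟶ M.K where
  f := m.endoF α β
  comm' i j hij := by
    have hf (k) : α.f k ≫ f.f k = f.f k ≫ β.f k := HomologicalComplex.congr_hom h k
    by_cases hi : i = 0
    · subst hi
      obtain rfl := nShape_rel_zero hij
      obtain ⟨j, hj⟩ := nShape_exists_next (n := n) 1 (last_ne_one hn).symm
      rw [endoF_zero, m.endoF_mid α β hj one_ne_zero, ← cancel_epi M.left.inv]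
      have h1 : M.left.inv ≫ M.K.d 0 1 = M.dFirst := rfl
      simp only [Category.assoc, Iso.inv_hom_id_assoc, h1, reassoc_of% h1]
      rw [m.dFirst_eq hj one_ne_zero]
      simp [reassoc_of% hf]
    · by_cases hj : j = Fin.last (n + 1)
      · subst hj
        obtain rfl := (nShape n).prev_eq hij nShape_rel_last
        rw [endoF_last, m.endoF_mid α β hij hi, ← cancel_mono M.right.hom]
        have h1 : M.K.d (Fin.last n).castSucc (Fin.last (n + 1)) ≫ M.right.hom = M.dLast := rfl
        simp only [Category.assoc, Iso.inv_hom_id, Category.comp_id, h1, reassoc_of% h1]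
        rw [m.dLast_eq hij hi]
        simp only [Preadditive.add_comp, Category.assoc, BiprodData.diag, Preadditive.comp_add]
        simp [NComplex.dLast, reassoc_of% hf]
      · obtain ⟨k, hjk⟩ := nShape_exists_next j hj
        have hj0 : j ≠ 0 := by
          rintro rfl
          exact nShape_not_rel_zero _ hij
        rw [m.endoF_mid α β hij hi, m.endoF_mid α β hjk hj0, m.d_eq hij hjk hi hj0]
        simp only [BiprodData.diag, Preadditive.add_comp, Preadditive.comp_add, Category.assoc,
          Preadditive.neg_comp, Preadditive.comp_neg]
        simp [reassoc_of% hf, add_assoc]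

lemma endo_comp_self (hn : 1 ≤ n) (h : α ≫ f = f ≫ β) (hα : α ≫ α = α) (hβ : β ≫ β = β) :
    m.endo α β hn h ≫ m.endo α β hn h = m.endo α β hn h := by
  have hα' (k) : α.f k ≫ α.f k = α.f k := HomologicalComplex.congr_hom hα k
  have hβ' (k) : β.f k ≫ β.f k = β.f k := HomologicalComplex.congr_hom hβ k
  ext k
  change m.endoF α β k ≫ m.endoF α β k = m.endoF α β k
  by_cases hk : k = 0
  · subst hk
    rw [endoF_zero]
    simp [reassoc_of% hα']
  · by_cases hl : k = Fin.last (n + 1)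
    · subst hl
      rw [endoF_last]
      simp [reassoc_of% hβ']
    · obtain ⟨j, hj⟩ := nShape_exists_next k hl
      rw [m.endoF_mid α β hj hk]
      exact (m.biprod hj hk).diag_comp_self (hα' _) (hβ' _)

end Endomorphism

/-- A direct factor of a mapping cone. -/
def retract {A' B' C' D' : 𝒞} {X' : NComplex n A' C'} {Y' : NComplex n B' D'}
    {iX : X'.K ⟶ X.K} {rX : X.K ⟶ X'.K} {iY : Y'.K ⟶ Y.K} {rY : Y.K ⟶ Y'.K}
    (hX : iX ≫ rX = 𝟙 _) (hY : iY ≫ rY = 𝟙 _) (h : (rX ≫ iX) ≫ f = f ≫ rY ≫ iY) (hn : 1 ≤ n)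
    {M' : NComplex n (X'.K.X 1) D'} (i : M'.K ⟶ M.K) (r : M.K ⟶ M'.K) (hir : i ≫ r = 𝟙 _)
    (hri : r ≫ i = m.endo (rX ≫ iX) (rY ≫ iY) hn h)
    (hl : M'.left.inv = iX.f 1 ≫ M.left.inv ≫ r.f 0)
    (hr : M'.right.hom = i.f _ ≫ M.right.hom ≫ Y.right.inv ≫ rY.f _ ≫ Y'.right.hom)  :
    MappingCone (iX ≫ f ≫ rY) M' := by
  have hX' (k) : iX.f k ≫ rX.f k = 𝟙 _ := HomologicalComplex.congr_hom hX k
  have hY' (k) : iY.f k ≫ rY.f k = 𝟙 _ := HomologicalComplex.congr_hom hY k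
  have hir' (k) : i.f k ≫ r.f k = 𝟙 _ := HomologicalComplex.congr_hom hir k
  have hri' (k) : r.f k ≫ i.f k = m.endoF (rX ≫ iX) (rY ≫ iY) k :=
    HomologicalComplex.congr_hom hri k
  have hf (k) : rX.f k ≫ iX.f k ≫ f.f k = f.f k ≫ rY.f k ≫ iY.f k := by
    simpa using HomologicalComplex.congr_hom h k
  have hfY (k) : f.f k ≫ rY.f k ≫ iY.f k ≫ rY.f k = f.f k ≫ rY.f k := by rw [hY', Category.comp_id]
  have hd0 : M'.dFirst = iX.f 1 ≫ M.dFirst ≫ r.f 1 := by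
    simp [NComplex.dFirst, hl]
  have hmid : ∀ {i' j : Fin (n + 2)} (hij : (nShape n).Rel i' j) (hi : i' ≠ 0),
      r.f i' ≫ i.f i' = (m.biprod hij hi).diag (rX.f j ≫ iX.f j) (rY.f i' ≫ iY.f i') :=
    fun hij hi => (hri' _).trans (m.endoF_mid _ _ hij hi)
  refine
  { biprod := fun hij hi => (m.biprod hij hi).retract (hX' _) (hY' _) (hir' _) (hmid hij hi)
    first_fst := ?_
    first_snd := ?_
    inl_d_fst := ?_
    inl_d_snd := ?_
    inr_d_fst := ?_
    inr_d_snd := ?_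
    inl_last := ?_
    inr_last := ?_ }
  · intro j h h0
    simp only [hd0, BiprodData.retract_fst, Category.assoc, reassoc_of% (hmid h h0)]
    rw [m.dFirst_eq h h0]
    simp [BiprodData.diag, hX']
  · intro j h h0
    simp only [hd0, BiprodData.retract_snd, Category.assoc, reassoc_of% (hmid h h0)]
    rw [m.dFirst_eq h h0]
    simp [BiprodData.diag, hY']
  · intro i' j k hij hjk hi hj
    simp only [BiprodData.retract_inl, BiprodData.retract_fst, Category.assoc,
      reassoc_of% (hmid hij hi), ← i.comm_assoc]
    rw [m.d_eq hij hjk hi hj]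
    simp [BiprodData.diag, hX']
  · intro i' j k hij hjk hi hj
    simp only [BiprodData.retract_inl, BiprodData.retract_snd, Category.assoc,
      reassoc_of% (hmid hij hi), ← i.comm_assoc]
    rw [m.d_eq hij hjk hi hj]
    simp [BiprodData.diag, reassoc_of% hX']
  · intro i' j k hij hjk hi hj
    simp only [BiprodData.retract_inr, BiprodData.retract_fst, Category.assoc,
      reassoc_of% (hmid hij hi), ← i.comm_assoc]
    rw [m.d_eq hij hjk hi hj]
    simp [BiprodData.diag]
  · intro i' j k hij hjk hi hj
    simp only [BiprodData.retract_inr, BiprodData.retract_snd, Category.assoc,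
      reassoc_of% (hmid hij hi), ← i.comm_assoc]
    rw [m.d_eq hij hjk hi hj]
    simp [BiprodData.diag, hY']
  · intro h h0
    have h1 : r.f (Fin.last n).castSucc ≫ M'.dLast =
        M.dLast ≫ Y.right.inv ≫ rY.f _ ≫ Y'.right.hom := by
      rw [NComplex.dLast, r.comm_assoc, hr, reassoc_of% (hri' (Fin.last (n + 1))), m.endoF_last]
      simp [NComplex.dLast, reassoc_of% hY']
    simp only [BiprodData.retract_inl, Category.assoc, h1]
    rw [m.dLast_eq h h0]
    simp
  · intro h h0
    have h1 : r.f (Fin.last n).castSucc ≫ M'.dLast =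
        M.dLast ≫ Y.right.inv ≫ rY.f _ ≫ Y'.right.hom := by
      rw [NComplex.dLast, r.comm_assoc, hr, reassoc_of% (hri' (Fin.last (n + 1))), m.endoF_last]
      simp [NComplex.dLast, reassoc_of% hY']
    simp only [BiprodData.retract_inr, Category.assoc, h1]
    rw [m.dLast_eq h h0]
    simp [NComplex.dLast, reassoc_of% hY']

/-- The image of a mapping cone under an additive functor. -/
def map {𝒟 : Type u'} [Category.{v'} 𝒟] [Preadditive 𝒟] (F : 𝒞 ⥤ 𝒟) [F.Additive] :
    MappingCone (X := X.map F) (Y := Y.map F) ((F.mapHomologicalComplex (nShape n)).map f)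
      (M.map F) where
  biprod hij hi := (m.biprod hij hi).map F
  first_fst h h0 := by
    refine (congrArg (· ≫ F.map (m.biprod h h0).fst) (M.map_dFirst F)).trans ?_
    refine (F.map_comp _ _).symm.trans ((congrArg F.map (m.first_fst h h0)).trans F.map_neg)
  first_snd h h0 := by
    refine (congrArg (· ≫ F.map (m.biprod h h0).snd) (M.map_dFirst F)).trans ?_
    exact (F.map_comp _ _).symm.trans (congrArg F.map (m.first_snd h h0))
  inl_d_fst hij hjk hi hj := by
    have := congrArg F.map (m.inl_d_fst hij hjk hi hj)
    rwa [F.map_comp, F.map_comp, F.map_neg] at this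
  inl_d_snd hij hjk hi hj := by
    have := congrArg F.map (m.inl_d_snd hij hjk hi hj)
    rwa [F.map_comp, F.map_comp] at this
  inr_d_fst hij hjk hi hj := by
    have := congrArg F.map (m.inr_d_fst hij hjk hi hj)
    rwa [F.map_comp, F.map_comp, F.map_zero] at this
  inr_d_snd hij hjk hi hj := by
    have := congrArg F.map (m.inr_d_snd hij hjk hi hj)
    rwa [F.map_comp, F.map_comp] at this
  inl_last h h0 := by
    refine (congrArg (F.map (m.biprod h h0).inl ≫ ·) (M.map_dLast F)).trans ?_
    exact (F.map_comp _ _).symm.trans ((congrArg F.map (m.inl_last h h0)).trans (F.map_comp _ _))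
  inr_last h h0 := by
    refine (congrArg (F.map (m.biprod h h0).inr ≫ ·) (M.map_dLast F)).trans ?_
    exact (F.map_comp _ _).symm.trans ((congrArg F.map (m.inr_last h h0)).trans
      (Y.map_dLast F).symm)

end MappingCone

end NExang

end

set_option linter.unusedSectionVars false

noncomputable section

namespace NExang

open NComplex ExtensionStructure

/-! ### Homotopy invariance of mapping cones -/

variable {𝒞 : Type u} [Category.{v} 𝒞] [Preadditive 𝒞] {n : ℕ}

/-- The automorphism `1 + v`, for `v` of square zero. -/
@[simps]
def oneAddIso {T : 𝒞} (v : T ⟶ T) (hv : v ≫ v = 0) : T ≅ T where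
  hom := 𝟙 T + v
  inv := 𝟙 T - v
  hom_inv_id := by simp [hv]
  inv_hom_id := by simp [hv]

/-- The biproduct obtained by a shear. -/
@[simps]
def BiprodData.shear {P Q M : 𝒞} (b : BiprodData P Q M) (h : P ⟶ Q) : BiprodData P Q M where
  inl := b.inl + h ≫ b.inr
  inr := b.inr
  fst := b.fst
  snd := b.snd - b.fst ≫ h
  inl_fst := by simp
  inl_snd := by simp
  inr_fst := by simp
  inr_snd := by simp
  total := by
    rw [← b.total]
    simp

section Homotopies

variable {K L : HomologicalComplex 𝒞 (nShape n)} {f f' : K ⟶ L}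

lemma homotopy_comm_mid (H : Homotopy f' f) {i j k : Fin (n + 2)} (hij : (nShape n).Rel i j)
    (hjk : (nShape n).Rel j k) :
    f'.f j = K.d j k ≫ H.hom k j + H.hom j i ≫ L.d i j + f.f j := by
  rw [H.comm j, dNext_eq H.hom hjk, prevD_eq H.hom hij]

lemma homotopy_comm_zero (H : Homotopy f' f) : f'.f 0 = K.d 0 1 ≫ H.hom 1 0 + f.f 0 := by
  rw [H.comm 0, dNext_eq H.hom nShape_rel_zero_one, prevD, AddMonoidHom.mk'_apply,
    L.shape _ _ (nShape_not_rel_zero _), comp_zero, add_zero]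

lemma homotopy_comm_last (H : Homotopy f' f) : f'.f (Fin.last (n + 1)) =
    H.hom (Fin.last (n + 1)) (Fin.last n).castSucc ≫
      L.d (Fin.last n).castSucc (Fin.last (n + 1)) + f.f (Fin.last (n + 1)) := by
  rw [H.comm, prevD_eq H.hom nShape_rel_last, dNext, AddMonoidHom.mk'_apply,
    K.shape _ _ (nShape_not_last_rel _), zero_comp, zero_add]

end Homotopies

section

variable {A C D : 𝒞} {X : NComplex n A C} {Y : NComplex n A D}

lemma dFirst_d (X : NComplex n A C) (j : Fin (n + 2)) : X.dFirst ≫ X.K.d 1 j = 0 := by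
  simp [NComplex.dFirst]

/-- A mapping cone of a morphism is isomorphic to a mapping cone of each homotopic morphism. -/
lemma MappingCone.exists_of_homotopy {f f' : X.K ⟶ Y.K} (H : Homotopy f' f) {c : C ⟶ D}
    (hf : X.IsLift Y f (𝟙 A) c) (hf' : X.IsLift Y f' (𝟙 A) c) {M : NComplex n (X.K.X 1) D}
    (m : MappingCone f M) :
    ∃ (v : X.K.X 1 ⟶ X.K.X 1) (hv : v ≫ v = 0), X.dFirst ≫ v = 0 ∧
      Nonempty (MappingCone f' (⟨M.K, M.left ≪≫ (oneAddIso v hv).symm, M.right⟩ :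
        NComplex n (X.K.X 1) D)) := by
  have h0 : X.K.d 0 1 ≫ H.hom 1 0 = 0 := by
    have h1 := homotopy_comm_zero H
    rw [hf.f_zero, hf'.f_zero] at h1
    exact (left_eq_add.mp (h1.trans (add_comm _ _)))
  have h0' {T : 𝒞} (t : Y.K.X 0 ⟶ T) : X.K.d 0 1 ≫ H.hom 1 0 ≫ t = 0 := by
    rw [← Category.assoc, h0, zero_comp]
  -- The homotopy component `X₁ ⟶ Y₀` cannot be absorbed by a shear, since the cone has no summand
  -- `Y₀`. It is traded for the automorphism `1 + v` of the first term `X₁`. The square of `v` is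
  -- zero because `f` and `f'` agree on `A`, which forces `d₀` followed by this component to vanish.
  let v : X.K.X 1 ⟶ X.K.X 1 := H.hom 1 0 ≫ Y.left.hom ≫ X.dFirst
  have hv : v ≫ v = 0 := by simp [v, NComplex.dFirst, h0']
  have hvd (j) : v ≫ X.K.d 1 j = 0 := by simp [v, dFirst_d]
  have hf0 : X.dFirst ≫ f.f 1 = Y.dFirst := by simpa using hf.dFirst
  have hvf : v ≫ f.f 1 = H.hom 1 0 ≫ Y.K.d 0 1 := by
    simp only [v, Category.assoc, hf0]
    simp [NComplex.dFirst]
  let M' : NComplex n (X.K.X 1) D := ⟨M.K, M.left ≪≫ (oneAddIso v hv).symm, M.right⟩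
  have hd : M'.dFirst = (𝟙 _ + v) ≫ M.dFirst := by simp [M', NComplex.dFirst]
  have hd' : M'.dLast = M.dLast := rfl
  refine ⟨v, hv, by simp [v, NComplex.dFirst, h0'], ⟨?_⟩⟩
  change MappingCone f' M'
  exact
  -- In the middle degrees the complex is unchanged; only its decomposition is sheared by the
  -- homotopy component `X (i + 1) ⟶ Y i`.
  { biprod := fun {i j} hij hi => (m.biprod hij hi).shear (H.hom j i)
    first_fst := fun {j} h h0 => by
      rw [hd]
      simp [m.first_fst, hvd]
    first_snd := fun {j} h h0 => by
      rw [hd, homotopy_comm_mid H nShape_rel_zero_one h]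
      simp [m.first_snd, reassoc_of% (m.first_fst h h0), hvf, reassoc_of% hvd]
      abel
    inl_d_fst := fun hij hjk hi hj => by
      change ((m.biprod hij hi).inl + _ ≫ (m.biprod hij hi).inr) ≫ M.K.d _ _ ≫
        (m.biprod hjk hj).fst = _
      simp [m.inl_d_fst hij hjk, m.inr_d_fst hij hjk]
    inl_d_snd := fun {i j k} hij hjk hi hj => by
      change ((m.biprod hij hi).inl + _ ≫ (m.biprod hij hi).inr) ≫ M.K.d _ _ ≫
        ((m.biprod hjk hj).snd - (m.biprod hjk hj).fst ≫ _) = _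
      have h1 := m.inl_d_fst hij hjk hi hj
      have h2 := m.inr_d_fst hij hjk hi hj
      rw [homotopy_comm_mid H hij hjk]
      simp only [Preadditive.add_comp, Preadditive.comp_sub, Category.assoc,
        m.inl_d_snd hij hjk, m.inr_d_snd hij hjk, reassoc_of% h1, reassoc_of% h2,
        Preadditive.neg_comp, zero_comp, comp_zero]
      abel
    inr_d_fst := fun hij hjk hi hj => m.inr_d_fst hij hjk hi hj
    inr_d_snd := fun {i j k} hij hjk hi hj => by
      change (m.biprod hij hi).inr ≫ M.K.d _ _ ≫
        ((m.biprod hjk hj).snd - (m.biprod hjk hj).fst ≫ _) = _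
      have h2 := m.inr_d_fst hij hjk hi hj
      simp only [Preadditive.comp_sub, m.inr_d_snd hij hjk, reassoc_of% h2, zero_comp, sub_zero]
    inl_last := fun h h0 => by
      rw [hd', homotopy_comm_last H]
      simp only [BiprodData.shear_inl, Preadditive.add_comp, Category.assoc, m.inl_last,
        m.inr_last]
      exact add_comm _ _
    inr_last := fun h h0 => m.inr_last h h0 }

end

/-! ### Mapping cones of direct factors -/

section Retract

variable {S : ExtensionStructure.{w} 𝒞 n} [HasZeroObject 𝒞]

/-- The twist `1 + v` of the first term is invisible to the extension, since `v` kills the first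
differential from the right and so fixes the pushed-out extension. -/
lemma ExtensionStructure.IsRealisation.exists_mappingCone_of_homotopy (hS : S.IsRealisation)
    {A C D : 𝒞} {X : NComplex n A C} {Y : NComplex n A D} {f f' : X.K ⟶ Y.K} {c : C ⟶ D}
    (hf : X.IsLift Y f (𝟙 A) c) (hf' : X.IsLift Y f' (𝟙 A) c) (H : Homotopy f' f)
    {M : NComplex n (X.K.X 1) D}
    (m : MappingCone f M) {δ : Ext S.E D A} (hM : S.Realises (push S.E X.dFirst δ) M) :
    ∃ M' : NComplex n (X.K.X 1) D, Nonempty (MappingCone f' M') ∧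
      S.Realises (push S.E X.dFirst δ) M' := by
  obtain ⟨v, hv, hdv, hm⟩ := m.exists_of_homotopy H hf hf'
  refine ⟨_, hm, hS.realises_of_iso hM (Iso.refl _) (oneAddIso v hv) (Iso.refl _)
    ⟨?_, ?_⟩ ?_⟩
  · simp [hv]
  · simp
  · rw [← push_comp]
    simp only [oneAddIso_hom, Preadditive.comp_add, hdv, Category.comp_id, add_zero, Iso.refl_hom,
      pull_id]

/-- Compatible splittings of a morphism by idempotents homotopic to the identity. -/
lemma exists_homotopy_commute {K L : HomologicalComplex 𝒞 (nShape n)} (f : K ⟶ L) {e : K ⟶ K}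
    {e' : L ⟶ L} (he : e ≫ e = e) (he' : e' ≫ e' = e')
    (H : Nonempty (Homotopy ((𝟙 K - e) ≫ (𝟙 K - e)) 0))
    (H' : Nonempty (Homotopy ((𝟙 L - e') ≫ (𝟙 L - e')) 0)) :
    Nonempty (Homotopy (e ≫ f ≫ e' + (𝟙 K - e) ≫ f ≫ (𝟙 L - e')) f) ∧
    e ≫ (e ≫ f ≫ e' + (𝟙 K - e) ≫ f ≫ (𝟙 L - e')) =
      (e ≫ f ≫ e' + (𝟙 K - e) ≫ f ≫ (𝟙 L - e')) ≫ e' := by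
  obtain ⟨H⟩ := H
  obtain ⟨H'⟩ := H'
  refine ⟨⟨Homotopy.equivSubZero.symm ?_⟩, ?_⟩
  · have h1 : Homotopy ((𝟙 K - e) ≫ (𝟙 K - e) ≫ f ≫ (-e')) 0 :=
      (Homotopy.ofEq (by rw [Category.assoc])).trans ((H.compRight (f ≫ (-e'))).trans
        (Homotopy.ofEq zero_comp))
    have h2 : Homotopy ((-(e ≫ f)) ≫ (𝟙 L - e') ≫ (𝟙 L - e')) 0 :=
      (H'.compLeft (-(e ≫ f))).trans (Homotopy.ofEq comp_zero)
    refine (Homotopy.ofEq ?_).trans ((h1.add h2).trans (Homotopy.ofEq (add_zero _)))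
    simp only [Preadditive.comp_sub, Preadditive.sub_comp, Category.comp_id, Category.id_comp,
      Category.assoc, Preadditive.comp_neg, Preadditive.neg_comp, he', reassoc_of% he]
    abel
  · simp only [Preadditive.comp_sub, Preadditive.sub_comp, Category.comp_id, Category.id_comp,
      Category.assoc, Preadditive.comp_add, Preadditive.add_comp, he', reassoc_of% he]
    abel

/-- Mapping cones of direct factors. -/
lemma ExtensionStructure.IsRealisation.exists_cone_of_retract (hS : S.IsRealisation)
    (hE : S.E.Additive) (hE' : ∀ C : 𝒞ᵒᵖ, (S.E.obj C).Additive) [IsIdempotentComplete 𝒞]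
    {A₀ C₀ D₀ A C D : 𝒞} {δ₀ : Ext S.E D₀ A₀} {c₀ : C₀ ⟶ D₀} {X₀ : NComplex n A₀ C₀}
    {Y₀ : NComplex n A₀ D₀} (hX₀ : S.Realises (pull S.E c₀ δ₀) X₀) (hY₀ : S.Realises δ₀ Y₀)
    {f₀ : X₀.K ⟶ Y₀.K} (hf₀ : X₀.IsLift Y₀ f₀ (𝟙 A₀) c₀) {M₀ : NComplex n (X₀.K.X 1) D₀}
    (m₀ : MappingCone f₀ M₀) (hM₀ : S.Realises (push S.E X₀.dFirst δ₀) M₀)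
    {X : NComplex n A C} {Y : NComplex n A D} {iX : X.K ⟶ X₀.K} {rX : X₀.K ⟶ X.K}
    {iY : Y.K ⟶ Y₀.K} {rY : Y₀.K ⟶ Y.K} {ιA : A ⟶ A₀} {πA : A₀ ⟶ A} {ιC : C ⟶ C₀} {πC : C₀ ⟶ C}
    {ιD : D ⟶ D₀} {πD : D₀ ⟶ D} (hiX : X.IsLift X₀ iX ιA ιC) (hrX : X₀.IsLift X rX πA πC)
    (hiY : Y.IsLift Y₀ iY ιA ιD) (hrY : Y₀.IsLift Y rY πA πD)
    (hX : iX ≫ rX = 𝟙 _) (hY : iY ≫ rY = 𝟙 _) (hA : ιA ≫ πA = 𝟙 _)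
    (hD : ιD ≫ πD = 𝟙 _) {c : C ⟶ D} (hc : c ≫ ιD = ιC ≫ c₀) (hc' : c₀ ≫ πD = πC ≫ c)
    {δ : Ext S.E D A} (hδ : push S.E ιA δ = pull S.E ιD δ₀) (hδ' : push S.E πA δ₀ = pull S.E πD δ)
    (hδA : push S.E (πA ≫ ιA) δ₀ = δ₀) :
    ∃ f : X.K ⟶ Y.K, X.IsLift Y f (𝟙 A) c ∧
      ∃ M : NComplex n (X.K.X 1) D, Nonempty (MappingCone f M) ∧
        S.Realises (push S.E X.dFirst δ) M := by
  -- Invariance of `δ₀` on the `A` side propagates to `D` and `C`. Hence the complementary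
  -- endomorphisms of `X₀` and `Y₀` annihilate the extensions on the ends and are null-homotopic.
  have hδD : pull S.E (πD ≫ ιD) δ₀ = δ₀ := by
    rw [pull_comp, ← hδ, ← push_pull, ← hδ', ← push_comp, hδA]
  have hcc : πC ≫ ιC ≫ c₀ = c₀ ≫ πD ≫ ιD := by rw [reassoc_of% hc', hc]
  have hδC : pull S.E (πC ≫ ιC) (pull S.E c₀ δ₀) = pull S.E c₀ δ₀ := by
    rw [← pull_comp, Category.assoc, hcc, pull_comp, hδD]
  have he : (rX ≫ iX) ≫ rX ≫ iX = rX ≫ iX := by simp [reassoc_of% hX]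
  have he' : (rY ≫ iY) ≫ rY ≫ iY = rY ≫ iY := by simp [reassoc_of% hY]
  obtain ⟨⟨H⟩, hcomm⟩ := exists_homotopy_commute f₀ he he'
    ((hS.isExangle _ _ hX₀).comp_self_htpy_zero hS.one_le _ ((IsLift.id _).sub (hrX.comp hiX))
      (by rw [push_pull, push_one_sub hE' hδA, map_zero]) (pull_one_sub hE hδC))
    ((hS.isExangle _ _ hY₀).comp_self_htpy_zero hS.one_le _ ((IsLift.id _).sub (hrY.comp hiY))
      (push_one_sub hE' hδA) (pull_one_sub hE hδD))
  set f₁ := (rX ≫ iX) ≫ f₀ ≫ rY ≫ iY + (𝟙 X₀.K - rX ≫ iX) ≫ f₀ ≫ (𝟙 Y₀.K - rY ≫ iY) with hf₁def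
  have hf₁ : X₀.IsLift Y₀ f₁ (𝟙 A₀) c₀ := by
    refine ((((hrX.comp hiX).comp (hf₀.comp (hrY.comp hiY)))).add
      (((IsLift.id _).sub (hrX.comp hiX)).comp (hf₀.comp ((IsLift.id _).sub (hrY.comp hiY))))).congr
      ?_ ?_
    · simp [reassoc_of% hA]
    · simp only [Category.assoc, reassoc_of% hcc, reassoc_of% hD, Preadditive.sub_comp,
        Preadditive.comp_sub, Category.id_comp, Category.comp_id]
      rw [← hcc]
      abel
  obtain ⟨M₁, ⟨m₁⟩, hM₁⟩ := hS.exists_mappingCone_of_homotopy hf₀ hf₁ H m₀ hM₀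
  -- As `f₁` commutes with the two idempotents, they induce a diagonal idempotent of its cone; its
  -- image is the cone of the restriction of `f₁` to the direct factors.
  obtain ⟨L, i, r, hir, hri, -⟩ := exists_splitting (m₁.endo (rX ≫ iX) (rY ≫ iY) hS.one_le hcomm) ⊤
    (fun k => by
      obtain ⟨T, i, r, h1, h2⟩ := IsIdempotentComplete.idempotents_split _
        ((m₁.endo (rX ≫ iX) (rY ≫ iY) hS.one_le hcomm).f k)
        (HomologicalComplex.congr_hom (m₁.endo_comp_self _ _ hS.one_le hcomm he he') k)
      exact ⟨T, i, r, trivial, h1, h2⟩)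
  have hri' (k) : r.f k ≫ i.f k = m₁.endoF (rX ≫ iX) (rY ≫ iY) k :=
    HomologicalComplex.congr_hom hri k
  have hir' (k) : i.f k ≫ r.f k = 𝟙 _ := HomologicalComplex.congr_hom hir k
  have hX' (k) : iX.f k ≫ rX.f k = 𝟙 _ := HomologicalComplex.congr_hom hX k
  have hri0 : r.f 0 ≫ i.f 0 = M₁.left.hom ≫ (rX.f 1 ≫ iX.f 1) ≫ M₁.left.inv :=
    (hri' 0).trans (m₁.endoF_zero _ _)
  have hriL : r.f (Fin.last (n + 1)) ≫ i.f (Fin.last (n + 1)) =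
      M₁.right.hom ≫ (πD ≫ ιD) ≫ M₁.right.inv := by
    rw [hri', m₁.endoF_last, HomologicalComplex.comp_f, hrY.f_last, hiY.f_last]
    simp
  let M : NComplex n (X.K.X 1) D :=
    { K := L
      left :=
        { hom := i.f 0 ≫ M₁.left.hom ≫ rX.f 1
          inv := iX.f 1 ≫ M₁.left.inv ≫ r.f 0
          hom_inv_id := by
            have := i.f 0 ≫= hri0 =≫ r.f 0
            simp only [Category.assoc, hir', Category.comp_id] at this ⊢
            exact this.symm
          inv_hom_id := by
            simp [reassoc_of% hri0, hX'] }
      right :=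
        { hom := i.f _ ≫ M₁.right.hom ≫ πD
          inv := ιD ≫ M₁.right.inv ≫ r.f _
          hom_inv_id := by
            have := i.f _ ≫= hriL =≫ r.f _
            simp only [Category.assoc, hir', Category.comp_id] at this ⊢
            exact this.symm
          inv_hom_id := by
            simp [reassoc_of% hriL, hD] } }
  refine ⟨iX ≫ f₁ ≫ rY, (hiX.comp (hf₁.comp hrY)).congr (by simp [hA]) (by simp [← reassoc_of% hc, hD]),
    M, ⟨m₁.retract hX hY hcomm hS.one_le (M' := M) i r hir hri rfl ?_⟩, ?_⟩
  · simp [M, hrY.right]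
  · refine hS.realises_of_retract hM₁ i r (a := iX.f 1) (a' := rX.f 1) (c := ιD) (c' := πD)
      ⟨?_, ?_⟩ ⟨?_, ?_⟩ hir (hX' 1) hD ?_ ?_
    · have := i.f 0 ≫= hri0
      rw [reassoc_of% hir'] at this
      rw [← cancel_mono M₁.left.inv]
      simpa [M] using this
    · have := i.f _ ≫= hriL
      rw [reassoc_of% hir'] at this
      rw [← cancel_mono M₁.right.inv]
      simpa [M] using this
    · simp [M, reassoc_of% hri0, hX']
    · simp [M, reassoc_of% hriL, hD]
    · rw [← push_comp, hiX.dFirst, push_comp, hδ, push_pull]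
    · rw [← push_comp, hrX.dFirst, push_comp, hδ', push_pull]

end Retract

end NExang

end

set_option linter.unusedSectionVars false

noncomputable section

namespace NExang

open NComplex ExtensionStructure

/-! ### The dual theory for mapping cocones -/

namespace MappingCocone

variable {𝒞 : Type u} [Category.{v} 𝒞] [Preadditive 𝒞] {n : ℕ} {A B C D : 𝒞}
  {X : NComplex n A C} {Y : NComplex n B D} {f : X.K ⟶ Y.K}
  {N : NComplex n A (Y.K.X (Fin.last n).castSucc)}
  (m : MappingCocone f N)

lemma dFirst_eq (h : (nShape n).Rel 0 1) (h1 : (1 : Fin (n + 2)) ≠ Fin.last (n + 1)) :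
    N.dFirst = X.left.inv ≫ f.f 0 ≫ (m.biprod h h1).inl + X.dFirst ≫ (m.biprod h h1).inr := by
  apply (m.biprod h h1).hom_ext_to
  · simp [m.first_fst]
  · simp [m.first_snd]

lemma d_eq {i j k : Fin (n + 2)} (hij : (nShape n).Rel i j) (hjk : (nShape n).Rel j k)
    (hj : j ≠ Fin.last (n + 1)) (hk : k ≠ Fin.last (n + 1)) :
    N.K.d j k = -(m.biprod hij hj).fst ≫ Y.K.d i j ≫ (m.biprod hjk hk).inl +
      (m.biprod hij hj).snd ≫ f.f j ≫ (m.biprod hjk hk).inl +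
      (m.biprod hij hj).snd ≫ X.K.d j k ≫ (m.biprod hjk hk).inr := by
  apply (m.biprod hij hj).hom_ext_from <;> apply (m.biprod hjk hk).hom_ext_to
  · simp [m.inl_d_fst hij hjk]
  · simp [m.inl_d_snd hij hjk]
  · simp [m.inr_d_fst hij hjk]
  · simp [m.inr_d_snd hij hjk]

lemma dLast_eq {i : Fin (n + 2)} (h : (nShape n).Rel i (Fin.last n).castSucc)
    (h1 : (Fin.last n).castSucc ≠ Fin.last (n + 1)) :
    N.dLast = -(m.biprod h h1).fst ≫ Y.K.d i (Fin.last n).castSucc +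
      (m.biprod h h1).snd ≫ f.f (Fin.last n).castSucc := by
  apply (m.biprod h h1).hom_ext_from
  · simp [m.inl_last]
  · simp [m.inr_last]

section Endomorphism

variable (α : X.K ⟶ X.K) (β : Y.K ⟶ Y.K)

/-- The components of the endomorphism of a mapping cocone induced by `α` and `β`. -/
def endoF (k : Fin (n + 2)) : N.K.X k ⟶ N.K.X k :=
  if hl : k = Fin.last (n + 1) then
    hl.symm ▸ (N.right.hom ≫ β.f (Fin.last n).castSucc ≫ N.right.inv :
      N.K.X (Fin.last (n + 1)) ⟶ N.K.X (Fin.last (n + 1)))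
  else if h0 : k = 0 then
    h0.symm ▸ (N.left.hom ≫ X.left.inv ≫ α.f 0 ≫ X.left.hom ≫ N.left.inv : N.K.X 0 ⟶ N.K.X 0)
  else (m.biprod (nShape_exists_prev k h0).choose_spec hl).diag (β.f _) (α.f _)

lemma endoF_zero : m.endoF α β 0 =
    N.left.hom ≫ X.left.inv ≫ α.f 0 ≫ X.left.hom ≫ N.left.inv := by
  rw [endoF, dif_neg last_ne_zero.symm, dif_pos rfl]

lemma endoF_last : m.endoF α β (Fin.last (n + 1)) =
    N.right.hom ≫ β.f (Fin.last n).castSucc ≫ N.right.inv := by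
  rw [endoF, dif_pos rfl]

lemma endoF_mid {i j : Fin (n + 2)} (hij : (nShape n).Rel i j) (hj : j ≠ Fin.last (n + 1)) :
    m.endoF α β j = (m.biprod hij hj).diag (β.f i) (α.f j) := by
  have h0 : j ≠ 0 := by
    rintro rfl
    exact nShape_not_rel_zero _ hij
  rw [endoF, dif_neg hj, dif_neg h0]
  have key : ∀ i' (h : (nShape n).Rel i' j), (m.biprod h hj).diag (β.f i') (α.f j) =
      (m.biprod hij hj).diag (β.f i) (α.f j) := by
    intro i' h
    obtain rfl := (nShape n).prev_eq h hij
    rfl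
  exact key _ _

/-- The endomorphism of a mapping cocone induced by compatible endomorphisms `α` and `β`. -/
def endo (hn : 1 ≤ n) (h : α ≫ f = f ≫ β) : N.K ⟶ N.K where
  f := m.endoF α β
  comm' i j hij := by
    have hf (k) : α.f k ≫ f.f k = f.f k ≫ β.f k := HomologicalComplex.congr_hom h k
    by_cases hj : j = Fin.last (n + 1)
    · subst hj
      obtain rfl := (nShape n).prev_eq hij nShape_rel_last
      obtain ⟨i, hi⟩ := nShape_exists_prev (n := n) _ (castSucc_last_ne_zero hn)
      rw [endoF_last, m.endoF_mid α β hi castSucc_last_ne_last, ← cancel_mono N.right.hom]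
      have h1 : N.K.d (Fin.last n).castSucc (Fin.last (n + 1)) ≫ N.right.hom = N.dLast := rfl
      simp only [Category.assoc, Iso.inv_hom_id, Category.comp_id, h1, reassoc_of% h1]
      rw [m.dLast_eq hi castSucc_last_ne_last]
      simp [BiprodData.diag, hf]
    · by_cases hi : i = 0
      · subst hi
        obtain rfl := nShape_rel_zero hij
        rw [endoF_zero, m.endoF_mid α β hij hj, ← cancel_epi N.left.inv]
        have h1 : N.left.inv ≫ N.K.d 0 1 = N.dFirst := rfl
        simp only [Category.assoc, Iso.inv_hom_id_assoc, h1, reassoc_of% h1]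
        rw [m.dFirst_eq hij hj]
        simp only [Preadditive.add_comp, Category.assoc, BiprodData.diag, Preadditive.comp_add]
        simp [NComplex.dFirst, reassoc_of% hf]
      · obtain ⟨k, hki⟩ := nShape_exists_prev i hi
        have hil : i ≠ Fin.last (n + 1) := by
          rintro rfl
          exact nShape_not_last_rel _ hij
        rw [m.endoF_mid α β hki hil, m.endoF_mid α β hij hj, m.d_eq hki hij hil hj]
        simp only [BiprodData.diag, Preadditive.add_comp, Preadditive.comp_add, Category.assoc,
          Preadditive.neg_comp, Preadditive.comp_neg]
        simp [reassoc_of% hf, add_assoc]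

lemma endo_comp_self (hn : 1 ≤ n) (h : α ≫ f = f ≫ β) (hα : α ≫ α = α) (hβ : β ≫ β = β) :
    m.endo α β hn h ≫ m.endo α β hn h = m.endo α β hn h := by
  have hα' (k) : α.f k ≫ α.f k = α.f k := HomologicalComplex.congr_hom hα k
  have hβ' (k) : β.f k ≫ β.f k = β.f k := HomologicalComplex.congr_hom hβ k
  ext k
  change m.endoF α β k ≫ m.endoF α β k = m.endoF α β k
  by_cases hl : k = Fin.last (n + 1)
  · subst hl
    rw [endoF_last]
    simp [reassoc_of% hβ']
  · by_cases hk : k = 0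
    · subst hk
      rw [endoF_zero]
      simp [reassoc_of% hα']
    · obtain ⟨j, hj⟩ := nShape_exists_prev k hk
      rw [m.endoF_mid α β hj hl]
      exact (m.biprod hj hl).diag_comp_self (hβ' _) (hα' _)

end Endomorphism

/-- A direct factor of a mapping cocone. -/
def retract {A' B' C' D' : 𝒞} {X' : NComplex n A' C'} {Y' : NComplex n B' D'}
    {iX : X'.K ⟶ X.K} {rX : X.K ⟶ X'.K} {iY : Y'.K ⟶ Y.K} {rY : Y.K ⟶ Y'.K}
    (hX : iX ≫ rX = 𝟙 _) (hY : iY ≫ rY = 𝟙 _) (h : (rX ≫ iX) ≫ f = f ≫ rY ≫ iY) (hn : 1 ≤ n)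
    {N' : NComplex n A' (Y'.K.X (Fin.last n).castSucc)} (i : N'.K ⟶ N.K) (r : N.K ⟶ N'.K)
    (hir : i ≫ r = 𝟙 _)
    (hri : r ≫ i = m.endo (rX ≫ iX) (rY ≫ iY) hn h)
    (hl : N'.left.inv = X'.left.inv ≫ iX.f 0 ≫ X.left.hom ≫ N.left.inv ≫ r.f 0)
    (hr : N'.right.hom = i.f _ ≫ N.right.hom ≫ rY.f _) :
    MappingCocone (iX ≫ f ≫ rY) N' := by
  have hX' (k) : iX.f k ≫ rX.f k = 𝟙 _ := HomologicalComplex.congr_hom hX k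
  have hY' (k) : iY.f k ≫ rY.f k = 𝟙 _ := HomologicalComplex.congr_hom hY k
  have hir' (k) : i.f k ≫ r.f k = 𝟙 _ := HomologicalComplex.congr_hom hir k
  have hri' (k) : r.f k ≫ i.f k = m.endoF (rX ≫ iX) (rY ≫ iY) k :=
    HomologicalComplex.congr_hom hri k
  have hf (k) : rX.f k ≫ iX.f k ≫ f.f k = f.f k ≫ rY.f k ≫ iY.f k := by
    simpa using HomologicalComplex.congr_hom h k
  have hd0 : N'.dLast = i.f _ ≫ N.dLast ≫ rY.f (Fin.last n).castSucc := by
    simp [NComplex.dLast, hr]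
  have hmid : ∀ {i' j : Fin (n + 2)} (hij : (nShape n).Rel i' j) (hj : j ≠ Fin.last (n + 1)),
      r.f j ≫ i.f j = (m.biprod hij hj).diag (rY.f i' ≫ iY.f i') (rX.f j ≫ iX.f j) :=
    fun hij hj => (hri' _).trans (m.endoF_mid _ _ hij hj)
  have h1 : N'.dFirst ≫ i.f 1 = X'.left.inv ≫ iX.f 0 ≫ X.left.hom ≫ N.dFirst := by
    rw [NComplex.dFirst, Category.assoc, ← i.comm, hl]
    simp only [Category.assoc]
    rw [reassoc_of% (hri' 0), m.endoF_zero]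
    simp [NComplex.dFirst, reassoc_of% hX']
  refine
  { biprod := fun hij hj => (m.biprod hij hj).retract (hY' _) (hX' _) (hir' _) (hmid hij hj)
    first_fst := ?_
    first_snd := ?_
    inl_d_fst := ?_
    inl_d_snd := ?_
    inr_d_fst := ?_
    inr_d_snd := ?_
    inl_last := ?_
    inr_last := ?_ }
  · intro h h0
    simp only [BiprodData.retract_fst, reassoc_of% h1]
    rw [m.dFirst_eq h h0]
    simp
  · intro h h0
    simp only [BiprodData.retract_snd, reassoc_of% h1]
    rw [m.dFirst_eq h h0]
    simp [NComplex.dFirst, hX']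
  · intro i' j k hij hjk hi hj
    simp only [BiprodData.retract_inl, BiprodData.retract_fst, Category.assoc,
      reassoc_of% (hmid hij hi), ← i.comm_assoc]
    rw [m.d_eq hij hjk hi hj]
    simp [BiprodData.diag, hY']
  · intro i' j k hij hjk hi hj
    simp only [BiprodData.retract_inl, BiprodData.retract_snd, Category.assoc,
      reassoc_of% (hmid hij hi), ← i.comm_assoc]
    rw [m.d_eq hij hjk hi hj]
    simp [BiprodData.diag]
  · intro i' j k hij hjk hi hj
    simp only [BiprodData.retract_inr, BiprodData.retract_fst, Category.assoc,
      reassoc_of% (hmid hij hi), ← i.comm_assoc]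
    rw [m.d_eq hij hjk hi hj]
    simp [BiprodData.diag, reassoc_of% hX']
  · intro i' j k hij hjk hi hj
    simp only [BiprodData.retract_inr, BiprodData.retract_snd, Category.assoc,
      reassoc_of% (hmid hij hi), ← i.comm_assoc]
    rw [m.d_eq hij hjk hi hj]
    simp [BiprodData.diag, hX']
  · intro j h h0
    simp only [hd0, BiprodData.retract_inl, Category.assoc, reassoc_of% (hmid h h0)]
    rw [m.dLast_eq h h0]
    simp [BiprodData.diag, hY']
  · intro j h h0
    simp only [hd0, BiprodData.retract_inr, Category.assoc, reassoc_of% (hmid h h0)]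
    rw [m.dLast_eq h h0]
    simp [BiprodData.diag, reassoc_of% hX']

/-- The image of a mapping cocone under an additive functor. -/
def map {𝒟 : Type u'} [Category.{v'} 𝒟] [Preadditive 𝒟] (F : 𝒞 ⥤ 𝒟) [F.Additive] :
    MappingCocone (X := X.map F) (Y := Y.map F) ((F.mapHomologicalComplex (nShape n)).map f)
      (N.map F) where
  biprod hij hi := (m.biprod hij hi).map F
  first_fst h h0 := by
    refine (congrArg (· ≫ F.map (m.biprod h h0).fst) (N.map_dFirst F)).trans ?_
    exact (F.map_comp _ _).symm.trans ((congrArg F.map (m.first_fst h h0)).trans (F.map_comp _ _))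
  first_snd h h0 := by
    refine (congrArg (· ≫ F.map (m.biprod h h0).snd) (N.map_dFirst F)).trans ?_
    exact (F.map_comp _ _).symm.trans ((congrArg F.map (m.first_snd h h0)).trans
      (X.map_dFirst F).symm)
  inl_d_fst hij hjk hi hj := by
    have := congrArg F.map (m.inl_d_fst hij hjk hi hj)
    rwa [F.map_comp, F.map_comp, F.map_neg] at this
  inl_d_snd hij hjk hi hj := by
    have := congrArg F.map (m.inl_d_snd hij hjk hi hj)
    rwa [F.map_comp, F.map_comp, F.map_zero] at this
  inr_d_fst hij hjk hi hj := by
    have := congrArg F.map (m.inr_d_fst hij hjk hi hj)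
    rwa [F.map_comp, F.map_comp] at this
  inr_d_snd hij hjk hi hj := by
    have := congrArg F.map (m.inr_d_snd hij hjk hi hj)
    rwa [F.map_comp, F.map_comp] at this
  inl_last h h0 := by
    refine (congrArg (F.map (m.biprod h h0).inl ≫ ·) (N.map_dLast F)).trans ?_
    exact (F.map_comp _ _).symm.trans ((congrArg F.map (m.inl_last h h0)).trans F.map_neg)
  inr_last h h0 := by
    refine (congrArg (F.map (m.biprod h h0).inr ≫ ·) (N.map_dLast F)).trans ?_
    exact (F.map_comp _ _).symm.trans (congrArg F.map (m.inr_last h h0))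

end MappingCocone

variable {𝒞 : Type u} [Category.{v} 𝒞] [Preadditive 𝒞] {n : ℕ}

/-- The biproduct obtained by a shear in the other direction. -/
@[simps]
def BiprodData.shear' {P Q M : 𝒞} (b : BiprodData P Q M) (h : Q ⟶ P) : BiprodData P Q M where
  inl := b.inl
  inr := b.inr - h ≫ b.inl
  fst := b.fst + b.snd ≫ h
  snd := b.snd
  inl_fst := by simp
  inl_snd := by simp
  inr_fst := by simp
  inr_snd := by simp
  total := by
    rw [← b.total]
    simp

section

variable {A B C : 𝒞} {X : NComplex n A C} {Y : NComplex n B C}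

lemma d_dLast (X : NComplex n A C) (i : Fin (n + 2)) :
    X.K.d i (Fin.last n).castSucc ≫ X.dLast = 0 := by
  simp [NComplex.dLast]

/-- A mapping cocone of a morphism is isomorphic to a mapping cocone of each homotopic morphism. -/
lemma MappingCocone.exists_of_homotopy {f f' : X.K ⟶ Y.K} (H : Homotopy f' f) {a : A ⟶ B}
    (hf : X.IsLift Y f a (𝟙 C)) (hf' : X.IsLift Y f' a (𝟙 C))
    {N : NComplex n A (Y.K.X (Fin.last n).castSucc)} (m : MappingCocone f N) :
    ∃ (v : Y.K.X (Fin.last n).castSucc ⟶ Y.K.X (Fin.last n).castSucc) (hv : v ≫ v = 0),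
      v ≫ Y.dLast = 0 ∧
      Nonempty (MappingCocone f' (⟨N.K, N.left, N.right ≪≫ oneAddIso v hv⟩ :
        NComplex n A (Y.K.X (Fin.last n).castSucc))) := by
  have h0 : H.hom (Fin.last (n + 1)) (Fin.last n).castSucc ≫
      Y.K.d (Fin.last n).castSucc (Fin.last (n + 1)) = 0 := by
    have h1 := homotopy_comm_last H
    rw [hf.f_last, hf'.f_last] at h1
    exact (left_eq_add.mp (h1.trans (add_comm _ _)))
  have h0' {T : 𝒞} (t : Y.K.X _ ⟶ T) : H.hom (Fin.last (n + 1)) (Fin.last n).castSucc ≫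
      Y.K.d (Fin.last n).castSucc (Fin.last (n + 1)) ≫ t = 0 := by
    rw [← Category.assoc, h0, zero_comp]
  -- Dually, the cocone has no summand `Xₙ₊₁`, so the component `Xₙ₊₁ ⟶ Yₙ` of the homotopy is moved
  -- into an automorphism of the last term `Yₙ`.
  let v : Y.K.X (Fin.last n).castSucc ⟶ Y.K.X (Fin.last n).castSucc :=
    Y.dLast ≫ X.right.inv ≫ H.hom (Fin.last (n + 1)) (Fin.last n).castSucc
  have hv : v ≫ v = 0 := by simp [v, NComplex.dLast, h0']
  have hvd (i) : Y.K.d i _ ≫ v = 0 := by simp [v, reassoc_of% (d_dLast Y)]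
  have hf0 : f.f _ ≫ Y.dLast = X.dLast := by simpa using hf.dLast
  have hvf : f.f _ ≫ v = X.K.d _ _ ≫ H.hom (Fin.last (n + 1)) (Fin.last n).castSucc := by
    simp only [v, reassoc_of% hf0]
    simp [NComplex.dLast]
  let N' : NComplex n A (Y.K.X (Fin.last n).castSucc) := ⟨N.K, N.left, N.right ≪≫ oneAddIso v hv⟩
  have hd : N'.dLast = N.dLast ≫ (𝟙 _ + v) := by simp [N', NComplex.dLast]
  have hd' : N'.dFirst = N.dFirst := rfl
  refine ⟨v, hv, by simp [v, NComplex.dLast, h0'], ⟨?_⟩⟩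
  change MappingCocone f' N'
  exact
  { biprod := fun {i j} hij hj => (m.biprod hij hj).shear' (H.hom j i)
    first_fst := fun h h1 => by
      rw [hd', homotopy_comm_zero H]
      simp only [BiprodData.shear'_fst, Preadditive.comp_add, m.first_fst,
        reassoc_of% (m.first_snd h h1)]
      rw [NComplex.dFirst, Category.assoc]
      exact add_comm _ _
    first_snd := fun h h1 => m.first_snd h h1
    inl_d_fst := fun {i j k} hij hjk hj hk => by
      change (m.biprod hij hj).inl ≫ N.K.d _ _ ≫
        ((m.biprod hjk hk).fst + (m.biprod hjk hk).snd ≫ _) = _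
      have h2 := m.inl_d_snd hij hjk hj hk
      simp only [Preadditive.comp_add, m.inl_d_fst hij hjk, reassoc_of% h2, zero_comp, add_zero]
    inl_d_snd := fun hij hjk hj hk => m.inl_d_snd hij hjk hj hk
    inr_d_fst := fun {i j k} hij hjk hj hk => by
      change ((m.biprod hij hj).inr - _ ≫ (m.biprod hij hj).inl) ≫ N.K.d _ _ ≫
        ((m.biprod hjk hk).fst + (m.biprod hjk hk).snd ≫ _) = _
      have h1 := m.inr_d_snd hij hjk hj hk
      have h2 := m.inl_d_snd hij hjk hj hk
      rw [homotopy_comm_mid H hij hjk]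
      simp only [Preadditive.comp_add, Preadditive.sub_comp, Category.assoc,
        m.inl_d_fst hij hjk, m.inr_d_fst hij hjk, reassoc_of% h1, reassoc_of% h2,
        Preadditive.comp_neg, zero_comp, comp_zero]
      abel
    inr_d_snd := fun {i j k} hij hjk hj hk => by
      change ((m.biprod hij hj).inr - _ ≫ (m.biprod hij hj).inl) ≫ N.K.d _ _ ≫
        (m.biprod hjk hk).snd = _
      simp [m.inl_d_snd hij hjk, m.inr_d_snd hij hjk]
    inl_last := fun {i} h h1 => by
      rw [hd]
      simp [reassoc_of% (m.inl_last h h1), m.inl_last, hvd]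
    inr_last := fun {i} h h1 => by
      rw [hd, homotopy_comm_mid H h nShape_rel_last]
      simp [m.inr_last, reassoc_of% (m.inr_last h h1), m.inl_last, reassoc_of% (m.inl_last h h1),
        hvf, hvd]
      abel }

end

/-! ### Mapping cocones of direct factors -/

section Retract

variable {S : ExtensionStructure.{w} 𝒞 n} [HasZeroObject 𝒞]

lemma ExtensionStructure.IsRealisation.exists_mappingCocone_of_homotopy (hS : S.IsRealisation)
    {A B C : 𝒞} {X : NComplex n A C} {Y : NComplex n B C} {f f' : X.K ⟶ Y.K} {a : A ⟶ B}
    (hf : X.IsLift Y f a (𝟙 C)) (hf' : X.IsLift Y f' a (𝟙 C)) (H : Homotopy f' f)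
    {N : NComplex n A (Y.K.X (Fin.last n).castSucc)}
    (m : MappingCocone f N) {δ : Ext S.E C A} (hN : S.Realises (pull S.E Y.dLast δ) N) :
    ∃ N' : NComplex n A (Y.K.X (Fin.last n).castSucc), Nonempty (MappingCocone f' N') ∧
      S.Realises (pull S.E Y.dLast δ) N' := by
  obtain ⟨v, hv, hdv, hm⟩ := m.exists_of_homotopy H hf hf'
  refine ⟨_, hm, hS.realises_of_iso hN (Iso.refl _) (Iso.refl _) (oneAddIso v hv).symm
    ⟨?_, ?_⟩ ?_⟩
  · simp
  · simp [hv]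
  · rw [← pull_comp]
    simp only [Iso.symm_hom, oneAddIso_inv, Preadditive.sub_comp, hdv, Category.id_comp, sub_zero,
      Iso.refl_hom, push_id]

/-- Mapping cocones of direct factors. -/
lemma ExtensionStructure.IsRealisation.exists_cocone_of_retract (hS : S.IsRealisation)
    (hE : S.E.Additive) (hE' : ∀ C : 𝒞ᵒᵖ, (S.E.obj C).Additive) [IsIdempotentComplete 𝒞]
    {A₀ B₀ C₀ A B C : 𝒞} {δ₀ : Ext S.E C₀ A₀} {a₀ : A₀ ⟶ B₀} {X₀ : NComplex n A₀ C₀}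
    {Y₀ : NComplex n B₀ C₀} (hX₀ : S.Realises δ₀ X₀) (hY₀ : S.Realises (push S.E a₀ δ₀) Y₀)
    {f₀ : X₀.K ⟶ Y₀.K} (hf₀ : X₀.IsLift Y₀ f₀ a₀ (𝟙 C₀))
    {N₀ : NComplex n A₀ (Y₀.K.X (Fin.last n).castSucc)}
    (m₀ : MappingCocone f₀ N₀) (hN₀ : S.Realises (pull S.E Y₀.dLast δ₀) N₀)
    {X : NComplex n A C} {Y : NComplex n B C} {iX : X.K ⟶ X₀.K} {rX : X₀.K ⟶ X.K}
    {iY : Y.K ⟶ Y₀.K} {rY : Y₀.K ⟶ Y.K} {ιA : A ⟶ A₀} {πA : A₀ ⟶ A} {ιB : B ⟶ B₀} {πB : B₀ ⟶ B}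
    {ιC : C ⟶ C₀} {πC : C₀ ⟶ C} (hiX : X.IsLift X₀ iX ιA ιC) (hrX : X₀.IsLift X rX πA πC)
    (hiY : Y.IsLift Y₀ iY ιB ιC) (hrY : Y₀.IsLift Y rY πB πC)
    (hX : iX ≫ rX = 𝟙 _) (hY : iY ≫ rY = 𝟙 _) (hA : ιA ≫ πA = 𝟙 _)
    (hC : ιC ≫ πC = 𝟙 _) {a : A ⟶ B} (ha : a ≫ ιB = ιA ≫ a₀) (ha' : a₀ ≫ πB = πA ≫ a)
    {δ : Ext S.E C A} (hδ : push S.E ιA δ = pull S.E ιC δ₀) (hδ' : push S.E πA δ₀ = pull S.E πC δ)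
    (hδC : pull S.E (πC ≫ ιC) δ₀ = δ₀) :
    ∃ f : X.K ⟶ Y.K, X.IsLift Y f a (𝟙 C) ∧
      ∃ N : NComplex n A (Y.K.X (Fin.last n).castSucc), Nonempty (MappingCocone f N) ∧
        S.Realises (pull S.E Y.dLast δ) N := by
  -- Here the invariance is given on the `C` side and propagates to `A` and `B`.
  have hδA : push S.E (πA ≫ ιA) δ₀ = δ₀ := by
    rw [push_comp, hδ', push_pull, hδ, ← pull_comp, hδC]
  have haa : πA ≫ ιA ≫ a₀ = a₀ ≫ πB ≫ ιB := by rw [reassoc_of% ha', ha]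
  have hδB : push S.E (πB ≫ ιB) (push S.E a₀ δ₀) = push S.E a₀ δ₀ := by
    rw [← push_comp, ← haa, ← Category.assoc, push_comp, hδA]
  have he : (rX ≫ iX) ≫ rX ≫ iX = rX ≫ iX := by simp [reassoc_of% hX]
  have he' : (rY ≫ iY) ≫ rY ≫ iY = rY ≫ iY := by simp [reassoc_of% hY]
  obtain ⟨⟨H⟩, hcomm⟩ := exists_homotopy_commute f₀ he he'
    ((hS.isExangle _ _ hX₀).comp_self_htpy_zero hS.one_le _ ((IsLift.id _).sub (hrX.comp hiX))
      (push_one_sub hE' hδA) (pull_one_sub hE hδC))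
    ((hS.isExangle _ _ hY₀).comp_self_htpy_zero hS.one_le _ ((IsLift.id _).sub (hrY.comp hiY))
      (push_one_sub hE' hδB) (by rw [← push_pull, pull_one_sub hE hδC, map_zero]))
  set f₁ := (rX ≫ iX) ≫ f₀ ≫ rY ≫ iY + (𝟙 X₀.K - rX ≫ iX) ≫ f₀ ≫ (𝟙 Y₀.K - rY ≫ iY) with hf₁def
  have hf₁ : X₀.IsLift Y₀ f₁ a₀ (𝟙 C₀) := by
    refine ((((hrX.comp hiX).comp (hf₀.comp (hrY.comp hiY)))).add
      (((IsLift.id _).sub (hrX.comp hiX)).comp (hf₀.comp ((IsLift.id _).sub (hrY.comp hiY))))).congr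
      ?_ ?_
    · simp only [Category.assoc, reassoc_of% ha', reassoc_of% hA,
        Preadditive.sub_comp, Preadditive.comp_sub, Category.id_comp, Category.comp_id]
      rw [haa, reassoc_of% ha']
      abel
    · simp [reassoc_of% hC]
  obtain ⟨N₁, ⟨m₁⟩, hN₁⟩ := hS.exists_mappingCocone_of_homotopy hf₀ hf₁ H m₀ hN₀
  obtain ⟨L, i, r, hir, hri, -⟩ := exists_splitting (m₁.endo (rX ≫ iX) (rY ≫ iY) hS.one_le hcomm) ⊤
    (fun k => by
      obtain ⟨T, i, r, h1, h2⟩ := IsIdempotentComplete.idempotents_split _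
        ((m₁.endo (rX ≫ iX) (rY ≫ iY) hS.one_le hcomm).f k)
        (HomologicalComplex.congr_hom (m₁.endo_comp_self _ _ hS.one_le hcomm he he') k)
      exact ⟨T, i, r, trivial, h1, h2⟩)
  have hri' (k) : r.f k ≫ i.f k = m₁.endoF (rX ≫ iX) (rY ≫ iY) k :=
    HomologicalComplex.congr_hom hri k
  have hir' (k) : i.f k ≫ r.f k = 𝟙 _ := HomologicalComplex.congr_hom hir k
  have hY' (k) : iY.f k ≫ rY.f k = 𝟙 _ := HomologicalComplex.congr_hom hY k
  have hri0 : r.f 0 ≫ i.f 0 = N₁.left.hom ≫ (πA ≫ ιA) ≫ N₁.left.inv := by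
    rw [hri', m₁.endoF_zero, HomologicalComplex.comp_f, hrX.f_zero, hiX.f_zero]
    simp
  have hriL : r.f (Fin.last (n + 1)) ≫ i.f (Fin.last (n + 1)) =
      N₁.right.hom ≫ (rY.f _ ≫ iY.f _) ≫ N₁.right.inv :=
    (hri' _).trans (m₁.endoF_last _ _)
  let N : NComplex n A (Y.K.X (Fin.last n).castSucc) :=
    { K := L
      left :=
        { hom := i.f 0 ≫ N₁.left.hom ≫ πA
          inv := ιA ≫ N₁.left.inv ≫ r.f 0
          hom_inv_id := by
            have := i.f 0 ≫= hri0 =≫ r.f 0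
            simp only [Category.assoc, hir', Category.comp_id] at this ⊢
            exact this.symm
          inv_hom_id := by
            simp [reassoc_of% hri0, hA] }
      right :=
        { hom := i.f _ ≫ N₁.right.hom ≫ rY.f _
          inv := iY.f _ ≫ N₁.right.inv ≫ r.f _
          hom_inv_id := by
            have := i.f _ ≫= hriL =≫ r.f _
            simp only [Category.assoc, hir', Category.comp_id] at this ⊢
            exact this.symm
          inv_hom_id := by
            simp [reassoc_of% hriL, hY'] } }
  refine ⟨iX ≫ f₁ ≫ rY, (hiX.comp (hf₁.comp hrY)).congr (by rw [ha', reassoc_of% hA]) (by simp [hC]),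
    N, ⟨m₁.retract hX hY hcomm hS.one_le (N' := N) i r hir hri ?_ rfl⟩, ?_⟩
  · simp [N, hiX.f_zero]
  · refine hS.realises_of_retract hN₁ i r (a := ιA) (a' := πA) (c := iY.f _) (c' := rY.f _)
      ⟨?_, ?_⟩ ⟨?_, ?_⟩ hir hA (hY' _) ?_ ?_
    · have := i.f 0 ≫= hri0
      rw [reassoc_of% hir'] at this
      rw [← cancel_mono N₁.left.inv]
      simpa [N] using this
    · have := i.f _ ≫= hriL
      rw [reassoc_of% hir'] at this
      rw [← cancel_mono N₁.right.inv]
      simpa [N] using this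
    · simp [N, reassoc_of% hri0, hA]
    · simp [N, reassoc_of% hriL, hY']
    · rw [← pull_comp, hiY.dLast, pull_comp, ← hδ, push_pull]
    · rw [← pull_comp, hrY.dLast, pull_comp, ← hδ', push_pull]

end Retract

end NExang

end

set_option linter.unusedSectionVars false

noncomputable section

namespace NExang

open NComplex ExtensionStructure

/-! ### Mapping cones and cocones in the idempotent completion -/

section Karoubi

variable {𝒞 : Type u} [Category.{v} 𝒞] [Preadditive 𝒞] {n : ℕ} {S : ExtensionStructure.{w} 𝒞 n}

lemma karoubiE_additive (hE : S.E.Additive) : (karoubiE S.E).Additive where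
  map_add {P Q} c d := by
    ext R δ
    refine Subtype.ext ?_
    change pull S.E (c.unop.f + d.unop.f) (underlying S.E δ) =
      pull S.E c.unop.f (underlying S.E δ) + pull S.E d.unop.f (underlying S.E δ)
    simp [pull]

lemma karoubiE_obj_additive (hE : ∀ C : 𝒞ᵒᵖ, (S.E.obj C).Additive) (Q : (Karoubi 𝒞)ᵒᵖ) :
    ((karoubiE S.E).obj Q).Additive where
  map_add {P P'} a b := by
    ext δ
    refine Subtype.ext ?_
    have := hE (op Q.unop.X)
    change push S.E (a.f + b.f) (underlying S.E δ) =
      push S.E a.f (underlying S.E δ) + push S.E b.f (underlying S.E δ)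
    simp [push]

variable [HasFiniteBiproducts 𝒞]

/-- The axiom must hold for the given complexes, not merely up to homotopy, so both are presented as
strict direct factors of complexes of `𝒞`. The cone that `𝒞` provides for the latter is then cut
down. -/
lemma ExtensionStructure.IsNExangulated.exists_cone_karoubi (hS : S.IsNExangulated)
    [HasZeroObject (Karoubi 𝒞)] {A C D : Karoubi 𝒞} (δ : Ext S.karoubi.E D A) (c : C ⟶ D)
    (Y : NComplex n A C) (X : NComplex n A D)
    (hY : S.karoubi.Realises (pull S.karoubi.E c δ) Y) (hX : S.karoubi.Realises δ X) :
    ∃ f : Y.K ⟶ X.K, Y.IsLift X f (𝟙 A) c ∧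
      ∃ M : NComplex n (Y.K.X 1) D, Nonempty (MappingCone f M) ∧
        S.karoubi.Realises (push S.karoubi.E Y.dFirst δ) M := by
  obtain ⟨p⟩ := hS.exists_presentation hY
  obtain ⟨q⟩ := hS.exists_presentation hX
  obtain ⟨f, hf, M, ⟨m⟩, hM⟩ := hS.exists_cone (underlying S.E δ) c.f p.X q.X p.realises q.realises
  refine hS.isRealisation_karoubi.exists_cone_of_retract (karoubiE_additive hS.additive_fst)
    (karoubiE_obj_additive hS.additive_snd) (δ₀ := ofExt (underlying S.E δ))
    (c₀ := (toKaroubi 𝒞).map c.f)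
    (realises_map_toKaroubi p.realises) (realises_map_toKaroubi q.realises) (hf.map (toKaroubi 𝒞))
    (m.map (toKaroubi 𝒞)) ?_ p.isLift_i p.isLift_r q.isLift_i q.isLift_r p.i_r q.i_r
    (karι_karπ A) (karι_karπ D) ?_ ?_ (push_karι δ) (push_karπ δ) ?_
  · exact (congrArg (fun a => S.karoubi.Realises (push S.karoubi.E a (ofExt (underlying S.E δ)))
      (M.map (toKaroubi 𝒞))) (p.X.map_dFirst (toKaroubi 𝒞))).mpr (realises_map_toKaroubi hM)
  · ext
    simp
  · ext
    simp
  · refine underlying_injective ?_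
    change push S.E (A.p ≫ A.p) (underlying S.E δ) = underlying S.E δ
    rw [A.idem]
    exact push_p_underlying δ

lemma ExtensionStructure.IsNExangulated.exists_cocone_karoubi (hS : S.IsNExangulated)
    [HasZeroObject (Karoubi 𝒞)] {A B C : Karoubi 𝒞} (δ : Ext S.karoubi.E C A) (a : A ⟶ B)
    (X : NComplex n A C) (Y : NComplex n B C)
    (hX : S.karoubi.Realises δ X) (hY : S.karoubi.Realises (push S.karoubi.E a δ) Y) :
    ∃ f : X.K ⟶ Y.K, X.IsLift Y f a (𝟙 C) ∧
      ∃ N : NComplex n A (Y.K.X (Fin.last n).castSucc), Nonempty (MappingCocone f N) ∧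
        S.karoubi.Realises (pull S.karoubi.E Y.dLast δ) N := by
  obtain ⟨p⟩ := hS.exists_presentation hX
  obtain ⟨q⟩ := hS.exists_presentation hY
  obtain ⟨f, hf, N, ⟨m⟩, hN⟩ :=
    hS.exists_cocone (underlying S.E δ) a.f p.X q.X p.realises q.realises
  refine hS.isRealisation_karoubi.exists_cocone_of_retract (karoubiE_additive hS.additive_fst)
    (karoubiE_obj_additive hS.additive_snd) (δ₀ := ofExt (underlying S.E δ))
    (a₀ := (toKaroubi 𝒞).map a.f)
    (realises_map_toKaroubi p.realises) (realises_map_toKaroubi q.realises) (hf.map (toKaroubi 𝒞))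
    (m.map (toKaroubi 𝒞)) ?_ p.isLift_i p.isLift_r q.isLift_i q.isLift_r p.i_r q.i_r
    (karι_karπ A) (karι_karπ C) ?_ ?_ (push_karι δ) (push_karπ δ) ?_
  · exact (congrArg (fun a => S.karoubi.Realises (pull S.karoubi.E a (ofExt (underlying S.E δ)))
      (N.map (toKaroubi 𝒞))) (q.X.map_dLast (toKaroubi 𝒞))).mpr (realises_map_toKaroubi hN)
  · ext
    simp
  · ext
    simp
  · refine underlying_injective ?_
    change pull S.E (C.p ≫ C.p) (underlying S.E δ) = underlying S.E δ
    rw [C.idem]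
    exact pull_p_underlying δ

end Karoubi

end NExang

end

set_option linter.unusedSectionVars false

noncomputable section

namespace NExang

open NComplex ExtensionStructure

/-! ### Splitting off contractible summands, and recognising inflations and deflations -/

variable {𝒞 : Type u} [Category.{v} 𝒞] [Preadditive 𝒞] {n : ℕ} {S : ExtensionStructure.{w} 𝒞 n}

/-- Axiom (EA2). -/
def ExtensionStructure.HasMappingCones (S : ExtensionStructure.{w} 𝒞 n) : Prop :=
  ∀ {A C D : 𝒞} (δ : Ext S.E D A) (c : C ⟶ D) (Y : NComplex n A C) (X : NComplex n A D),
    S.Realises (pull S.E c δ) Y → S.Realises δ X →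
    ∃ f : Y.K ⟶ X.K, Y.IsLift X f (𝟙 A) c ∧
      ∃ M : NComplex n (Y.K.X 1) D, Nonempty (MappingCone f M) ∧
        S.Realises (push S.E Y.dFirst δ) M

/-- The dual of (EA2). -/
def ExtensionStructure.HasMappingCocones (S : ExtensionStructure.{w} 𝒞 n) : Prop :=
  ∀ {A B C : 𝒞} (δ : Ext S.E C A) (a : A ⟶ B) (X : NComplex n A C) (Y : NComplex n B C),
    S.Realises δ X → S.Realises (push S.E a δ) Y →
    ∃ f : X.K ⟶ Y.K, X.IsLift Y f a (𝟙 C) ∧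
      ∃ N : NComplex n A (Y.K.X (Fin.last n).castSucc), Nonempty (MappingCocone f N) ∧
        S.Realises (pull S.E Y.dLast δ) N

/-- The kernel of the retraction `r` is the image of `1 - r ≫ s`. -/
lemma IsWeaklyIdempotentComplete.exists_complement (hW : IsWeaklyIdempotentComplete 𝒞) {X Y : 𝒞}
    (r : X ⟶ Y) (s : Y ⟶ X) (h : s ≫ r = 𝟙 Y) :
    ∃ (T : 𝒞) (i : T ⟶ X) (p : X ⟶ T), i ≫ p = 𝟙 T ∧ p ≫ i = 𝟙 X - r ≫ s := by
  have := hW r ⟨⟨⟨s, h⟩⟩⟩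
  have h1 : (𝟙 X - r ≫ s) ≫ r = 0 := by simp [h]
  refine ⟨kernel r, kernel.ι r, kernel.lift r (𝟙 X - r ≫ s) h1, ?_, kernel.lift_ι _ _ _⟩
  rw [← cancel_mono (kernel.ι r)]
  simp

variable [HasZeroObject 𝒞]

/-- If the contractible complex reaches the last degree, its map there passes through the last
differential, which annihilates the extension. Hence splitting it off does not change the extension.
-/
lemma fromDbl_last_right {A C : 𝒞} (X : NComplex n A C) {i j : Fin (n + 2)}
    (hij : (nShape n).Rel i j) {T : 𝒞} (ψ : T ⟶ X.K.X i) :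
    ∃ t, (fromDbl hij (nShape_ne hij) ψ).f (Fin.last (n + 1)) ≫ X.right.hom = t ≫ X.dLast := by
  by_cases hj : Fin.last (n + 1) = j
  · subst hj
    obtain rfl := (nShape n).prev_eq hij nShape_rel_last
    refine ⟨(HomologicalComplex.doubleXIso₁ (𝟙 T) hij (nShape_ne hij)).hom ≫ ψ, ?_⟩
    simp [NComplex.dLast]
  · refine ⟨0, ?_⟩
    rw [(HomologicalComplex.isZero_double_X (𝟙 T) hij _ (by
      rintro rfl
      exact nShape_not_last_rel _ hij) hj).eq_of_src ((fromDbl hij (nShape_ne hij) ψ).f _) 0]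
    simp

lemma left_toDbl_zero {A C : 𝒞} (X : NComplex n A C) {i j : Fin (n + 2)}
    (hij : (nShape n).Rel i j) {T : 𝒞} (φ : X.K.X j ⟶ T) :
    ∃ t, X.left.inv ≫ (toDbl hij (nShape_ne hij) φ).f 0 = X.dFirst ≫ t := by
  by_cases hi : 0 = i
  · subst hi
    obtain rfl := nShape_rel_zero hij
    refine ⟨φ ≫ (HomologicalComplex.doubleXIso₀ (𝟙 T) hij).inv, ?_⟩
    simp [NComplex.dFirst]
  · refine ⟨0, ?_⟩
    rw [(HomologicalComplex.isZero_double_X (𝟙 T) hij _ hi (by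
      rintro rfl
      exact nShape_not_rel_zero _ hij)).eq_of_tgt ((toDbl hij (nShape_ne hij) φ).f _) 0]
    simp

/-- A contractible direct summand of a complex realising an extension can be split off in a weakly
idempotent complete category. -/
lemma ExtensionStructure.IsExangle.exists_complement (hE : S.E.Additive)
    (hE' : ∀ C : 𝒞ᵒᵖ, (S.E.obj C).Additive) (hW : IsWeaklyIdempotentComplete 𝒞)
    {A C : 𝒞} {δ : Ext S.E C A} {X : NComplex n A C} (hX : S.IsExangle δ X) {i j : Fin (n + 2)}
    (hij : (nShape n).Rel i j) {T : 𝒞} (φ : X.K.X j ⟶ T) (ψ : T ⟶ X.K.X i)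
    (h : ψ ≫ X.K.d i j ≫ φ = 𝟙 T) :
    ∃ (L : HomologicalComplex 𝒞 (nShape n)) (ι : L ⟶ X.K) (r : X.K ⟶ L), ι ≫ r = 𝟙 L ∧
      r ≫ ι = 𝟙 X.K - toDbl hij (nShape_ne hij) φ ≫ fromDbl hij (nShape_ne hij) ψ ∧
      push S.E (X.left.inv ≫ (r.f 0 ≫ ι.f 0) ≫ X.left.hom) δ = δ ∧
      pull S.E (X.right.inv ≫ (r.f (Fin.last (n + 1)) ≫ ι.f (Fin.last (n + 1))) ≫ X.right.hom) δ
        = δ := by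
  set α := toDbl hij (nShape_ne hij) φ with hα
  set β := fromDbl hij (nShape_ne hij) ψ with hβ
  have hβα : β ≫ α = 𝟙 _ := by
    apply HomologicalComplex.from_double_hom_ext
    · simp [α, β, reassoc_of% h]
    · simp [α, β, reassoc_of% h]
  -- The idempotent removed is degreewise a retraction followed by its section, so weak idempotent
  -- completeness provides its complement; arbitrary idempotents need not split.
  obtain ⟨L, ι, r, hir, hri, -⟩ := exists_splitting (𝟙 X.K - α ≫ β) ⊤ (fun k => by
    obtain ⟨T, i, p, h1, h2⟩ := hW.exists_complement (α.f k) (β.f k)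
      (HomologicalComplex.congr_hom hβα k)
    exact ⟨T, i, p, trivial, h1, by simp [h2]⟩)
  have hri' (k) : r.f k ≫ ι.f k = 𝟙 _ - α.f k ≫ β.f k := by
    simpa using HomologicalComplex.congr_hom hri k
  refine ⟨L, ι, r, hir, hri, ?_, ?_⟩
  · obtain ⟨t, ht⟩ := left_toDbl_zero X hij φ
    have h1 : push S.E (X.dFirst ≫ t ≫ β.f 0 ≫ X.left.hom) δ = 0 := by
      rw [push_comp, hX.push_dFirst, map_zero]
    have := hE' (op C)
    rw [hri']
    simp only [Preadditive.sub_comp, Preadditive.comp_sub, Category.id_comp, Category.assoc,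
      Iso.inv_hom_id]
    rw [hα, reassoc_of% ht]
    have h3 : push S.E (𝟙 A - X.dFirst ≫ t ≫ β.f 0 ≫ X.left.hom) δ =
      push S.E (𝟙 A) δ - push S.E (X.dFirst ≫ t ≫ β.f 0 ≫ X.left.hom) δ := by
      simp [push]
    rw [h3, h1, push_id, sub_zero]
  · obtain ⟨t, ht⟩ := fromDbl_last_right X hij ψ
    have h1 : pull S.E (X.right.inv ≫ α.f _ ≫ t ≫ X.dLast) δ = 0 := by
      rw [← Category.assoc, ← Category.assoc, pull_comp, hX.pull_dLast, map_zero]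
    rw [hri']
    simp only [Preadditive.sub_comp, Preadditive.comp_sub, Category.id_comp, Category.assoc,
      Iso.inv_hom_id]
    rw [hβ, ht]
    have h3 : pull S.E (𝟙 C - X.right.inv ≫ α.f _ ≫ t ≫ X.dLast) δ =
      pull S.E (𝟙 C) δ - pull S.E (X.right.inv ≫ α.f _ ≫ t ≫ X.dLast) δ := by
      simp [pull, op_sub]
    rw [h3, h1, pull_id, sub_zero]

/-- In the weakly idempotent complete case, `u` is an inflation if some composite `u ≫ φ` is. -/
lemma ExtensionStructure.IsRealisation.isInflation_of_comp (hS : S.IsRealisation)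
    (hE : S.E.Additive) (hE' : ∀ C : 𝒞ᵒᵖ, (S.E.obj C).Additive)
    (hW : IsWeaklyIdempotentComplete 𝒞) (hco : S.HasMappingCocones) {A V D : 𝒞} {θ : Ext S.E V A}
    {W : NComplex n A V} (hWθ : S.Realises θ W) {u : A ⟶ D} {φ : D ⟶ W.K.X 1}
    (h : u ≫ φ = W.dFirst) : S.IsInflation u := by
  -- The cocone `N` of a lift of `u` has `N₁ = D ⊕ W₁` and first differential with entries `u` and
  -- `W.dFirst`. The plan is to discard the summand `W₁`.
  obtain ⟨Y, hY⟩ := hS.exists_realises (push S.E u θ)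
  obtain ⟨f, hf, N, ⟨m⟩, hN⟩ := hco θ u W Y hWθ hY
  have h1 := (last_ne_one hS.one_le).symm
  let b := m.biprod nShape_rel_zero_one h1
  have hfst : N.dFirst ≫ b.fst = u ≫ Y.left.inv := by
    rw [m.first_fst, hf.f_zero]
    simp
  have hsnd : N.dFirst ≫ b.snd = W.dFirst := m.first_snd _ _
  obtain ⟨k, hk⟩ := nShape_exists_next (n := n) 1 h1
  -- As `W.dFirst = u ≫ φ`, this sheared projection kills the first differential, hence factors
  -- through the next one. It still retracts the inclusion of `W₁`, so `W₁` sits in degrees `1, 2`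
  -- as a contractible summand.
  let σ : N.K.X 1 ⟶ W.K.X 1 := b.snd - b.fst ≫ Y.left.hom ≫ φ
  have hσ : N.K.d 0 1 ≫ σ = 0 := by
    rw [← cancel_epi N.left.inv]
    have : N.dFirst ≫ σ = 0 := by simp [σ, hsnd, reassoc_of% hfst, h]
    simpa [NComplex.dFirst] using this
  have hNE := hS.isExangle _ _ hN
  obtain ⟨s, hs⟩ := hNE.exact_hom_to nShape_rel_zero_one hk σ hσ
  obtain ⟨L, ι, r, hir, hri, h2, h3⟩ := hNE.exists_complement hE hE' hW hk s b.inr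
    (by simp [hs, σ])
  have hir' (k) : ι.f k ≫ r.f k = 𝟙 _ := HomologicalComplex.congr_hom hir k
  have hri0 : r.f 0 ≫ ι.f 0 = 𝟙 _ := by
    refine (HomologicalComplex.congr_hom hri 0).trans ?_
    rw [HomologicalComplex.sub_f_apply, dbl_comp_f_eq_zero _ _ zero_ne_one (by
      rintro rfl
      exact nShape_not_rel_zero _ hk), sub_zero, HomologicalComplex.id_f]
  have hri1 : r.f 1 ≫ ι.f 1 = 𝟙 _ - σ ≫ b.inr := by
    refine (HomologicalComplex.congr_hom hri 1).trans ?_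
    simp [reassoc_of% hs]
  -- Both `D` and the first term of the complement `L` are images of the idempotent `1 - σ ≫ b.inr`,
  -- so they are isomorphic, and `u` becomes the first differential of `L`.
  have hb : (b.fst ≫ Y.left.hom) ≫ (Y.left.inv ≫ b.inl + φ ≫ b.inr) = 𝟙 _ - σ ≫ b.inr := by
    rw [← b.total]
    simp [σ]
    abel
  have hb' : (Y.left.inv ≫ b.inl + φ ≫ b.inr) ≫ (b.fst ≫ Y.left.hom) = 𝟙 _ := by
    simp
  have hri1' := hri1.trans hb.symm
  simp only [Category.assoc] at hri1'
  -- The last term is taken from `L` rather than from `N`: for `n = 1` the contractible summand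
  -- reaches the last degree and changes it.
  let Z : NComplex n A (L.X (Fin.last (n + 1))) :=
    { K := L
      left :=
        { hom := ι.f 0 ≫ N.left.hom
          inv := N.left.inv ≫ r.f 0
          hom_inv_id := by simp [hir']
          inv_hom_id := by simp [reassoc_of% hri0] }
      right := Iso.refl _ }
  have hZ : S.Realises (pull S.E (ι.f _ ≫ N.right.hom) (pull S.E Y.dLast θ)) Z := by
    refine hS.realises_of_retract hN ι r (a := 𝟙 _) (a' := 𝟙 _) (c := ι.f _ ≫ N.right.hom)
      (c' := N.right.inv ≫ r.f _) ⟨by simp [Z], by simp [Z]⟩ ⟨by simp [Z, reassoc_of% hri0],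
        by simp [Z]⟩ hir (by simp) (by simp [hir']) (by rw [push_id]) ?_
    rw [push_id, ← pull_comp]
    simpa using h3.symm
  refine ⟨_, _, Z, ⟨ι.f 1 ≫ b.fst ≫ Y.left.hom, (Y.left.inv ≫ b.inl + φ ≫ b.inr) ≫ r.f 1,
    ?_, ?_⟩, hZ, ?_⟩
  · have := ι.f 1 ≫= hri1' =≫ r.f 1
    simp only [Category.assoc, hir', Category.comp_id] at this ⊢
    exact this.symm
  · simp only [Category.assoc, reassoc_of% hri1'] at hb' ⊢
    rw [reassoc_of% hb', hb']
  · have hZd : Z.dFirst = N.dFirst ≫ r.f 1 := by simp [Z, NComplex.dFirst]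
    simp only [hZd, Category.assoc, reassoc_of% hri1', reassoc_of% hfst]
    simp

/-- In the weakly idempotent complete case, `u` is a deflation if some composite `φ ≫ u` is. -/
lemma ExtensionStructure.IsRealisation.isDeflation_of_comp (hS : S.IsRealisation)
    (hE : S.E.Additive) (hE' : ∀ C : 𝒞ᵒᵖ, (S.E.obj C).Additive)
    (hW : IsWeaklyIdempotentComplete 𝒞) (hco : S.HasMappingCones) {C V D : 𝒞} {θ : Ext S.E C V}
    {W : NComplex n V C} (hWθ : S.Realises θ W) {u : D ⟶ C}
    {φ : W.K.X (Fin.last n).castSucc ⟶ D} (h : φ ≫ u = W.dLast) : S.IsDeflation u := by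
  obtain ⟨Y, hY⟩ := hS.exists_realises (pull S.E u θ)
  obtain ⟨f, hf, M, ⟨m⟩, hM⟩ := hco θ u Y W hY hWθ
  have h1 := castSucc_last_ne_zero hS.one_le
  let b := m.biprod nShape_rel_last h1
  have hinl : b.inl ≫ M.dLast = Y.right.hom ≫ u := by
    rw [m.inl_last, hf.right]
  have hinr : b.inr ≫ M.dLast = W.dLast := m.inr_last _ _
  obtain ⟨k, hk⟩ := nShape_exists_prev (n := n) _ h1
  -- Dually, `Mₙ = D ⊕ Wₙ`, and this sheared inclusion of `Wₙ` is killed by the last differential.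
  -- It therefore lifts along the preceding one, and `Wₙ` splits off in degrees `n - 1, n`.
  let σ : W.K.X (Fin.last n).castSucc ⟶ M.K.X (Fin.last n).castSucc :=
    b.inr - φ ≫ Y.right.inv ≫ b.inl
  have hσ : σ ≫ M.K.d _ (Fin.last (n + 1)) = 0 := by
    rw [← cancel_mono M.right.hom]
    have : σ ≫ M.dLast = 0 := by simp [σ, hinr, hinl, h]
    simpa [NComplex.dLast] using this
  have hME := hS.isExangle _ _ hM
  obtain ⟨s, hs⟩ := hME.exact_hom_from hk nShape_rel_last σ hσ
  obtain ⟨L, ι, r, hir, hri, h2, h3⟩ := hME.exists_complement hE hE' hW hk b.snd s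
    (by simp [reassoc_of% hs, σ])
  have hir' (k) : ι.f k ≫ r.f k = 𝟙 _ := HomologicalComplex.congr_hom hir k
  have hriL : r.f (Fin.last (n + 1)) ≫ ι.f (Fin.last (n + 1)) = 𝟙 _ := by
    refine (HomologicalComplex.congr_hom hri _).trans ?_
    rw [HomologicalComplex.sub_f_apply, dbl_comp_f_eq_zero _ _ (by
      rintro rfl
      exact nShape_not_last_rel _ hk) castSucc_last_ne_last.symm, sub_zero,
      HomologicalComplex.id_f]
  have hri1 : r.f (Fin.last n).castSucc ≫ ι.f (Fin.last n).castSucc = 𝟙 _ - b.snd ≫ σ := by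
    refine (HomologicalComplex.congr_hom hri _).trans ?_
    simp [hs]
  have hb : (b.fst ≫ Y.right.hom + b.snd ≫ φ) ≫ (Y.right.inv ≫ b.inl) = 𝟙 _ - b.snd ≫ σ := by
    rw [← b.total]
    simp [σ]
    abel
  have hb' : (Y.right.inv ≫ b.inl) ≫ (b.fst ≫ Y.right.hom + b.snd ≫ φ) = 𝟙 _ := by
    simp
  have hri1' := hri1.trans hb.symm
  let Z : NComplex n (L.X 0) C :=
    { K := L
      left := Iso.refl _
      right :=
        { hom := ι.f _ ≫ M.right.hom
          inv := M.right.inv ≫ r.f _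
          hom_inv_id := by simp [hir']
          inv_hom_id := by simp [reassoc_of% hriL] } }
  have hZ : S.Realises (push S.E (M.left.inv ≫ r.f 0) (push S.E Y.dFirst θ)) Z := by
    refine hS.realises_of_retract hM ι r (c := 𝟙 _) (c' := 𝟙 _) (a := ι.f _ ≫ M.left.hom)
      (a' := M.left.inv ≫ r.f _) ⟨by simp [Z], by simp [Z]⟩ ⟨by simp [Z],
        by simp [Z, reassoc_of% hriL]⟩ hir (by simp [hir']) (by simp) ?_ (by rw [pull_id])
    rw [pull_id, ← push_comp]
    simpa using h2
  have hb2 : (Y.right.inv ≫ b.inl) ≫ r.f _ ≫ ι.f _ = Y.right.inv ≫ b.inl := by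
    rw [hri1', ← Category.assoc, hb', Category.id_comp]
  simp only [Category.assoc] at hb2
  refine ⟨_, _, Z, ⟨ι.f _ ≫ (b.fst ≫ Y.right.hom + b.snd ≫ φ), (Y.right.inv ≫ b.inl) ≫ r.f _,
    ?_, ?_⟩, hZ, ?_⟩
  · have := ι.f _ ≫= hri1' =≫ r.f _
    simp only [Category.assoc, hir', Category.comp_id] at this ⊢
    exact this.symm
  · simp only [Category.assoc, reassoc_of% hb2] at hb' ⊢
    exact hb'
  · have hZd : Z.dLast = ι.f _ ≫ M.dLast := by simp [Z, NComplex.dLast]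
    simp only [hZd, Category.assoc, reassoc_of% hb2, hinl]
    simp

end NExang

end

set_option linter.unusedSectionVars false

noncomputable section

namespace NExang

open NComplex ExtensionStructure

section

variable {𝒞 : Type u} [Category.{v} 𝒞] [Preadditive 𝒞]

lemma hasKernel_of_complement {X Y T : 𝒞} (r : X ⟶ Y) (s : Y ⟶ X) (h : s ≫ r = 𝟙 Y) (i : T ⟶ X)
    (p : X ⟶ T) (hi : i ≫ p = 𝟙 T) (hp : p ≫ i = 𝟙 X - r ≫ s) : HasKernel r := by
  have h0 : i ≫ r = 0 := by
    have : (p ≫ i) ≫ r = 0 := by simp [hp, h]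
    rw [← Category.id_comp i, ← hi, Category.assoc, Category.assoc, ← Category.assoc p, this,
      comp_zero]
  exact HasLimit.mk ⟨KernelFork.ofι i h0, KernelFork.IsLimit.ofι i h0
    (fun k _ => k ≫ p) (fun k hk => by simp [hp, reassoc_of% hk])
    (fun k _ b hb => by rw [← hb, Category.assoc, hi, Category.comp_id])⟩

lemma IsWeaklyIdempotentComplete.of_isIdempotentComplete [IsIdempotentComplete 𝒞] :
    IsWeaklyIdempotentComplete 𝒞 := by
  rintro X Y r ⟨⟨s, h⟩⟩
  obtain ⟨T, i, p, hi, hp⟩ := IsIdempotentComplete.idempotents_split X (𝟙 X - r ≫ s)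
    (by simp [reassoc_of% h])
  exact hasKernel_of_complement r s h i p hi hp

end

/-! ### Composites of inflations and deflations; the idempotent completion is `n`-exangulated -/

section Karoubi

variable {𝒞 : Type u} [Category.{v} 𝒞] [Preadditive 𝒞] {n : ℕ} {S : ExtensionStructure.{w} 𝒞 n}

variable [HasFiniteBiproducts 𝒞]

/-- Up to postcomposition, composites of inflations between formal direct factors realise
extensions by objects of `𝒞`. -/
lemma ExtensionStructure.IsNExangulated.exists_comp_inflations (hS : S.IsNExangulated)
    {A B D : Karoubi 𝒞} {f : A ⟶ B} {g : B ⟶ D} (hf : S.karoubi.IsInflation f)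
    (hg : S.karoubi.IsInflation g) :
    ∃ (V : 𝒞) (θ : Ext S.karoubi.E ((toKaroubi 𝒞).obj V) A), ∀ W, S.karoubi.Realises θ W →
      ∃ φ : D ⟶ W.K.X 1, (f ≫ g) ≫ φ = W.dFirst := by
  have hK := hS.isRealisation_karoubi
  obtain ⟨C, δ, X', β, hX', rfl⟩ := hf
  obtain ⟨R, ρ, Y', γ, hY', rfl⟩ := hg
  obtain ⟨X, hX⟩ := hS.isRealisation.exists_realises (underlying S.E δ)
  obtain ⟨i, hi⟩ := hK.exists_lift δ (ofExt (underlying S.E δ)) (karι A) (karι C) (push_karι δ)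
    X' _ hX' (realises_map_toKaroubi hX)
  let i₁ : X'.K.X 1 ⟶ (toKaroubi 𝒞).obj (X.K.X 1) := i.f 1
  have hi₁ : X'.dFirst ≫ i₁ = karι A ≫ (toKaroubi 𝒞).map X.dFirst :=
    hi.dFirst.trans (congrArg (karι A ≫ ·) (X.map_dFirst (toKaroubi 𝒞)))
  -- The first inflation maps to the inflation `X.dFirst` of `𝒞`. Pushing `ρ` to `X₁` makes the
  -- second one start at an object of `𝒞`, so that (EA1) in `𝒞` applies to the two comparison
  -- inflations.
  let ρ' : Ext (karoubiE S.E) R ((toKaroubi 𝒞).obj (X.K.X 1)) := push S.karoubi.E (β.inv ≫ i₁) ρ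
  obtain ⟨Y, hY⟩ := hS.isRealisation.exists_realises (A := X.K.X 1) (underlying S.E ρ')
  obtain ⟨j, hj⟩ := hK.exists_lift ρ (ofExt (underlying S.E ρ'))
    ((β.inv ≫ i₁) ≫ karι ((toKaroubi 𝒞).obj (X.K.X 1))) (karι R)
    ((push_comp _ _ _ _).trans (push_karι ρ')) Y' _ hY' (realises_map_toKaroubi hY)
  let j₁ : Y'.K.X 1 ⟶ (toKaroubi 𝒞).obj (Y.K.X 1) := j.f 1
  have hk : karι ((toKaroubi 𝒞).obj (X.K.X 1)) = 𝟙 _ := rfl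
  have hj₁ : Y'.dFirst ≫ j₁ = (β.inv ≫ i₁) ≫ (toKaroubi 𝒞).map Y.dFirst := by
    refine hj.dFirst.trans ?_
    rw [hk, Category.comp_id]
    exact congrArg ((β.inv ≫ i₁) ≫ ·) (Y.map_dFirst (toKaroubi 𝒞))
  obtain ⟨V, θ, W₀, ω, hW₀, hω⟩ := hS.inflation_comp X.dFirst Y.dFirst
    ⟨_, _, X, Iso.refl _, hX, Category.comp_id _⟩ ⟨_, _, Y, Iso.refl _, hY, Category.comp_id _⟩
  -- The composite inflation of `𝒞` starts at `A.X`; projecting its extension to the factor `A`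
  -- leaves the end `V` in `𝒞`.
  refine ⟨V, push S.karoubi.E (karπ A) (ofExt θ), fun W hW => ?_⟩
  obtain ⟨w, hw⟩ := hK.exists_lift (ofExt θ) (push S.karoubi.E (karπ A) (ofExt θ)) (karπ A) (𝟙 _)
    (pull_id _ _).symm _ W (realises_map_toKaroubi hW₀) hW
  let w₁ : (toKaroubi 𝒞).obj (W₀.K.X 1) ⟶ W.K.X 1 := w.f 1
  have hw₁ : (toKaroubi 𝒞).map W₀.dFirst ≫ w₁ = karπ A ≫ W.dFirst :=
    (congrArg (· ≫ w₁) (W₀.map_dFirst (toKaroubi 𝒞)).symm).trans hw.dFirst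
  refine ⟨γ.inv ≫ j₁ ≫ (toKaroubi 𝒞).map ω.inv ≫ w₁, ?_⟩
  have h1 : (toKaroubi 𝒞).map X.dFirst ≫ (toKaroubi 𝒞).map Y.dFirst ≫ (toKaroubi 𝒞).map ω.inv =
      (toKaroubi 𝒞).map W₀.dFirst := by
    rw [← Functor.map_comp, ← Functor.map_comp, ← Category.assoc, ← hω, Category.assoc,
      Iso.hom_inv_id, Category.comp_id]
  simp only [Category.assoc, Iso.hom_inv_id_assoc, reassoc_of% hj₁, reassoc_of% hi₁,
    reassoc_of% h1, hw₁, karι_karπ_assoc]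

/-- Up to precomposition, composites of deflations between formal direct factors realise
extensions of objects of `𝒞`. -/
lemma ExtensionStructure.IsNExangulated.exists_comp_deflations (hS : S.IsNExangulated)
    {A B C : Karoubi 𝒞} {f : A ⟶ B} {g : B ⟶ C} (hf : S.karoubi.IsDeflation f)
    (hg : S.karoubi.IsDeflation g) :
    ∃ (V : 𝒞) (θ : Ext S.karoubi.E C ((toKaroubi 𝒞).obj V)), ∀ W, S.karoubi.Realises θ W →
      ∃ φ : W.K.X (Fin.last n).castSucc ⟶ A, φ ≫ f ≫ g = W.dLast := by
  have hK := hS.isRealisation_karoubi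
  obtain ⟨D, δ, X', β, hX', rfl⟩ := hg
  obtain ⟨R, ρ, Y', γ, hY', rfl⟩ := hf
  obtain ⟨X, hX⟩ := hS.isRealisation.exists_realises (underlying S.E δ)
  obtain ⟨i, hi⟩ := hK.exists_lift (ofExt (underlying S.E δ)) δ (karπ D) (karπ C) (push_karπ δ)
    _ X' (realises_map_toKaroubi hX) hX'
  let i₁ : (toKaroubi 𝒞).obj (X.K.X (Fin.last n).castSucc) ⟶ X'.K.X (Fin.last n).castSucc := i.f _
  have hi₁ : i₁ ≫ X'.dLast = (toKaroubi 𝒞).map X.dLast ≫ karπ C :=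
    hi.dLast.trans (congrArg (· ≫ karπ C) (X.map_dLast (toKaroubi 𝒞)))
  -- Dually, `ρ` is pulled back to the penultimate term of `X`, so that the two comparison
  -- deflations compose in `𝒞`.
  let ρ' : Ext (karoubiE S.E) ((toKaroubi 𝒞).obj (X.K.X (Fin.last n).castSucc)) R :=
    pull S.karoubi.E (i₁ ≫ β.hom) ρ
  obtain ⟨Y, hY⟩ := hS.isRealisation.exists_realises (C := X.K.X (Fin.last n).castSucc)
    (underlying S.E ρ')
  obtain ⟨j, hj⟩ := hK.exists_lift (ofExt (underlying S.E ρ')) ρ (karπ R)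
    (karπ ((toKaroubi 𝒞).obj (X.K.X (Fin.last n).castSucc)) ≫ i₁ ≫ β.hom)
    ((push_karπ ρ').trans (pull_comp _ _ _ _).symm) _ Y' (realises_map_toKaroubi hY) hY'
  let j₁ : (toKaroubi 𝒞).obj (Y.K.X (Fin.last n).castSucc) ⟶ Y'.K.X (Fin.last n).castSucc := j.f _
  have hk : karπ ((toKaroubi 𝒞).obj (X.K.X (Fin.last n).castSucc)) = 𝟙 _ := rfl
  have hj₁ : j₁ ≫ Y'.dLast = (toKaroubi 𝒞).map Y.dLast ≫ i₁ ≫ β.hom := by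
    refine hj.dLast.trans ?_
    rw [hk, Category.id_comp]
    exact congrArg (· ≫ i₁ ≫ β.hom) (Y.map_dLast (toKaroubi 𝒞))
  obtain ⟨V, θ, W₀, ω, hW₀, hω⟩ := hS.deflation_comp Y.dLast X.dLast
    ⟨_, _, Y, Iso.refl _, hY, Category.id_comp _⟩ ⟨_, _, X, Iso.refl _, hX, Category.id_comp _⟩
  refine ⟨V, pull S.karoubi.E (karι C) (ofExt θ), fun W hW => ?_⟩
  obtain ⟨w, hw⟩ := hK.exists_lift (pull S.karoubi.E (karι C) (ofExt θ)) (ofExt θ) (𝟙 _) (karι C)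
    (push_id _ _) W _ hW (realises_map_toKaroubi hW₀)
  let w₁ : W.K.X (Fin.last n).castSucc ⟶ (toKaroubi 𝒞).obj (W₀.K.X (Fin.last n).castSucc) := w.f _
  have hw₁ : w₁ ≫ (toKaroubi 𝒞).map W₀.dLast = W.dLast ≫ karι C :=
    (congrArg (w₁ ≫ ·) (W₀.map_dLast (toKaroubi 𝒞)).symm).trans hw.dLast
  refine ⟨w₁ ≫ (toKaroubi 𝒞).map ω.hom ≫ j₁ ≫ γ.hom, ?_⟩
  have h1 : (toKaroubi 𝒞).map ω.hom ≫ (toKaroubi 𝒞).map Y.dLast ≫ (toKaroubi 𝒞).map X.dLast =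
      (toKaroubi 𝒞).map W₀.dLast := by
    rw [← Functor.map_comp, ← hω, ← Functor.map_comp, Iso.hom_inv_id_assoc]
  simp only [Category.assoc, Iso.hom_inv_id_assoc, reassoc_of% hj₁, hi₁,
    reassoc_of% h1, reassoc_of% hw₁, karι_karπ, Category.comp_id]

/-- Only (EA1) needs assembling here: the composite becomes a realising differential after a further
morphism, and the recognition criterion, available by idempotent completeness, removes that
morphism. -/
lemma ExtensionStructure.IsNExangulated.karoubi (hS : S.IsNExangulated) :
    S.karoubi.IsNExangulated := by
  have := Karoubi.karoubi_hasFiniteBiproducts (C := 𝒞)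
  have : HasZeroObject (Karoubi 𝒞) := hasZeroObject_of_hasFiniteBiproducts _
  have hK := hS.isRealisation_karoubi
  have hE := karoubiE_additive hS.additive_fst
  have hE' := karoubiE_obj_additive hS.additive_snd
  have hW : IsWeaklyIdempotentComplete (Karoubi 𝒞) := .of_isIdempotentComplete
  exact
  { one_le := hS.one_le
    additive_fst := hE
    additive_snd := hE'
    isClass := hK.isClass
    exists_lift := hK.exists_lift
    isExangle := hK.isExangle
    realises_trivFirst := hK.realises_trivFirst
    realises_trivLast := hK.realises_trivLast
    inflation_comp := fun f g hf hg => by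
      obtain ⟨V, θ, h⟩ := hS.exists_comp_inflations hf hg
      obtain ⟨W, hWθ⟩ := hK.exists_realises θ
      obtain ⟨φ, hφ⟩ := h W hWθ
      exact hK.isInflation_of_comp hE hE' hW hS.exists_cocone_karoubi hWθ hφ
    deflation_comp := fun f g hf hg => by
      obtain ⟨V, θ, h⟩ := hS.exists_comp_deflations hf hg
      obtain ⟨W, hWθ⟩ := hK.exists_realises θ
      obtain ⟨φ, hφ⟩ := h W hWθ
      exact hK.isDeflation_of_comp hE hE' hW hS.exists_cone_karoubi hWθ hφ
    exists_cone := hS.exists_cone_karoubi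
    exists_cocone := hS.exists_cocone_karoubi }

/-- The lifted idempotent was constructed so that its complement splits in every degree when it does
on the ends. -/
lemma ExtensionStructure.IsNExangulated.exists_realises_weakProp (hS : S.IsNExangulated)
    {P Q : Karoubi 𝒞} (hP : weakProp 𝒞 P) (hQ : weakProp 𝒞 Q) (δ : Ext S.karoubi.E Q P) :
    ∃ X : NComplex n P Q, S.karoubi.Realises δ X ∧ ∀ i, weakProp 𝒞 (X.K.X i) := by
  obtain ⟨X, e, he, hl, hX, h⟩ := hS.exists_karoubiNComplex δ
  exact ⟨karoubiNComplex X e he hl, ⟨X, e, he, hl, hX, HtpyEquiv.refl _⟩, h hP hQ⟩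

lemma ExtensionStructure.IsNExangulated.isExtensionClosed_weakProp (hS : S.IsNExangulated) :
    S.karoubi.IsExtensionClosed (weakProp 𝒞) := fun _ _ hP hQ δ => by
  obtain ⟨X, hX, h⟩ := hS.exists_realises_weakProp hP hQ δ
  exact ⟨X, hX, fun i _ _ => h i⟩

end Karoubi

end NExang

end

set_option linter.unusedSectionVars false

noncomputable section

namespace NExang

open NComplex ExtensionStructure

/-! ### Transport of cones and cocones along isomorphisms -/

section Transport

variable {𝒞 : Type u} [Category.{v} 𝒞] [Preadditive 𝒞] {n : ℕ}

/-- Transport of a biproduct along an isomorphism. -/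
@[simps]
def BiprodData.ofIso {P Q M M' : 𝒞} (b : BiprodData P Q M) (e : M' ≅ M) : BiprodData P Q M' where
  inl := b.inl ≫ e.inv
  inr := b.inr ≫ e.inv
  fst := e.hom ≫ b.fst
  snd := e.hom ≫ b.snd
  inl_fst := by simp
  inl_snd := by simp
  inr_fst := by simp
  inr_snd := by simp
  total := by
    have := e.hom ≫= b.total =≫ e.inv
    simpa using this

variable {A B C D : 𝒞}

lemma hom_d_inv {K L : HomologicalComplex 𝒞 (nShape n)} (e : L ≅ K) (i j : Fin (n + 2)) :
    e.inv.f i ≫ L.d i j ≫ e.hom.f j = K.d i j := by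
  rw [← e.hom.comm, ← HomologicalComplex.comp_f_assoc, e.inv_hom_id, HomologicalComplex.id_f,
    Category.id_comp]

lemma inv_hom_app {K L : HomologicalComplex 𝒞 (nShape n)} (e : L ≅ K) (i : Fin (n + 2)) {T : 𝒞}
    (t : K.X i ⟶ T) : e.inv.f i ≫ e.hom.f i ≫ t = t := by
  rw [← HomologicalComplex.comp_f_assoc, e.inv_hom_id, HomologicalComplex.id_f, Category.id_comp]

variable {X : NComplex n A C} {Y : NComplex n B D} {f : X.K ⟶ Y.K}

/-- Transport of a mapping cone along an isomorphism. -/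
def MappingCone.ofIso {M M' : NComplex n (X.K.X 1) D} (m : MappingCone f M)
    (e : M'.K ≅ M.K) (he : M'.IsLift M e.hom (𝟙 _) (𝟙 _)) : MappingCone f M' where
  biprod {i j} hij hi := (m.biprod hij hi).ofIso (HomologicalComplex.Hom.isoApp e i)
  first_fst h h0 := by
    have h1 := he.dFirst
    simp [reassoc_of% h1, m.first_fst]
  first_snd h h0 := by
    have h1 := he.dFirst
    simp [reassoc_of% h1, m.first_snd]
  inl_d_fst hij hjk hi hj := by
    simpa [reassoc_of% (hom_d_inv e)] using m.inl_d_fst hij hjk hi hj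
  inl_d_snd hij hjk hi hj := by
    simpa [reassoc_of% (hom_d_inv e)] using m.inl_d_snd hij hjk hi hj
  inr_d_fst hij hjk hi hj := by
    simpa [reassoc_of% (hom_d_inv e)] using m.inr_d_fst hij hjk hi hj
  inr_d_snd hij hjk hi hj := by
    simpa [reassoc_of% (hom_d_inv e)] using m.inr_d_snd hij hjk hi hj
  inl_last h h0 := by
    have h1 : M'.dLast = _ := (Category.comp_id _).symm.trans he.dLast.symm
    simp [h1, inv_hom_app, m.inl_last]
  inr_last h h0 := by
    have h1 : M'.dLast = _ := (Category.comp_id _).symm.trans he.dLast.symm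
    simp [h1, inv_hom_app, m.inr_last]

/-- Transport of a mapping cocone along an isomorphism. -/
def MappingCocone.ofIso {N N' : NComplex n A (Y.K.X (Fin.last n).castSucc)} (m : MappingCocone f N)
    (e : N'.K ≅ N.K) (he : N'.IsLift N e.hom (𝟙 _) (𝟙 _)) : MappingCocone f N' where
  biprod {i j} hij hi := (m.biprod hij hi).ofIso (HomologicalComplex.Hom.isoApp e j)
  first_fst h h0 := by
    have h1 := he.dFirst
    simp [reassoc_of% h1, m.first_fst]
  first_snd h h0 := by
    have h1 := he.dFirst
    simp [reassoc_of% h1, m.first_snd]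
  inl_d_fst hij hjk hi hj := by
    simpa [reassoc_of% (hom_d_inv e)] using m.inl_d_fst hij hjk hi hj
  inl_d_snd hij hjk hi hj := by
    simpa [reassoc_of% (hom_d_inv e)] using m.inl_d_snd hij hjk hi hj
  inr_d_fst hij hjk hi hj := by
    simpa [reassoc_of% (hom_d_inv e)] using m.inr_d_fst hij hjk hi hj
  inr_d_snd hij hjk hi hj := by
    simpa [reassoc_of% (hom_d_inv e)] using m.inr_d_snd hij hjk hi hj
  inl_last h h0 := by
    have h1 : N'.dLast = _ := (Category.comp_id _).symm.trans he.dLast.symm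
    simp [h1, inv_hom_app, m.inl_last]
  inr_last h h0 := by
    have h1 : N'.dLast = _ := (Category.comp_id _).symm.trans he.dLast.symm
    simp [h1, inv_hom_app, m.inr_last]

end Transport

/-! ### Restriction to an extension-closed full subcategory -/

section Restriction

variable {𝒞 : Type u} [Category.{v} 𝒞] [Preadditive 𝒞] {n : ℕ} (P : ObjectProperty 𝒞)

/-- A complex whose terms lie in a full subcategory, as a complex in this subcategory. -/
def liftComplex (K : HomologicalComplex 𝒞 (nShape n)) (h : ∀ i, P (K.X i)) :
    HomologicalComplex P.FullSubcategory (nShape n) where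
  X i := ⟨K.X i, h i⟩
  d i j := ObjectProperty.homMk (K.d i j)
  shape i j hij := P.hom_ext (K.shape i j hij)
  d_comp_d' i j k _ _ := P.hom_ext (K.d_comp_d i j k)

/-- A complex with prescribed end terms, as a complex in a full subcategory. -/
def liftNComplex {A C : P.FullSubcategory} (X : NComplex n A.obj C.obj) (h : ∀ i, P (X.K.X i)) :
    NComplex n A C where
  K := liftComplex P X.K h
  left := P.isoMk X.left
  right := P.isoMk X.right

variable {P}

/-- The inclusion of a full subcategory is full on complexes. -/
def preimageHom {K L : HomologicalComplex P.FullSubcategory (nShape n)}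
    (f : (P.ι.mapHomologicalComplex (nShape n)).obj K ⟶
      (P.ι.mapHomologicalComplex (nShape n)).obj L) : K ⟶ L where
  f i := ObjectProperty.homMk (f.f i)
  comm' i j _ := P.hom_ext (f.comm i j)

/-- The inclusion of a full subcategory reflects homotopies. -/
def preimageHomotopy {K L : HomologicalComplex P.FullSubcategory (nShape n)} {f g : K ⟶ L}
    (H : Homotopy ((P.ι.mapHomologicalComplex (nShape n)).map f)
      ((P.ι.mapHomologicalComplex (nShape n)).map g)) : Homotopy f g where
  hom i j := ObjectProperty.homMk (H.hom i j)
  zero i j hij := P.hom_ext (H.zero i j hij)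
  comm i := P.hom_ext (H.comm i)

variable {A B C D : P.FullSubcategory} {X : NComplex n A C} {Y : NComplex n B D}

lemma isLift_preimageHom {f : (X.map P.ι).K ⟶ (Y.map P.ι).K} {a : A ⟶ B} {c : C ⟶ D}
    (hf : (X.map P.ι).IsLift (Y.map P.ι) f a.hom c.hom) :
    X.IsLift Y (preimageHom f) a c :=
  ⟨P.hom_ext hf.left, P.hom_ext hf.right⟩

lemma NComplex.HtpyEquiv.of_map_ι {X Y : NComplex n A C}
    (h : (X.map P.ι).HtpyEquiv (Y.map P.ι)) : X.HtpyEquiv Y := by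
  obtain ⟨f, g, hf, hg, ⟨H⟩, ⟨H'⟩⟩ := h
  exact ⟨preimageHom f, preimageHom g, isLift_preimageHom hf, isLift_preimageHom hg,
    ⟨preimageHomotopy (g := 𝟙 X.K) (H.trans (Homotopy.ofEq rfl))⟩,
    ⟨preimageHomotopy (g := 𝟙 Y.K) (H'.trans (Homotopy.ofEq rfl))⟩⟩

lemma NComplex.HtpyEquiv.map {𝒟 : Type u'} [Category.{v'} 𝒟] [Preadditive 𝒟] {A C : 𝒞}
    {X Y : NComplex n A C} (F : 𝒞 ⥤ 𝒟) [F.Additive]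
    (h : X.HtpyEquiv Y) : (X.map F).HtpyEquiv (Y.map F) := by
  obtain ⟨f, g, hf, hg, ⟨H⟩, ⟨H'⟩⟩ := h
  exact ⟨_, _, (hf.map F).congr (F.map_id _) (F.map_id _), (hg.map F).congr (F.map_id _)
    (F.map_id _), ⟨((Homotopy.ofEq (Functor.map_comp _ _ _).symm).trans
      (F.mapHomotopy H)).trans (Homotopy.ofEq (CategoryTheory.Functor.map_id _ _))⟩,
    ⟨((Homotopy.ofEq (Functor.map_comp _ _ _).symm).trans
      (F.mapHomotopy H')).trans (Homotopy.ofEq (CategoryTheory.Functor.map_id _ _))⟩⟩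

/-- The inclusion of a full subcategory reflects biproducts. -/
def BiprodData.ofMap {A B M : P.FullSubcategory} (b : BiprodData A.obj B.obj M.obj) :
    BiprodData A B M where
  inl := ObjectProperty.homMk b.inl
  inr := ObjectProperty.homMk b.inr
  fst := ObjectProperty.homMk b.fst
  snd := ObjectProperty.homMk b.snd
  inl_fst := P.hom_ext b.inl_fst
  inl_snd := P.hom_ext b.inl_snd
  inr_fst := P.hom_ext b.inr_fst
  inr_snd := P.hom_ext b.inr_snd
  total := P.hom_ext b.total

/-- The inclusion of a full subcategory reflects mapping cones. -/
def MappingCone.ofMap {f : X.K ⟶ Y.K} {M : NComplex n (X.K.X 1) D}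
    (m : MappingCone (X := X.map P.ι) (Y := Y.map P.ι)
      ((P.ι.mapHomologicalComplex (nShape n)).map f) (M.map P.ι)) : MappingCone f M where
  biprod hij hi := (m.biprod hij hi).ofMap
  first_fst h h0 := P.hom_ext (m.first_fst h h0)
  first_snd h h0 := P.hom_ext (m.first_snd h h0)
  inl_d_fst hij hjk hi hj := P.hom_ext (m.inl_d_fst hij hjk hi hj)
  inl_d_snd hij hjk hi hj := P.hom_ext (m.inl_d_snd hij hjk hi hj)
  inr_d_fst hij hjk hi hj := P.hom_ext (m.inr_d_fst hij hjk hi hj)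
  inr_d_snd hij hjk hi hj := P.hom_ext (m.inr_d_snd hij hjk hi hj)
  inl_last h h0 := P.hom_ext (m.inl_last h h0)
  inr_last h h0 := P.hom_ext (m.inr_last h h0)

/-- The inclusion of a full subcategory reflects mapping cocones. -/
def MappingCocone.ofMap {f : X.K ⟶ Y.K} {N : NComplex n A (Y.K.X (Fin.last n).castSucc)}
    (m : MappingCocone (X := X.map P.ι) (Y := Y.map P.ι)
      ((P.ι.mapHomologicalComplex (nShape n)).map f) (N.map P.ι)) : MappingCocone f N where
  biprod hij hi := (m.biprod hij hi).ofMap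
  first_fst h h0 := P.hom_ext (m.first_fst h h0)
  first_snd h h0 := P.hom_ext (m.first_snd h h0)
  inl_d_fst hij hjk hi hj := P.hom_ext (m.inl_d_fst hij hjk hi hj)
  inl_d_snd hij hjk hi hj := P.hom_ext (m.inl_d_snd hij hjk hi hj)
  inr_d_fst hij hjk hi hj := P.hom_ext (m.inr_d_fst hij hjk hi hj)
  inr_d_snd hij hjk hi hj := P.hom_ext (m.inr_d_snd hij hjk hi hj)
  inl_last h h0 := P.hom_ext (m.inl_last h h0)
  inr_last h h0 := P.hom_ext (m.inr_last h h0)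

variable {S : ExtensionStructure.{w} 𝒞 n}

lemma isExangle_restrict {A C : P.FullSubcategory} {δ : Ext (S.restrict P).E C A}
    {X : NComplex n A C}
    (hX : S.IsExangle (A := A.obj) (C := C.obj) δ (X.map P.ι)) : (S.restrict P).IsExangle δ X where
  push_dFirst := hX.push_dFirst
  pull_dLast := hX.pull_dLast
  exact_hom_from hij hjk T x hx := by
    obtain ⟨y, hy⟩ := hX.exact_hom_from hij hjk x.hom (congrArg InducedCategory.Hom.hom hx)
    exact ⟨ObjectProperty.homMk y, P.hom_ext hy⟩
  exact_hom_from_last x hx := by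
    obtain ⟨y, hy⟩ := hX.exact_hom_from_last x.hom hx
    exact ⟨ObjectProperty.homMk y, P.hom_ext hy⟩
  exact_hom_to hij hjk T x hx := by
    obtain ⟨y, hy⟩ := hX.exact_hom_to hij hjk x.hom (congrArg InducedCategory.Hom.hom hx)
    exact ⟨ObjectProperty.homMk y, P.hom_ext hy⟩
  exact_hom_to_first x hx := by
    obtain ⟨y, hy⟩ := hX.exact_hom_to_first x.hom hx
    exact ⟨ObjectProperty.homMk y, P.hom_ext hy⟩

/-- The restriction of a realisation to a full subcategory, provided that all extensions are
realised by complexes in the subcategory. -/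
lemma ExtensionStructure.IsRealisation.restrict (hS : S.IsRealisation)
    (hP : ∀ ⦃A C : 𝒞⦄, P A → P C → ∀ δ : Ext S.E C A, ∃ X, S.Realises δ X ∧ ∀ i, P (X.K.X i)) :
    (S.restrict P).IsRealisation where
  one_le := hS.one_le
  isClass {A C} δ := by
    obtain ⟨X, hX, h⟩ := hP A.property C.property δ
    obtain ⟨Z, hZ⟩ := hS.isClass (A := A.obj) (C := C.obj) δ
    refine ⟨liftNComplex P X h, fun Y => ⟨fun hY => ?_, fun hY => ?_⟩⟩
    · exact NComplex.HtpyEquiv.of_map_ι (((hZ _).1 hX).symm.trans ((hZ _).1 hY))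
    · exact hS.realises_of_htpyEquiv (A := A.obj) (C := C.obj) hX (hY.map P.ι)
  exists_lift δ ρ a c h X Y hX hY := by
    obtain ⟨f, hf⟩ := hS.exists_lift δ ρ a.hom c.hom h _ _ hX hY
    exact ⟨preimageHom f, isLift_preimageHom hf⟩
  isExangle δ X hX := isExangle_restrict (hS.isExangle _ _ hX)

lemma restrict_additive (hE : S.E.Additive) : (S.restrict P).E.Additive where
  map_add {A B f g} := by
    ext C δ
    exact pull_add_of_additive hE f.unop.hom g.unop.hom δ

lemma restrict_obj_additive (hE : ∀ C : 𝒞ᵒᵖ, (S.E.obj C).Additive) (C : P.FullSubcategoryᵒᵖ) :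
    ((S.restrict P).E.obj C).Additive where
  map_add {A B f g} := by
    ext δ
    exact push_add_of_additive hE f.hom g.hom δ

variable [HasFiniteBiproducts P.FullSubcategory]

/-- The property `P` is not assumed to be closed under isomorphisms, so a biproduct taken in the
ambient category is replaced by the one computed in the subcategory. -/
lemma exists_iso_of_biprodData {A B : P.FullSubcategory} {M : 𝒞}
    (b : BiprodData A.obj B.obj M) : ∃ (T : 𝒞) (i : T ⟶ M) (r : M ⟶ T),
      P T ∧ i ≫ r = 𝟙 T ∧ r ≫ i = 𝟙 M := by
  have := hasBinaryBiproducts_of_finite_biproducts P.FullSubcategory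
  have h1 := congrArg InducedCategory.Hom.hom (biprod.total (X := A) (Y := B))
  have h2 := congrArg InducedCategory.Hom.hom (biprod.inl_fst (X := A) (Y := B))
  have h3 := congrArg InducedCategory.Hom.hom (biprod.inl_snd (X := A) (Y := B))
  have h4 := congrArg InducedCategory.Hom.hom (biprod.inr_fst (X := A) (Y := B))
  have h5 := congrArg InducedCategory.Hom.hom (biprod.inr_snd (X := A) (Y := B))
  let b' : BiprodData A.obj B.obj (A ⊞ B).obj :=
    ⟨P.ι.map (biprod.inl : A ⟶ A ⊞ B), P.ι.map (biprod.inr : B ⟶ A ⊞ B),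
      P.ι.map (biprod.fst : A ⊞ B ⟶ A), P.ι.map (biprod.snd : A ⊞ B ⟶ B), h2, h3, h4, h5, h1⟩
  refine ⟨(A ⊞ B).obj, b'.fst ≫ b.inl + b'.snd ≫ b.inr, b.fst ≫ b'.inl + b.snd ≫ b'.inr,
    (A ⊞ B).property, ?_, ?_⟩
  · rw [← b'.total]
    simp
  · rw [← b.total]
    simp

lemma exists_iso_forall_prop {A C : 𝒞} {X : NComplex n A C}
    (h : ∀ k, ∃ (T : 𝒞) (i : T ⟶ X.K.X k) (r : X.K.X k ⟶ T), P T ∧ i ≫ r = 𝟙 T ∧ r ≫ i = 𝟙 _) :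
    ∃ (Y : NComplex n A C) (e : Y.K ≅ X.K), Y.IsLift X e.hom (𝟙 _) (𝟙 _) ∧ ∀ k, P (Y.K.X k) := by
  obtain ⟨L, i, r, hir, hri, hL⟩ := exists_splitting (𝟙 X.K) P h
  let e : L ≅ X.K := ⟨i, r, hir, hri⟩
  exact ⟨⟨L, HomologicalComplex.Hom.isoApp e 0 ≪≫ X.left,
    HomologicalComplex.Hom.isoApp e (Fin.last (n + 1)) ≪≫ X.right⟩, e, ⟨by simp, by simp⟩, hL⟩

/-- The terms of an ambient cone are biproducts of terms of the two complexes, apart from its ends.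
After replacing it by an isomorphic complex with terms in `P`, the fullness of the inclusion
reflects all the data. -/
lemma ExtensionStructure.IsRealisation.hasMappingCones_restrict [HasZeroObject 𝒞]
    (hS : S.IsRealisation) (h : S.HasMappingCones) : (S.restrict P).HasMappingCones := by
  intro A C D δ c Y X hY hX
  obtain ⟨f, hf, M, ⟨m⟩, hM⟩ := h (A := A.obj) (D := D.obj) δ c.hom (Y.map P.ι) (X.map P.ι) hY hX
  obtain ⟨L, e, he, hL⟩ := exists_iso_forall_prop (P := P) (X := M) (fun k => by
    by_cases h0 : k = 0
    · subst h0
      exact ⟨_, M.left.inv, M.left.hom, (Y.K.X 1).property, by simp, by simp⟩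
    by_cases hl : k = Fin.last (n + 1)
    · subst hl
      exact ⟨_, M.right.inv, M.right.hom, D.property, by simp, by simp⟩
    obtain ⟨j, hj⟩ := nShape_exists_next k hl
    exact exists_iso_of_biprodData (A := Y.K.X j) (B := X.K.X k) (m.biprod hj h0))
  let M' := liftNComplex P (A := Y.K.X 1) (C := D) L hL
  refine ⟨preimageHom f, isLift_preimageHom hf, M', ⟨MappingCone.ofMap (M := M') (m.ofIso e he)⟩, ?_⟩
  change S.Realises (push S.E (Y.map P.ι).dFirst δ) L
  exact hS.realises_of_iso hM e (Iso.refl _) (Iso.refl _) he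
    (by simp [push_id, pull_id])

lemma ExtensionStructure.IsRealisation.hasMappingCocones_restrict [HasZeroObject 𝒞]
    (hS : S.IsRealisation) (h : S.HasMappingCocones) : (S.restrict P).HasMappingCocones := by
  intro A B C δ a X Y hX hY
  obtain ⟨f, hf, N, ⟨m⟩, hN⟩ := h (A := A.obj) (C := C.obj) δ a.hom (X.map P.ι) (Y.map P.ι) hX hY
  obtain ⟨L, e, he, hL⟩ := exists_iso_forall_prop (P := P) (X := N) (fun k => by
    by_cases h0 : k = 0
    · subst h0
      exact ⟨_, N.left.inv, N.left.hom, A.property, by simp, by simp⟩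
    by_cases hl : k = Fin.last (n + 1)
    · subst hl
      exact ⟨_, N.right.inv, N.right.hom, (Y.K.X (Fin.last n).castSucc).property, by simp,
        by simp⟩
    obtain ⟨j, hj⟩ := nShape_exists_prev k h0
    exact exists_iso_of_biprodData (A := Y.K.X j) (B := X.K.X k) (m.biprod hj hl))
  let N' := liftNComplex P (A := A) (C := Y.K.X (Fin.last n).castSucc) L hL
  refine ⟨preimageHom f, isLift_preimageHom hf, N', ⟨MappingCocone.ofMap (N := N') (m.ofIso e he)⟩, ?_⟩
  change S.Realises (pull S.E (Y.map P.ι).dLast δ) L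
  exact hS.realises_of_iso hN e (Iso.refl _) (Iso.refl _) he
    (by simp [push_id, pull_id])

end Restriction

end NExang

end

set_option linter.unusedSectionVars false

noncomputable section

namespace NExang

open NComplex ExtensionStructure

lemma BiprodData.hasBinaryBiproduct {𝒞 : Type u} [Category.{v} 𝒞] [Preadditive 𝒞] {P Q M : 𝒞}
    (b : BiprodData P Q M) : HasBinaryBiproduct P Q := by
  let c : BinaryBicone P Q := ⟨M, b.fst, b.snd, b.inl, b.inr, b.inl_fst, b.inl_snd, b.inr_fst,
    b.inr_snd⟩
  exact ⟨⟨⟨c, isBinaryBilimitOfTotal c b.total⟩⟩⟩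

/-! ### The weak idempotent completion is additive, weakly idempotent complete and `n`-exangulated
-/

section Weak

variable {𝒞 : Type u} [Category.{v} 𝒞] [Preadditive 𝒞] {n : ℕ}

lemma Splits.diag [HasBinaryBiproducts 𝒞] {P Q M : 𝒞} (b : BiprodData P Q M) {α : P ⟶ P}
    {β : Q ⟶ Q} (hα : Splits α) (hβ : Splits β) : Splits (b.diag α β) := by
  obtain ⟨Y, r, s, rfl, h⟩ := hα
  obtain ⟨Z, t, u, rfl, h'⟩ := hβ
  exact Splits.add ⟨Y, b.fst ≫ r, s ≫ b.inl, by simp, by simp [h]⟩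
    ⟨Z, b.snd ≫ t, u ≫ b.inr, by simp, by simp [h']⟩ (by simp) (by simp)

lemma BiprodData.one_sub_diag {P Q M : 𝒞} (b : BiprodData P Q M) (α : P ⟶ P) (β : Q ⟶ Q) :
    𝟙 M - b.diag α β = b.diag (𝟙 P - α) (𝟙 Q - β) := by
  rw [← b.total]
  simp only [diag, Preadditive.sub_comp, Preadditive.comp_sub, Category.id_comp]
  abel

/-- The standard biproduct. -/
def biprodData [HasBinaryBiproducts 𝒞] (P Q : 𝒞) : BiprodData P Q (P ⊞ Q) where
  inl := biprod.inl
  inr := biprod.inr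
  fst := biprod.fst
  snd := biprod.snd
  inl_fst := by simp
  inl_snd := by simp
  inr_fst := by simp
  inr_snd := by simp
  total := by simp

/-- The biproduct of two formal direct factors. -/
def karoubiBiprod {P Q : Karoubi 𝒞} {M : 𝒞} (b : BiprodData P.X Q.X M) : Karoubi 𝒞 :=
  ⟨M, b.diag P.p Q.p, b.diag_comp_self P.idem Q.idem⟩

lemma weakProp_karoubiBiprod [HasBinaryBiproducts 𝒞] {P Q : Karoubi 𝒞} {M : 𝒞}
    (b : BiprodData P.X Q.X M) (hP : weakProp 𝒞 P) (hQ : weakProp 𝒞 Q) :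
    weakProp 𝒞 (karoubiBiprod b) := by
  change Splits (𝟙 M - b.diag P.p Q.p)
  rw [b.one_sub_diag]
  exact Splits.diag b hP hQ

/-- The biproduct of two formal direct factors. -/
def karoubiBiprodData {P Q : Karoubi 𝒞} {M : 𝒞} (b : BiprodData P.X Q.X M) :
    BiprodData P Q (karoubiBiprod b) where
  inl := ⟨P.p ≫ b.inl, by
    change P.p ≫ (P.p ≫ b.inl) ≫ b.diag P.p Q.p = P.p ≫ b.inl
    simp⟩
  inr := ⟨Q.p ≫ b.inr, by
    change Q.p ≫ (Q.p ≫ b.inr) ≫ b.diag P.p Q.p = Q.p ≫ b.inr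
    simp⟩
  fst := ⟨b.fst ≫ P.p, by
    change b.diag P.p Q.p ≫ (b.fst ≫ P.p) ≫ P.p = b.fst ≫ P.p
    simp [reassoc_of% (b.diag_fst P.p Q.p)]⟩
  snd := ⟨b.snd ≫ Q.p, by
    change b.diag P.p Q.p ≫ (b.snd ≫ Q.p) ≫ Q.p = b.snd ≫ Q.p
    simp [reassoc_of% (b.diag_snd P.p Q.p)]⟩
  inl_fst := by
    apply Karoubi.hom_ext
    change (P.p ≫ b.inl) ≫ b.fst ≫ P.p = P.p
    simp
  inl_snd := by
    apply Karoubi.hom_ext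
    change (P.p ≫ b.inl) ≫ b.snd ≫ Q.p = 0
    simp
  inr_fst := by
    apply Karoubi.hom_ext
    change (Q.p ≫ b.inr) ≫ b.fst ≫ P.p = 0
    simp
  inr_snd := by
    apply Karoubi.hom_ext
    change (Q.p ≫ b.inr) ≫ b.snd ≫ Q.p = Q.p
    simp
  total := by
    apply Karoubi.hom_ext
    change (b.fst ≫ P.p) ≫ P.p ≫ b.inl + (b.snd ≫ Q.p) ≫ Q.p ≫ b.inr = b.diag P.p Q.p
    simp [BiprodData.diag]

variable [HasFiniteBiproducts 𝒞]

-- The biproduct of `(X, p)` and `(Y, q)` carries the diagonal idempotent, whose complement is again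
-- diagonal with split entries.
variable (𝒞) in
lemma hasFiniteBiproducts_weakCompletion : HasFiniteBiproducts (WeakCompletion 𝒞) := by
  have := hasBinaryBiproducts_of_finite_biproducts 𝒞
  have : HasBinaryBiproducts (WeakCompletion 𝒞) := ⟨fun P Q =>
    (BiprodData.ofMap (M := ⟨_, weakProp_karoubiBiprod (biprodData P.obj.X Q.obj.X)
      P.property Q.property⟩) (karoubiBiprodData _)).hasBinaryBiproduct⟩
  have : HasZeroObject (WeakCompletion 𝒞) := by
    obtain ⟨Z, hZ⟩ := hasZeroObject_of_hasFiniteBiproducts 𝒞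
    refine ⟨(toWeak 𝒞).obj Z, (IsZero.iff_id_eq_zero _).2 ?_⟩
    exact (weakProp 𝒞).hom_ext (Karoubi.hom_ext _ _ ((IsZero.iff_id_eq_zero _).1 hZ))
  have : HasTerminal (WeakCompletion 𝒞) := HasZeroObject.hasTerminal
  have := hasFiniteProducts_of_has_binary_and_terminal (C := WeakCompletion 𝒞)
  exact HasFiniteBiproducts.of_hasFiniteProducts

/-- A split idempotent of a direct factor `p` of `X` with split complement, if its image is a
direct factor `q` of `Y` with split complement, has a split complement in `X ⊕ Z`, where `Z` is
the complementary factor of `Y`. -/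
lemma splits_one_sub_diag [HasBinaryBiproducts 𝒞] {X Y Z M : 𝒞} {p : X ⟶ X} {q : Y ⟶ Y}
    {r : X ⟶ Y} {s : Y ⟶ X} {t : Y ⟶ Z} {z : Z ⟶ Y} (b : BiprodData X Z M) (hp : Splits (𝟙 X - p))
    (hpr : p ≫ r = r) (hrq : r ≫ q = r) (hqs : q ≫ s = s) (hsp : s ≫ p = s)
    (hsr : s ≫ r = q) (htz : t ≫ z = 𝟙 Y - q) (hzt : z ≫ t = 𝟙 Z) :
    Splits (𝟙 M - b.diag (p - r ≫ s) 0) := by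
  have hqt : q ≫ t = 0 := by
    have := htz =≫ t
    rw [Category.assoc, hzt, Category.comp_id, Preadditive.sub_comp, Category.id_comp] at this
    exact sub_eq_self.mp this.symm
  have hzq : z ≫ q = 0 := by
    have := z ≫= htz
    rw [← Category.assoc, hzt, Category.id_comp, Preadditive.comp_sub, Category.comp_id] at this
    exact sub_eq_self.mp this.symm
  have hrt : r ≫ t = 0 := by rw [← hrq, Category.assoc, hqt, comp_zero]
  have hzs : z ≫ s = 0 := by rw [← hqs, ← Category.assoc, hzq, zero_comp]
  -- The first summand splits because `1 - p` does. The second has image `(Y, q) ⊕ Z`, which is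
  -- isomorphic to `Y`; without `Z` one would need an image of `q` in `𝒞`, which may not exist.
  have h1 : 𝟙 M - b.diag (p - r ≫ s) 0 = b.diag (𝟙 X - p) 0 + b.diag (r ≫ s) (𝟙 Z) := by
    rw [b.one_sub_diag]
    simp only [BiprodData.diag, Preadditive.sub_comp, Preadditive.comp_sub, zero_comp, comp_zero,
      sub_zero]
    abel
  rw [h1]
  refine Splits.add (Splits.diag b hp ⟨_, 0, 0, by simp, (isZero_zero 𝒞).eq_of_src _ _⟩)
    ⟨Y, b.fst ≫ r + b.snd ≫ z, s ≫ b.inl + t ≫ b.inr, ?_, ?_⟩ ?_ ?_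
  · simp [BiprodData.diag, reassoc_of% hrt, reassoc_of% hzs, reassoc_of% hzt]
  · simp [hsr, htz]
  · simp [BiprodData.diag, reassoc_of% hpr]
  · simp [BiprodData.diag, reassoc_of% hsp]

variable (𝒞) in
/-- The weak idempotent completion is weakly idempotent complete. -/
lemma isWeaklyIdempotentComplete_weakCompletion :
    IsWeaklyIdempotentComplete (WeakCompletion 𝒞) := by
  have := hasBinaryBiproducts_of_finite_biproducts 𝒞
  rintro ⟨P, hP⟩ ⟨Q, hQ⟩ ⟨r⟩ ⟨⟨⟨s⟩, hsr⟩⟩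
  obtain ⟨Z, t, z, htz, hzt⟩ := hQ
  have hsr' : s.f ≫ r.f = Q.p :=
    congrArg (fun f => Karoubi.Hom.f (InducedCategory.Hom.hom f)) hsr
  let b := biprodData P.X Z
  have hrs : r.f ≫ s.f ≫ r.f = r.f := by rw [hsr']; simp
  -- The kernel is `(X, p - r ≫ s)` in the idempotent completion. It is represented by an isomorphic
  -- object on `X ⊕ Z`, because the complement of the idempotent on `X` alone need not split.
  let K : WeakCompletion 𝒞 := ⟨⟨P.X ⊞ Z, b.diag (P.p - r.f ≫ s.f) 0, b.diag_comp_self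
    (by simp [reassoc_of% hrs]) (by simp)⟩, splits_one_sub_diag b hP (by simp) (by simp) (by simp)
      (by simp) hsr' htz hzt⟩
  refine hasKernel_of_complement (𝒞 := WeakCompletion 𝒞) (T := K) (X := ⟨P, hP⟩) _ (ObjectProperty.homMk s)
    hsr (ObjectProperty.homMk ⟨b.fst ≫ (P.p - r.f ≫ s.f), ?_⟩)
    (ObjectProperty.homMk ⟨(P.p - r.f ≫ s.f) ≫ b.inl, ?_⟩) ?_ ?_
  · change b.diag (P.p - r.f ≫ s.f) 0 ≫ (b.fst ≫ (P.p - r.f ≫ s.f)) ≫ P.p =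
      b.fst ≫ (P.p - r.f ≫ s.f)
    simp [BiprodData.diag, reassoc_of% hrs]
  · change P.p ≫ ((P.p - r.f ≫ s.f) ≫ b.inl) ≫ b.diag (P.p - r.f ≫ s.f) 0 =
      (P.p - r.f ≫ s.f) ≫ b.inl
    simp [BiprodData.diag, reassoc_of% hrs]
  · apply (weakProp 𝒞).hom_ext
    apply Karoubi.hom_ext
    change (b.fst ≫ (P.p - r.f ≫ s.f)) ≫ (P.p - r.f ≫ s.f) ≫ b.inl = b.diag (P.p - r.f ≫ s.f) 0
    simp [BiprodData.diag, reassoc_of% hrs]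
  · apply (weakProp 𝒞).hom_ext
    apply Karoubi.hom_ext
    refine Eq.trans ?_ ((sub_eq_add_neg P.p (r.f ≫ s.f)).trans (congrArg
      (fun f : (⟨P, hP⟩ : WeakCompletion 𝒞) ⟶ ⟨P, hP⟩ => f.hom.f)
      (sub_eq_add_neg (𝟙 _) (ObjectProperty.homMk r ≫ ObjectProperty.homMk s)).symm))
    change ((P.p - r.f ≫ s.f) ≫ b.inl) ≫ b.fst ≫ (P.p - r.f ≫ s.f) = P.p - r.f ≫ s.f
    simp [reassoc_of% hrs]

variable {S : ExtensionStructure.{w} 𝒞 n}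

lemma ExtensionStructure.IsInflation.of_restrict {𝒟 : Type u'} [Category.{v'} 𝒟] [Preadditive 𝒟]
    {S : ExtensionStructure.{w} 𝒟 n} {P : ObjectProperty 𝒟} {A B : P.FullSubcategory} {f : A ⟶ B}
    (hf : (S.restrict P).IsInflation f) : S.IsInflation f.hom := by
  obtain ⟨C, δ, X, β, hX, h⟩ := hf
  exact ⟨C.obj, δ, X.map P.ι, P.ι.mapIso β, hX, congrArg InducedCategory.Hom.hom h⟩

lemma ExtensionStructure.IsDeflation.of_restrict {𝒟 : Type u'} [Category.{v'} 𝒟] [Preadditive 𝒟]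
    {S : ExtensionStructure.{w} 𝒟 n} {P : ObjectProperty 𝒟} {A B : P.FullSubcategory} {f : A ⟶ B}
    (hf : (S.restrict P).IsDeflation f) : S.IsDeflation f.hom := by
  obtain ⟨C, δ, X, β, hX, h⟩ := hf
  exact ⟨C.obj, δ, X.map P.ι, P.ι.mapIso β, hX, congrArg InducedCategory.Hom.hom h⟩

lemma ExtensionStructure.IsNExangulated.weak (hS : S.IsNExangulated) :
    S.weak.IsNExangulated := by
  have := hasFiniteBiproducts_weakCompletion 𝒞
  have : HasZeroObject (WeakCompletion 𝒞) := hasZeroObject_of_hasFiniteBiproducts _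
  have := Karoubi.karoubi_hasFiniteBiproducts (C := 𝒞)
  have : HasZeroObject (Karoubi 𝒞) := hasZeroObject_of_hasFiniteBiproducts _
  have hK := hS.isRealisation_karoubi
  have hR : S.weak.IsRealisation := hK.restrict fun _ _ h h' δ =>
    hS.exists_realises_weakProp h h' δ
  have hE : S.weak.E.Additive := restrict_additive (karoubiE_additive hS.additive_fst)
  have hE' : ∀ C, (S.weak.E.obj C).Additive :=
    restrict_obj_additive (karoubiE_obj_additive hS.additive_snd)
  have hW := isWeaklyIdempotentComplete_weakCompletion 𝒞
  have hc : S.weak.HasMappingCones := hK.hasMappingCones_restrict hS.exists_cone_karoubi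
  have hc' : S.weak.HasMappingCocones := hK.hasMappingCocones_restrict hS.exists_cocone_karoubi
  exact
  { one_le := hS.one_le
    additive_fst := hE
    additive_snd := hE'
    isClass := hR.isClass
    exists_lift := hR.exists_lift
    isExangle := hR.isExangle
    realises_trivFirst := hR.realises_trivFirst
    realises_trivLast := hR.realises_trivLast
    inflation_comp := fun {A _ _} f g hf hg => by
      -- As `V` comes from `𝒞`, the extension `θ` lies between objects of the weak completion and is
      -- realised there, so no arbitrary idempotent is needed.
      obtain ⟨V, θ, h⟩ := hS.exists_comp_inflations hf.of_restrict hg.of_restrict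
      obtain ⟨W, hWθ⟩ := hR.exists_realises (A := A) (C := (toWeak 𝒞).obj V) θ
      obtain ⟨φ, hφ⟩ := h _ hWθ
      exact hR.isInflation_of_comp hE hE' hW hc' hWθ (φ := ⟨φ⟩) ((weakProp 𝒞).hom_ext hφ)
    deflation_comp := fun {_ _ C} f g hf hg => by
      obtain ⟨V, θ, h⟩ := hS.exists_comp_deflations hf.of_restrict hg.of_restrict
      obtain ⟨W, hWθ⟩ := hR.exists_realises (A := (toWeak 𝒞).obj V) (C := C) θ
      obtain ⟨φ, hφ⟩ := h _ hWθ
      exact hR.isDeflation_of_comp hE hE' hW hc hWθ (φ := ⟨φ⟩) ((weakProp 𝒞).hom_ext hφ)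
    exists_cone := hc
    exists_cocone := hc' }

/-- The inclusion into the weak idempotent completion is `n`-exangulated. -/
lemma inclusion_isNExangulated : (inclusion S).IsNExangulated := fun _ _ _ _ hX =>
  realises_map_toKaroubi hX

end Weak

end NExang

end

set_option linter.unusedSectionVars false

noncomputable section

namespace NExang

open NComplex ExtensionStructure

section Underlying

variable {𝒞 : Type u} [Category.{v} 𝒞] [Preadditive 𝒞] {n : ℕ} {S : ExtensionStructure.{w} 𝒞 n}

/-- The extension in `𝔼` underlying an extension in `𝔾`. -/
def weakUnderlying {P Q : WeakCompletion 𝒞} :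
    Ext S.weak.E Q P →+ Ext S.E Q.obj.X P.obj.X :=
  (karoubiSubgroup S.E Q.obj P.obj).subtype

lemma push_p_weakUnderlying {P Q : WeakCompletion 𝒞} (δ : Ext S.weak.E Q P) :
    push S.E P.obj.p (weakUnderlying δ) = weakUnderlying δ := δ.2.1

lemma pull_p_weakUnderlying {P Q : WeakCompletion 𝒞} (δ : Ext S.weak.E Q P) :
    pull S.E Q.obj.p (weakUnderlying δ) = weakUnderlying δ := δ.2.2

end Underlying

/-! ### Natural transformations on the weak idempotent completion -/

section Transformations

lemma push_comp_eq_pull_comp {𝒟 : Type u} [Category.{v} 𝒟] {E : 𝒟ᵒᵖ ⥤ 𝒟 ⥤ AddCommGrpCat.{w}}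
    {A A' A'' C C' C'' : 𝒟} {δ : Ext E C A} {δ' : Ext E C' A'} {δ'' : Ext E C'' A''} {a : A ⟶ A'}
    {a' : A' ⟶ A''} {c : C ⟶ C'} {c' : C' ⟶ C''} (h : push E a δ = pull E c δ')
    (h' : push E a' δ' = pull E c' δ'') : push E (a ≫ a') δ = pull E (c ≫ c') δ'' := by
  rw [push_comp, h, push_pull, h', ← pull_comp]

variable {𝒞 : Type u} [Category.{v} 𝒞] [Preadditive 𝒞]
  {𝒟 : Type u'} [Category.{v'} 𝒟] [Preadditive 𝒟] {n : ℕ}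
  {S : ExtensionStructure.{w} 𝒞 n} {S' : ExtensionStructure.{w'} 𝒟 n}

lemma ExtensionFunctor.IsNExangulatedTrans.comp {Φ Ψ Ξ : ExtensionFunctor S S'} {α : Φ.F ⟶ Ψ.F}
    {β : Ψ.F ⟶ Ξ.F} (hα : IsNExangulatedTrans Φ Ψ α) (hβ : IsNExangulatedTrans Ψ Ξ β) :
    IsNExangulatedTrans Φ Ξ (α ≫ β) := by
  intro A C δ
  rw [NatTrans.comp_app, NatTrans.comp_app]
  exact push_comp_eq_pull_comp (hα δ) (hβ δ)

variable [HasFiniteBiproducts 𝒞]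

/-- The inclusion of the direct factor `(X, e)` of `X`. -/
def weakι (Q : WeakCompletion 𝒞) : Q ⟶ (toWeak 𝒞).obj Q.obj.X := ObjectProperty.homMk (karι Q.obj)

/-- The projection to the direct factor `(X, e)` of `X`. -/
def weakπ (Q : WeakCompletion 𝒞) : (toWeak 𝒞).obj Q.obj.X ⟶ Q := ObjectProperty.homMk (karπ Q.obj)

lemma weakι_weakπ (Q : WeakCompletion 𝒞) : weakι Q ≫ weakπ Q = 𝟙 Q :=
  (weakProp 𝒞).hom_ext (karι_karπ Q.obj)

lemma comp_weakι {P Q : WeakCompletion 𝒞} (f : P ⟶ Q) :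
    f ≫ weakι Q = weakι P ≫ (toWeak 𝒞).map f.hom.f :=
  (weakProp 𝒞).hom_ext (Karoubi.hom_ext _ _
    ((Karoubi.comp_p f.hom).trans (Karoubi.p_comp f.hom).symm))

lemma weakπ_comp {P Q : WeakCompletion 𝒞} (f : P ⟶ Q) :
    weakπ P ≫ f = (toWeak 𝒞).map f.hom.f ≫ weakπ Q :=
  (weakProp 𝒞).hom_ext (Karoubi.hom_ext _ _
    ((Karoubi.p_comp f.hom).trans (Karoubi.comp_p f.hom).symm))

lemma map_weakι_weakπ_assoc (G : WeakCompletion 𝒞 ⥤ 𝒟) (Q : WeakCompletion 𝒞) {T : 𝒟}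
    (f : G.obj Q ⟶ T) : G.map (weakι Q) ≫ G.map (weakπ Q) ≫ f = f := by
  rw [← Category.assoc, ← G.map_comp, weakι_weakπ, CategoryTheory.Functor.map_id, Category.id_comp]

/-- The extension of a natural transformation to the weak idempotent completion. -/
def extendTrans {G H : WeakCompletion 𝒞 ⥤ 𝒟} (α : toWeak 𝒞 ⋙ G ⟶ toWeak 𝒞 ⋙ H) : G ⟶ H where
  app Q := G.map (weakι Q) ≫ α.app Q.obj.X ≫ H.map (weakπ Q)
  naturality P Q f := by
    have h : G.map ((toWeak 𝒞).map f.hom.f) ≫ α.app Q.obj.X =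
      α.app P.obj.X ≫ H.map ((toWeak 𝒞).map f.hom.f) := α.naturality f.hom.f
    rw [← Category.assoc, ← G.map_comp, comp_weakι, G.map_comp, Category.assoc, reassoc_of% h,
      Category.assoc, Category.assoc, ← H.map_comp, ← H.map_comp, weakπ_comp]

lemma whiskerLeft_extendTrans {G H : WeakCompletion 𝒞 ⥤ 𝒟} (α : toWeak 𝒞 ⋙ G ⟶ toWeak 𝒞 ⋙ H) :
    Functor.whiskerLeft (toWeak 𝒞) (extendTrans α) = α := by
  ext X
  change G.map (𝟙 ((toWeak 𝒞).obj X)) ≫ α.app X ≫ H.map (𝟙 ((toWeak 𝒞).obj X)) = _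
  rw [CategoryTheory.Functor.map_id, CategoryTheory.Functor.map_id, Category.id_comp]
  exact Category.comp_id _

/-- A natural transformation on the weak idempotent completion is determined by its
restriction. -/
lemma whiskerLeft_toWeak_injective {G H : WeakCompletion 𝒞 ⥤ 𝒟} {μ ν : G ⟶ H}
    (h : Functor.whiskerLeft (toWeak 𝒞) μ = Functor.whiskerLeft (toWeak 𝒞) ν) : μ = ν := by
  ext Q
  have hQ : μ.app ((toWeak 𝒞).obj Q.obj.X) = ν.app ((toWeak 𝒞).obj Q.obj.X) :=
    NatTrans.congr_app h Q.obj.X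
  rw [← map_weakι_weakπ_assoc G Q (μ.app Q), ← map_weakι_weakπ_assoc G Q (ν.app Q), μ.naturality,
    ν.naturality, hQ]

/-- The extension of a natural isomorphism to the weak idempotent completion. -/
def extendIso {G H : WeakCompletion 𝒞 ⥤ 𝒟} (α : toWeak 𝒞 ⋙ G ≅ toWeak 𝒞 ⋙ H) : G ≅ H where
  hom := extendTrans α.hom
  inv := extendTrans α.inv
  hom_inv_id := whiskerLeft_toWeak_injective (by
    rw [Functor.whiskerLeft_comp, whiskerLeft_extendTrans, whiskerLeft_extendTrans, α.hom_inv_id,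
      Functor.whiskerLeft_id'])
  inv_hom_id := whiskerLeft_toWeak_injective (by
    rw [Functor.whiskerLeft_comp, whiskerLeft_extendTrans, whiskerLeft_extendTrans, α.inv_hom_id,
      Functor.whiskerLeft_id'])

lemma push_weakι {P Q : WeakCompletion 𝒞} (δ : Ext S.weak.E Q P) :
    push S.weak.E (weakι P) δ =
      pull S.weak.E (weakι Q) ((inclusion S).Γ (weakUnderlying δ)) :=
  push_karι (P := P.obj) (Q := Q.obj) δ

lemma push_weakπ {P Q : WeakCompletion 𝒞} (δ : Ext S.weak.E Q P) :
    push S.weak.E (weakπ P) ((inclusion S).Γ (weakUnderlying δ)) =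
      pull S.weak.E (weakπ Q) δ :=
  push_karπ (P := P.obj) (Q := Q.obj) δ

/-- The extension of an `n`-exangulated natural transformation is `n`-exangulated. -/
lemma isNExangulatedTrans_extendTrans {G H : ExtensionFunctor S.weak S'}
    (α : toWeak 𝒞 ⋙ G.F ⟶ toWeak 𝒞 ⋙ H.F)
    (h : ExtensionFunctor.IsNExangulatedTrans ((inclusion S).comp G) ((inclusion S).comp H) α) :
    ExtensionFunctor.IsNExangulatedTrans G H (extendTrans α) := by
  intro A C δ
  have h1 (ε : Ext S.E C.obj.X A.obj.X) : push S'.E (α.app A.obj.X) (G.Γ ((inclusion S).Γ ε)) =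
      pull S'.E (α.app C.obj.X) (H.Γ ((inclusion S).Γ ε)) := h ε
  have h2 : push S'.E (G.F.map (weakι A)) (G.Γ δ) = pull S'.E (G.F.map (weakι C))
      (G.Γ ((inclusion S).Γ (weakUnderlying δ))) :=
    (G.map_push _ _).symm.trans ((congrArg _ (push_weakι δ)).trans (G.map_pull _ _))
  have h3 : push S'.E (H.F.map (weakπ A)) (H.Γ ((inclusion S).Γ (weakUnderlying δ))) =
      pull S'.E (H.F.map (weakπ C)) (H.Γ δ) :=
    (H.map_push _ _).symm.trans ((congrArg _ (push_weakπ δ)).trans (H.map_pull _ _))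
  exact push_comp_eq_pull_comp h2 (push_comp_eq_pull_comp (h1 _) h3)

/-- The universal property of the weak idempotent completion on the level of natural
transformations. -/
lemma existsUnique_isNExangulatedIso {Φ : ExtensionFunctor S S'}
    {G H : ExtensionFunctor S.weak S'} (β : Φ.F ≅ ((inclusion S).comp G).F)
    (γ : Φ.F ≅ ((inclusion S).comp H).F)
    (hβ : ExtensionFunctor.IsNExangulatedIso Φ ((inclusion S).comp G) β)
    (hγ : ExtensionFunctor.IsNExangulatedIso Φ ((inclusion S).comp H) γ) :
    ∃! μ : G.F ≅ H.F, ExtensionFunctor.IsNExangulatedIso G H μ ∧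
      γ.hom = β.hom ≫ Functor.whiskerLeft (inclusion S).F μ.hom := by
  -- The restriction of `μ` to `𝒞` is forced to be this isomorphism, and a transformation is
  -- determined by its restriction since every object is a retract of one from `𝒞`.
  let α : toWeak 𝒞 ⋙ G.F ≅ toWeak 𝒞 ⋙ H.F := β.symm ≪≫ γ
  refine ⟨extendIso α, ⟨⟨isNExangulatedTrans_extendTrans _ (hβ.2.comp hγ.1),
    isNExangulatedTrans_extendTrans _ (hγ.2.comp hβ.1)⟩, ?_⟩, ?_⟩
  · refine Eq.symm ((congrArg (β.hom ≫ ·) (whiskerLeft_extendTrans α.hom)).trans ?_)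
    exact β.hom_inv_id_assoc γ.hom
  · rintro μ ⟨-, hμ⟩
    apply Iso.ext
    apply whiskerLeft_toWeak_injective
    refine Eq.trans ?_ (whiskerLeft_extendTrans α.hom).symm
    exact (Iso.eq_inv_comp β).2 hμ.symm

end Transformations

/-! ### Extension of functors to the weak idempotent completion -/

section Extend

variable {𝒞 : Type u} [Category.{v} 𝒞] [Preadditive 𝒞]
  {𝒟 : Type u'} [Category.{v'} 𝒟] [Preadditive 𝒟] {n : ℕ}
  {S : ExtensionStructure.{w} 𝒞 n} {S' : ExtensionStructure.{w'} 𝒟 n}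

/-- A choice of images of the idempotents `F(e)`, for the objects `(X, e)` of the weak idempotent
completion. -/
structure ImageData (F : 𝒞 ⥤ 𝒟) where
  T : WeakCompletion 𝒞 → 𝒟
  i : ∀ Q, T Q ⟶ F.obj Q.obj.X
  p : ∀ Q, F.obj Q.obj.X ⟶ T Q
  i_p : ∀ Q, i Q ≫ p Q = 𝟙 (T Q)
  p_i : ∀ Q, p Q ≫ i Q = F.map Q.obj.p

/-- The splitting of `1 - e` is carried by `F` to a retraction with a section. Its complement in the
target is an image of `F(e)`. -/
lemma IsWeaklyIdempotentComplete.nonempty_imageData (hW : IsWeaklyIdempotentComplete 𝒟)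
    (F : 𝒞 ⥤ 𝒟) [F.Additive] : Nonempty (ImageData F) := by
  have h (Q : WeakCompletion 𝒞) : ∃ (T : 𝒟) (i : T ⟶ F.obj Q.obj.X) (p : F.obj Q.obj.X ⟶ T),
      i ≫ p = 𝟙 T ∧ p ≫ i = F.map Q.obj.p := by
    obtain ⟨Y, r, s, hrs, hsr⟩ := Q.property
    obtain ⟨T, i, p, hip, hpi⟩ := hW.exists_complement (F.map r) (F.map s) (by
      rw [← F.map_comp, hsr, CategoryTheory.Functor.map_id])
    refine ⟨T, i, p, hip, ?_⟩
    rw [hpi, ← F.map_comp, hrs, F.map_sub, CategoryTheory.Functor.map_id, sub_sub_cancel]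
  choose T i p hip hpi using h
  exact ⟨⟨T, i, p, hip, hpi⟩⟩

namespace ImageData

attribute [simp] i_p

variable {F : 𝒞 ⥤ 𝒟} (D : ImageData F)

@[simp]
lemma i_p_assoc (Q : WeakCompletion 𝒞) {Z : 𝒟} (f : D.T Q ⟶ Z) : D.i Q ≫ D.p Q ≫ f = f := by
  rw [← Category.assoc, D.i_p, Category.id_comp]

lemma p_i_map {P Q : WeakCompletion 𝒞} (f : P ⟶ Q) :
    D.p P ≫ D.i P ≫ F.map f.hom.f = F.map f.hom.f := by
  rw [← Category.assoc, D.p_i, ← F.map_comp, Karoubi.p_comp]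

/-- The action of the extension of `F` on morphisms. -/
def mapHom {P Q : WeakCompletion 𝒞} (f : P ⟶ Q) : D.T P ⟶ D.T Q :=
  D.i P ≫ F.map f.hom.f ≫ D.p Q

lemma mapHom_comp_i {P Q : WeakCompletion 𝒞} (f : P ⟶ Q) :
    D.mapHom f ≫ D.i Q = D.i P ≫ F.map f.hom.f := by
  rw [mapHom, Category.assoc, Category.assoc, D.p_i, ← F.map_comp, Karoubi.comp_p]

lemma p_comp_mapHom {P Q : WeakCompletion 𝒞} (f : P ⟶ Q) :
    D.p P ≫ D.mapHom f = F.map f.hom.f ≫ D.p Q := by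
  rw [mapHom, reassoc_of% (D.p_i_map f)]

/-- The extension of `F` to the weak idempotent completion. -/
def functor : WeakCompletion 𝒞 ⥤ 𝒟 where
  obj := D.T
  map f := D.mapHom f
  map_id Q := by
    change D.i Q ≫ F.map Q.obj.p ≫ D.p Q = _
    rw [← D.p_i]
    simp
  map_comp {P Q R} f g := by
    change D.i P ≫ F.map (f.hom.f ≫ g.hom.f) ≫ D.p R = _
    rw [F.map_comp]
    simp [mapHom, reassoc_of% (D.p_i_map g)]

instance [F.Additive] : D.functor.Additive where
  map_add {P Q f g} := by
    change D.i P ≫ F.map (f.hom.f + g.hom.f) ≫ D.p Q = _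
    rw [F.map_add, Preadditive.add_comp, Preadditive.comp_add]
    rfl

lemma i_map_p (Q : WeakCompletion 𝒞) : D.i Q ≫ F.map Q.obj.p = D.i Q := by
  rw [← D.p_i, i_p_assoc]

lemma map_p_p (Q : WeakCompletion 𝒞) : F.map Q.obj.p ≫ D.p Q = D.p Q := by
  rw [← D.p_i, Category.assoc, D.i_p, Category.comp_id]

lemma i_map_comm {P Q : WeakCompletion 𝒞} {X Y : 𝒞} {f : P ⟶ Q} {u : P.obj.X ⟶ X}
    {v : Q.obj.X ⟶ Y} {g : X ⟶ Y} (h : u ≫ g = f.hom.f ≫ v) :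
    (D.i P ≫ F.map u) ≫ F.map g = D.mapHom f ≫ D.i Q ≫ F.map v := by
  rw [Category.assoc, ← F.map_comp, h, F.map_comp, ← Category.assoc, ← Category.assoc,
    D.mapHom_comp_i]

lemma map_p_comm {P Q : WeakCompletion 𝒞} {X Y : 𝒞} {f : P ⟶ Q} {u : X ⟶ P.obj.X}
    {v : Y ⟶ Q.obj.X} {g : X ⟶ Y} (h : u ≫ f.hom.f = g ≫ v) :
    (F.map u ≫ D.p P) ≫ D.mapHom f = F.map g ≫ F.map v ≫ D.p Q := by
  rw [Category.assoc, D.p_comp_mapHom, ← Category.assoc, ← F.map_comp, h, F.map_comp,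
    Category.assoc]

lemma i_map_map_p {P : WeakCompletion 𝒞} {X : 𝒞} {u : P.obj.X ⟶ X} {v : X ⟶ P.obj.X}
    (h : u ≫ v = P.obj.p) : (D.i P ≫ F.map u) ≫ F.map v ≫ D.p P = 𝟙 (D.T P) := by
  rw [Category.assoc, ← Category.assoc (F.map u), ← F.map_comp, h, D.map_p_p, D.i_p]

end ImageData

/-- The extension of an `n`-exangulated functor to the weak idempotent completion. -/
def ImageData.extend {Φ : ExtensionFunctor S S'} (D : ImageData Φ.F) :
    ExtensionFunctor S.weak S' where
  F := D.functor
  -- The underlying extension is transported by the given `Γ` and then cut down to the chosen images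
  -- on both ends.
  Γ {Q P} := ((push S'.E (D.p P)).comp (pull S'.E (D.i Q))).comp (Φ.Γ.comp
    weakUnderlying)
  map_push {P P' Q} a δ := by
    change push S'.E (D.p P') (pull S'.E (D.i Q) (Φ.Γ (push S.E a.hom.f
      (weakUnderlying δ)))) = push S'.E (D.mapHom a)
        (push S'.E (D.p P) (pull S'.E (D.i Q) (Φ.Γ (weakUnderlying δ))))
    rw [Φ.map_push, ← push_pull, ← push_comp, ← push_comp, D.p_comp_mapHom]
  map_pull {P Q Q'} c δ := by
    change push S'.E (D.p P) (pull S'.E (D.i Q') (Φ.Γ (pull S.E c.hom.f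
      (weakUnderlying δ)))) = pull S'.E (D.mapHom c)
        (push S'.E (D.p P) (pull S'.E (D.i Q) (Φ.Γ (weakUnderlying δ))))
    rw [Φ.map_pull, ← push_pull, ← pull_comp, ← pull_comp, D.mapHom_comp_i]

/-- The idempotent `p ≫ i = F(e)` arising on the left disappears because the underlying extension is
fixed by `e`. With `pull_p`, this presents the extended value as a direct factor of the original
one. -/
lemma ImageData.push_i {Φ : ExtensionFunctor S S'} (D : ImageData Φ.F) {P Q : WeakCompletion 𝒞}
    (δ : Ext S.weak.E Q P) : push S'.E (D.i P) (D.extend.Γ δ) = pull S'.E (D.i Q)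
      (Φ.Γ (weakUnderlying δ)) := by
  change push S'.E (D.i P) (push S'.E (D.p P) (pull S'.E (D.i Q) (Φ.Γ (weakUnderlying δ)))) = _
  rw [← push_comp, D.p_i, push_pull, ← Φ.map_push, push_p_weakUnderlying]

lemma ImageData.pull_p {Φ : ExtensionFunctor S S'} (D : ImageData Φ.F) {P Q : WeakCompletion 𝒞}
    (δ : Ext S.weak.E Q P) : pull S'.E (D.p Q) (D.extend.Γ δ) = push S'.E (D.p P)
      (Φ.Γ (weakUnderlying δ)) := by
  change pull S'.E (D.p Q) (push S'.E (D.p P) (pull S'.E (D.i Q) (Φ.Γ (weakUnderlying δ)))) = _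
  rw [← push_pull, ← pull_comp, D.p_i, ← Φ.map_pull, pull_p_weakUnderlying]

variable [HasFiniteBiproducts 𝒞]

/-- The extension of an `n`-exangulated functor to the weak idempotent completion is
`n`-exangulated. -/
lemma ImageData.extend_isNExangulated (hS : S.IsNExangulated) (hS' : S'.IsNExangulated)
    {Φ : ExtensionFunctor S S'} (hΦ : Φ.IsNExangulated) (D : ImageData Φ.F) :
    D.extend.IsNExangulated := by
  intro P Q δ Z hZ
  have := hS'.additive
  have : HasZeroObject 𝒟 := hasZeroObject_of_hasFiniteBiproducts _
  -- A strict presentation of `Z` over `𝒞` makes its image under the extended functor a direct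
  -- factor of the image under `F` of a realising complex, which realises by hypothesis on `F`.
  obtain ⟨N⟩ := hS.exists_presentation (P := P.obj) (Q := Q.obj) (δ := δ) hZ
  let i : (Z.map D.functor).K ⟶ (N.X.map Φ.F).K :=
    { f k := D.i (Z.K.X k) ≫ Φ.F.map (N.i.f k).f
      comm' j k _ := D.i_map_comm (congrArg Karoubi.Hom.f (N.i.comm j k)) }
  let r : (N.X.map Φ.F).K ⟶ (Z.map D.functor).K :=
    { f k := Φ.F.map (N.r.f k).f ≫ D.p (Z.K.X k)
      comm' j k _ := D.map_p_comm (congrArg Karoubi.Hom.f (N.r.comm j k)) }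
  refine hS'.isRealisation.realises_of_retract (hΦ _ _ N.realises) (M := Z.map D.functor) i r
    (a := D.i P) (c := D.i Q) (a' := D.p P) (c' := D.p Q) ⟨?_, ?_⟩ ⟨?_, ?_⟩ ?_ (D.i_p P) (D.i_p Q)
    (D.push_i δ) (D.pull_p δ).symm
  · exact (D.i_map_comm (f := Z.left.hom) (congrArg Karoubi.Hom.f N.isLift_i.left)).trans
      (congrArg (D.mapHom Z.left.hom ≫ ·) (D.i_map_p P))
  · exact (D.i_map_comm (f := Z.right.hom) (congrArg Karoubi.Hom.f N.isLift_i.right)).trans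
      (congrArg (D.mapHom Z.right.hom ≫ ·) (D.i_map_p Q))
  · exact (D.map_p_comm (f := Z.left.hom) (congrArg Karoubi.Hom.f N.isLift_r.left)).trans
      (congrArg (Φ.F.map N.X.left.hom ≫ ·) (D.map_p_p P))
  · exact (D.map_p_comm (f := Z.right.hom) (congrArg Karoubi.Hom.f N.isLift_r.right)).trans
      (congrArg (Φ.F.map N.X.right.hom ≫ ·) (D.map_p_p Q))
  · ext k
    exact D.i_map_map_p (congrArg Karoubi.Hom.f (HomologicalComplex.congr_hom N.i_r k))

/-- The extension of `F` restricts to `F`. -/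
def ImageData.restrictIso {F : 𝒞 ⥤ 𝒟} (D : ImageData F) : F ≅ toWeak 𝒞 ⋙ D.functor :=
  NatIso.ofComponents
    (fun X =>
      { hom := D.p ((toWeak 𝒞).obj X)
        inv := D.i ((toWeak 𝒞).obj X)
        hom_inv_id := (D.p_i _).trans (F.map_id X)
        inv_hom_id := D.i_p _ })
    (fun f => (D.p_comp_mapHom ((toWeak 𝒞).map f)).symm)

lemma ImageData.isNExangulatedIso_restrictIso {Φ : ExtensionFunctor S S'} (D : ImageData Φ.F) :
    ExtensionFunctor.IsNExangulatedIso Φ ((inclusion S).comp D.extend) D.restrictIso :=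
  ⟨fun _ _ δ => (D.pull_p ((inclusion S).Γ δ)).symm,
    fun _ _ δ => D.push_i ((inclusion S).Γ δ)⟩

end Extend

end NExang

end

theorem theorem5p5 {C : Type u} [Category.{v} C] [Preadditive C] [HasFiniteBiproducts C] (n : ℕ)
    (S : NExang.ExtensionStructure.{w} C n) (hS : S.IsNExangulated) :
    (S.karoubi.IsNExangulated ∧ S.karoubi.IsExtensionClosed (NExang.weakProp C)) ∧
    (S.weak.IsNExangulated ∧ NExang.IsWeaklyIdempotentComplete (NExang.WeakCompletion C)) ∧
    (NExang.inclusion S).IsNExangulated ∧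
    ∀ (C' : Type u') [Category.{v'} C'] [Preadditive C']
      (S' : NExang.ExtensionStructure.{w'} C' n), S'.IsNExangulated →
      NExang.IsWeaklyIdempotentComplete C' →
      ∀ Φ : NExang.ExtensionFunctor S S', Φ.IsNExangulated →
        (∃ Ψ : NExang.ExtensionFunctor S.weak S', Ψ.IsNExangulated ∧
          ∃ τ : Φ.F ≅ ((NExang.inclusion S).comp Ψ).F,
            NExang.ExtensionFunctor.IsNExangulatedIso Φ ((NExang.inclusion S).comp Ψ) τ) ∧
        (∀ G H : NExang.ExtensionFunctor S.weak S', G.IsNExangulated → H.IsNExangulated →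
          ∀ (β : Φ.F ≅ ((NExang.inclusion S).comp G).F)
            (γ : Φ.F ≅ ((NExang.inclusion S).comp H).F),
            NExang.ExtensionFunctor.IsNExangulatedIso Φ ((NExang.inclusion S).comp G) β →
            NExang.ExtensionFunctor.IsNExangulatedIso Φ ((NExang.inclusion S).comp H) γ →
            ∃! μ : G.F ≅ H.F, NExang.ExtensionFunctor.IsNExangulatedIso G H μ ∧
              γ.hom = β.hom ≫ Functor.whiskerLeft (NExang.inclusion S).F μ.hom) := by
  refine ⟨⟨hS.karoubi, hS.isExtensionClosed_weakProp⟩,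
    ⟨hS.weak, NExang.isWeaklyIdempotentComplete_weakCompletion C⟩,
    NExang.inclusion_isNExangulated, fun C' _ _ S' hS' hW Φ hΦ => ⟨?_, ?_⟩⟩
  · obtain ⟨D⟩ := hW.nonempty_imageData Φ.F
    exact ⟨D.extend, D.extend_isNExangulated hS hS' hΦ, D.restrictIso,
      D.isNExangulatedIso_restrictIso⟩
  · intro G H _ _ β γ hβ hγ
    exact NExang.existsUnique_isNExangulatedIso β γ hβ hγ
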